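/- For a finite simple undirected graph $G=(V,E)$ with edge weights $w:E\to\mathbb Z_{\ge 0}$, the \textsc{Edge-Weighted $q$-Clique} problem asks, given $(G,w,q)$, for a set $S\subseteq V$ with $|S|=q$ that induces a clique of $G$ and optimizes (maximizes, or, in the minimization version, minimizes) $\sum_{e\in E(G[S])}w(e)$ among all $q$-cliques of $G$, or for the answer that $G$ has no $q$-clique. Let $\omega$ be the exponent of matrix multiplication, that is, the infimum of all real $\tau$ such that two $N\times N$ matrices over $\mathbb Q$ can be multiplied with $O(N^{\tau})$ arithmetic operations $+,-,\times$. For both versions of the problem, \textsc{Edge-Weighted $3k$-Clique} on graphs with $n$ vertices and integer edge weights in $[0,W]$ can be solved in time $O^*(n^{\omega k}\,W)$, where, as usual, $\omega$ in a running time stands for $\omega+\varepsilon$ with an arbitrarily small constant $\varepsilon>0$, and $O^*$ hides factors polynomial in the input size (in particular in $n$ and $\log W$, but not in $W$). Precisely: for each of the two versions and every $\varepsilon>0$ there are a deterministic random access machine program (with logarithmic cost) and constants $C,c$, depending only on the version and on $\varepsilon$, such that for all integers $n\ge 1$, $k\ge 0$, $W\ge 1$, and every graph $G$ on $n$ vertices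 with integer edge weights in $[0,W]$, the program, given $G$, $w$ and $3k$ as an input of bit length $L$, outputs a correct answer in time at most \[ C\cdot n^{(\omega+\varepsilon)k}\cdot W\cdot L^{c}. \] -/

import Mathlib

/-! ### The exponent of matrix multiplication -/

namespace MatMul

/-- `StraightLine L S`: some division-free straight-line program over `ℚ` with the indeterminates
`X i` and all rational constants as inputs, and with exactly `L` arithmetic operations, has `S` as
the set of its inputs and intermediate results. -/
inductive StraightLine {σ : Type} : ℕ → Set (MvPolynomial σ ℚ) → Prop
  | start : StraightLine 0 (Set.range MvPolynomial.X ∪ Set.range MvPolynomial.C)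
  | add {L : ℕ} {S : Set (MvPolynomial σ ℚ)} {f g : MvPolynomial σ ℚ} :
      StraightLine L S → f ∈ S → g ∈ S → StraightLine (L + 1) (insert (f + g) S)
  | sub {L : ℕ} {S : Set (MvPolynomial σ ℚ)} {f g : MvPolynomial σ ℚ} :
      StraightLine L S → f ∈ S → g ∈ S → StraightLine (L + 1) (insert (f - g) S)
  | mul {L : ℕ} {S : Set (MvPolynomial σ ℚ)} {f g : MvPolynomial σ ℚ} :
      StraightLine L S → f ∈ S → g ∈ S → StraightLine (L + 1) (insert (f * g) S)

/-- The entry `(i, j)` of the product of two generic `N × N` matrices; `Sum.inl` indexes the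
entries of the first factor, `Sum.inr` those of the second. -/
noncomputable def productEntry (N : ℕ) (i j : Fin N) :
    MvPolynomial ((Fin N × Fin N) ⊕ (Fin N × Fin N)) ℚ :=
  ∑ l : Fin N, MvPolynomial.X (Sum.inl (i, l)) * MvPolynomial.X (Sum.inr (l, j))

/-- Two generic `N × N` matrices can be multiplied with `L` arithmetic operations. -/
def MultipliableWith (N L : ℕ) : Prop :=
  ∃ S : Set (MvPolynomial ((Fin N × Fin N) ⊕ (Fin N × Fin N)) ℚ),
    StraightLine L S ∧ ∀ i j : Fin N, productEntry N i j ∈ S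

/-- The exponent `ω` of matrix multiplication: the infimum of all real `τ` such that `N × N`
matrices can be multiplied with `O(N ^ τ)` arithmetic operations. -/
noncomputable def omega : ℝ :=
  sInf {τ : ℝ | ∃ C : ℝ, ∀ N : ℕ, ∃ L : ℕ, MultipliableWith N L ∧ (L : ℝ) ≤ C * (N : ℝ) ^ τ}

end MatMul

/-! ### Random access machine with logarithmic cost

Programs are structured (`while`-)programs over finitely many registers and one unbounded,
indirectly addressed memory, all holding natural numbers. Every access and every operation is
charged by the bit lengths (`Nat.size`) of the numbers involved, including addresses;
multiplication and division are charged the cost of the schoolbook methods. -/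

namespace RAM

structure State where
  reg : ℕ → ℕ
  mem : ℕ → ℕ

inductive Op
  | add
  | sub
  | mul
  | div

/-- Subtraction is truncated at `0`, division is rounded down, and division by `0` gives `0`. -/
def Op.eval : Op → ℕ → ℕ → ℕ
  | .add, a, b => a + b
  | .sub, a, b => a - b
  | .mul, a, b => a * b
  | .div, a, b => a / b

def Op.cost : Op → ℕ → ℕ → ℕ
  | .add, a, b => a.size + b.size + 1
  | .sub, a, b => a.size + b.size + 1
  | .mul, a, b => (a.size + 1) * (b.size + 1)
  | .div, a, b => (a.size + 1) * (b.size + 1)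

inductive Expr
  | const (c : ℕ)
  | reg (r : ℕ)
  | load (address : Expr)
  | bin (op : Op) (a b : Expr)

def Expr.eval (s : State) : Expr → ℕ
  | .const c => c
  | .reg r => s.reg r
  | .load a => s.mem (a.eval s)
  | .bin op a b => op.eval (a.eval s) (b.eval s)

def Expr.cost (s : State) : Expr → ℕ
  | .const c => c.size + 1
  | .reg r => (s.reg r).size + 1
  | .load a => a.cost s + (a.eval s).size + (s.mem (a.eval s)).size + 1
  | .bin op a b => a.cost s + b.cost s + op.cost (a.eval s) (b.eval s)

inductive Program
  | skip
  | assign (r : ℕ) (e : Expr)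
  | store (address e : Expr)
  | seq (p q : Program)
  | cond (test : Expr) (p q : Program)
  | loop (test : Expr) (p : Program)

/-- `Run p s s' t`: started in the state `s`, the program `p` halts in the state `s'`, at the total
cost `t`. Tests succeed on non-zero values; `loop` is the `while` loop. -/
inductive Run : Program → State → State → ℕ → Prop
  | skip {s : State} : Run .skip s s 1
  | assign {s : State} {r : ℕ} {e : Expr} :
      Run (.assign r e) s { s with reg := Function.update s.reg r (e.eval s) }
        (e.cost s + (e.eval s).size + 1)
  | store {s : State} {a e : Expr} :
      Run (.store a e) s { s with mem := Function.update s.mem (a.eval s) (e.eval s) }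
        (a.cost s + e.cost s + (a.eval s).size + (e.eval s).size + 1)
  | seq {p q : Program} {s s' s'' : State} {t t' : ℕ} :
      Run p s s' t → Run q s' s'' t' → Run (.seq p q) s s'' (t + t')
  | cond_true {b : Expr} {p q : Program} {s s' : State} {t : ℕ} :
      b.eval s ≠ 0 → Run p s s' t → Run (.cond b p q) s s' (b.cost s + 1 + t)
  | cond_false {b : Expr} {p q : Program} {s s' : State} {t : ℕ} :
      b.eval s = 0 → Run q s s' t → Run (.cond b p q) s s' (b.cost s + 1 + t)
  | loop_done {b : Expr} {p : Program} {s : State} :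
      b.eval s = 0 → Run (.loop b p) s s (b.cost s + 1)
  | loop_step {b : Expr} {p : Program} {s s' s'' : State} {t t' : ℕ} :
      b.eval s ≠ 0 → Run p s s' t → Run (.loop b p) s' s'' t' →
        Run (.loop b p) s s'' (b.cost s + 1 + t + t')

/-- The input is written into the memory cells `0, 1, 2, …`; everything else is `0`. -/
def initial (input : List ℕ) : State where
  reg := fun _ => 0
  mem := fun i => input.getD i 0

/-- On the given input the program halts at cost `t`, with the output in the memory cells
`0, 1, 2, …`. (`Run` is deterministic, so a program has at most one run on an input.) -/
def Program.Computes (p : Program) (input output : List ℕ) (t : ℕ) : Prop :=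
  ∃ s : State, Run p (initial input) s t ∧
    ∀ (i : ℕ) (h : i < output.length), s.mem i = output[i]

/-- The size of an input: the total bit length of its numbers, each with one separator. -/
def inputSize (input : List ℕ) : ℕ :=
  (input.map fun x => x.size + 1).sum

end RAM

/-! ### The edge-weighted clique problem -/

namespace WeightedClique

/-- The optimization direction. -/
inductive Objective
  | maximize
  | minimize

open Classical in
/-- The total weight of the edges of `G` with both ends in `S`. -/
noncomputable def weight {n : ℕ} (G : SimpleGraph (Fin n)) (w : Sym2 (Fin n) → ℕ)
    (S : Finset (Fin n)) : ℕ :=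
  ∑ e : Sym2 (Fin n) with e ∈ G.edgeSet ∧ ∀ v ∈ e, v ∈ S, w e

/-- `S` is a `q`-clique of maximum, respectively minimum, weight among all `q`-cliques of `G`. -/
def IsOptimal {n : ℕ} (G : SimpleGraph (Fin n)) (w : Sym2 (Fin n) → ℕ) (q : ℕ)
    (S : Finset (Fin n)) : Objective → Prop
  | .maximize => G.IsNClique q S ∧ ∀ T, G.IsNClique q T → weight G w T ≤ weight G w S
  | .minimize => G.IsNClique q S ∧ ∀ T, G.IsNClique q T → weight G w S ≤ weight G w T

/-- Correct answers: an optimal `q`-clique, or `none` if `G` has no `q`-clique. -/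
def IsAnswer {n : ℕ} (G : SimpleGraph (Fin n)) (w : Sym2 (Fin n) → ℕ) (q : ℕ)
    (obj : Objective) : Option (Finset (Fin n)) → Prop
  | some S => IsOptimal G w q S obj
  | none => G.CliqueFree q

open Classical in
/-- An instance is given as `n`, `q`, and the `n × n` adjacency matrix in row-major order, with
entry `w(uv) + 1` for an edge `uv` and `0` for a non-edge. -/
noncomputable def encodeInstance {n : ℕ} (G : SimpleGraph (Fin n)) (w : Sym2 (Fin n) → ℕ)
    (q : ℕ) : List ℕ :=
  n :: q :: List.ofFn fun t : Fin (n * n) =>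
    if G.Adj t.divNat t.modNat then w s(t.divNat, t.modNat) + 1 else 0

/-- An answer is given as `0` for `none`, and as `1` followed by the indicator vector of `S` for
`some S`. -/
def encodeAnswer {n : ℕ} : Option (Finset (Fin n)) → List ℕ
  | some S => 1 :: List.ofFn fun v : Fin n => if v ∈ S then 1 else 0
  | none => [0]

end WeightedClique

/-! Let `A` be the matrix indexed by `k`-tuples of vertices whose entry at `(I, J)` is `x` to the
total weight of the pairs inside `I` and between `I` and `J`, and `0` if one of these pairs is a
non-edge. In the trace of `A ^ 3` every pair of positions of a `3k`-tuple is counted once, so the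
trace is the sum of `x ^ weight` over all tuples that form a clique (`trace_eq`,
`sum_pairProd_edgePow`). Its degree in `x` is the maximum weight of a `3k`-clique.

The trace is computed by fast matrix multiplication. The mixed second-order coefficients of the
results of a straight-line program with `L` operations are spanned by `2 * L` rank-one matrices
(`StraightLine.exists_rank_one`). For a suitable fixed `g` this decomposes the tensor of `g × g`
multiplication into `R ≤ g ^ (omega + ε)` terms, with integer coefficients after scaling by some `D`
(`exists_decomposition_rpow`). The `m`-th tensor power, applied digit by digit, yields `D ^ m` times
the trace for matrices of side `g ^ m` (`sum_transform`). With `m` minimal such that `n ^ k ≤ g ^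
m`, the rank `R ^ m` is `O(n ^ ((omega + ε) * k))` (`rank_pow_le`).

The degree is read off without interpolation: the trace is evaluated at consecutive integers from
`0` to a bound on the degree, and the largest order of a nonzero finite difference at `0` is the
degree. All arithmetic is modulo `p ^ j`, where the prime `p` exceeds the degree bound and `D`, and
`p ^ j` exceeds the number of tuples; hence no leading coefficient is lost
(`sup_eq_of_differences`).

An optimal clique is found by deleting vertices one after another as long as the optimum persists
(`isOptimal_greedy`). Minimization reduces to maximization by replacing `w` with `c - w`, since all
cliques of one size have equally many edges.

The number of evaluations is proportional to the largest weight, up to polynomial factors. The prime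
search and the difference table need a number of steps quadratic in the degree bound, which is
affordable while the largest entry `w` is at most `n ^ k`. Otherwise exhaustive search over `n ^ (3
* k) ≤ n ^ (2 * k) * w` tuples is fast enough, because `2 ≤ omega` (`two_le_omega`). Both cases are
settled in `exists_lim`.

The program is written in a small language of counting loops with rules for verification and a
translation into RAM programs (`exists_program`). All numbers have at most quadratically many bits
in the input size, so each step has polynomial logarithmic cost. -/

set_option linter.unusedSectionVars false
set_option linter.constructorNameAsVariable false

/-! ### Bit lengths of RAM computations -/

namespace RAM

/-- Every register and every memory cell holds a number of at most `B` bits. -/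
def State.Bounded (B : ℕ) (σ : State) : Prop :=
  (∀ r, (σ.reg r).size ≤ B) ∧ ∀ a, (σ.mem a).size ≤ B

theorem size_add_le (a b : ℕ) : (a + b).size ≤ a.size + b.size + 1 := by
  rw [Nat.size_le]
  have ha := Nat.lt_size_self a
  have hb := Nat.lt_size_self b
  have h1 : 2 ^ a.size ≤ 2 ^ (a.size + b.size) := Nat.pow_le_pow_right (by norm_num) (by omega)
  have h2 : 2 ^ b.size ≤ 2 ^ (a.size + b.size) := Nat.pow_le_pow_right (by norm_num) (by omega)
  rw [pow_succ]
  omega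

theorem size_mul_le (a b : ℕ) : (a * b).size ≤ a.size + b.size := by
  rw [Nat.size_le, pow_add]
  exact Nat.mul_lt_mul'' (Nat.lt_size_self a) (Nat.lt_size_self b)

theorem Op.size_eval_le (op : Op) (a b : ℕ) : (op.eval a b).size ≤ a.size + b.size + 1 := by
  cases op with
  | add => exact size_add_le a b
  | sub => exact (Nat.size_le_size (Nat.sub_le a b)).trans (by omega)
  | mul => exact (size_mul_le a b).trans (by omega)
  | div => exact (Nat.size_le_size (Nat.div_le_self a b)).trans (by omega)

/-- A constant bounding, relative to the bit lengths in the state, the bit length of the value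
of an expression. -/
def Expr.growth : Expr → ℕ
  | .const c => c.size
  | .reg _ => 1
  | .load _ => 1
  | .bin _ a b => a.growth + b.growth + 1

/-- A constant bounding, relative to the bit lengths in the state, the cost of an expression. -/
def Expr.factor : Expr → ℕ
  | .const c => c.size + 1
  | .reg _ => 1
  | .load a => a.factor + a.growth + 1
  | .bin _ a b => a.factor + b.factor + (a.growth + 1) * (b.growth + 1)

theorem Expr.size_eval_le {B : ℕ} {σ : State} (h : σ.Bounded B) :
    ∀ e : Expr, (e.eval σ).size ≤ e.growth * (B + 1)
  | .const c => Nat.le_mul_of_pos_right _ (Nat.succ_pos B)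
  | .reg r => (h.1 r).trans (by simp [growth])
  | .load a => (h.2 _).trans (by simp [growth])
  | .bin op a b => by
    have ha := Expr.size_eval_le h a
    have hb := Expr.size_eval_le h b
    refine (op.size_eval_le _ _).trans ?_
    rw [growth]
    linarith

/-- The square appears because a product or quotient is charged the product of two bit lengths, each
linear in `B + 1`. -/
theorem Expr.cost_le {B : ℕ} {σ : State} (h : σ.Bounded B) :
    ∀ e : Expr, e.cost σ ≤ e.factor * (B + 1) ^ 2
  | .const c => Nat.le_mul_of_pos_right _ (by positivity)
  | .reg r => by
    have := h.1 r
    rw [cost, factor]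
    nlinarith
  | .load a => by
    have h1 := Expr.cost_le h a
    have h2 := Expr.size_eval_le h a
    have h3 := h.2 (a.eval σ)
    rw [cost, factor]
    have h4 : a.growth * (B + 1) ≤ a.growth * (B + 1) ^ 2 :=
      Nat.mul_le_mul_left _ (by nlinarith)
    nlinarith
  | .bin op a b => by
    have h1 := Expr.cost_le h a
    have h2 := Expr.cost_le h b
    have h3 := Expr.size_eval_le h a
    have h4 := Expr.size_eval_le h b
    have h5 : op.cost (a.eval σ) (b.eval σ) ≤ ((a.eval σ).size + 1) * ((b.eval σ).size + 1) := by
      cases op <;> simp only [Op.cost] <;> nlinarith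
    have h6 : ((a.eval σ).size + 1) * ((b.eval σ).size + 1) ≤
        ((a.growth + 1) * (B + 1)) * ((b.growth + 1) * (B + 1)) :=
      Nat.mul_le_mul (by linarith) (by linarith)
    rw [cost, factor]
    linarith

theorem State.Bounded.update_reg {B : ℕ} {σ : State} (h : σ.Bounded B) (r x : ℕ)
    (hx : x.size ≤ B) : State.Bounded B { σ with reg := Function.update σ.reg r x } := by
  refine ⟨fun r' => ?_, h.2⟩
  by_cases hr : r' = r
  · subst hr; simpa using hx
  · simpa [hr] using h.1 r'

theorem State.Bounded.update_mem {B : ℕ} {σ : State} (h : σ.Bounded B) (a x : ℕ)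
    (hx : x.size ≤ B) : State.Bounded B { σ with mem := Function.update σ.mem a x } := by
  refine ⟨h.1, fun a' => ?_⟩
  by_cases ha : a' = a
  · subst ha; simpa using hx
  · simpa [ha] using h.2 a'

/-- A constant bounding the cost of a program relative to the number of its steps. -/
def Program.factor : Program → ℕ
  | .skip => 1
  | .assign _ e => e.factor + e.growth + 1
  | .store a e => a.factor + e.factor + a.growth + e.growth + 1
  | .seq p q => p.factor + q.factor
  | .cond b p q => b.factor + 1 + p.factor + q.factor
  | .loop b p => b.factor + 1 + p.factor

/-- `p` runs from `σ` to `σ'` in (at most) `T` steps, and all numbers keep at most `B` bits. -/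
def Steps (B : ℕ) (p : Program) (σ σ' : State) (T : ℕ) : Prop :=
  ∃ t, Run p σ σ' t ∧ t ≤ p.factor * (B + 1) ^ 2 * T ∧ σ'.Bounded B

theorem Steps.assign {B : ℕ} {σ : State} (h : σ.Bounded B) (r : ℕ) (e : Expr)
    (he : (e.eval σ).size ≤ B) :
    Steps B (.assign r e) σ { σ with reg := Function.update σ.reg r (e.eval σ) } 1 := by
  refine ⟨_, Run.assign, ?_, h.update_reg _ _ he⟩
  have h1 := e.cost_le h
  have h2 := e.size_eval_le h
  have h4 : e.growth * (B + 1) ≤ e.growth * (B + 1) ^ 2 := Nat.mul_le_mul_left _ (by nlinarith)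
  rw [Program.factor]
  nlinarith

theorem Steps.store {B : ℕ} {σ : State} (h : σ.Bounded B) (a e : Expr)
    (he : (e.eval σ).size ≤ B) :
    Steps B (.store a e) σ { σ with mem := Function.update σ.mem (a.eval σ) (e.eval σ) } 1 := by
  refine ⟨_, Run.store, ?_, h.update_mem _ _ he⟩
  have h1 := e.cost_le h
  have h2 := e.size_eval_le h
  have h1' := a.cost_le h
  have h2' := a.size_eval_le h
  have h4 : e.growth * (B + 1) ≤ e.growth * (B + 1) ^ 2 := Nat.mul_le_mul_left _ (by nlinarith)
  have h5 : a.growth * (B + 1) ≤ a.growth * (B + 1) ^ 2 := Nat.mul_le_mul_left _ (by nlinarith)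
  rw [Program.factor]
  nlinarith

theorem Steps.mono {B : ℕ} {p : Program} {σ σ' : State} {T T' : ℕ} (h : Steps B p σ σ' T)
    (hT : T ≤ T') : Steps B p σ σ' T' := by
  obtain ⟨t, h1, h2, h3⟩ := h
  exact ⟨t, h1, h2.trans (Nat.mul_le_mul_left _ hT), h3⟩

/-- Every part is charged at the factor of the whole program, which is the sum of the factors of the
parts. This is why step numbers can be added although the parts have different factors. -/
theorem Steps.seq {B : ℕ} {p q : Program} {σ σ' σ'' : State} {T T' : ℕ}
    (h : Steps B p σ σ' T) (h' : Steps B q σ' σ'' T') :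
    Steps B (.seq p q) σ σ'' (T + T') := by
  obtain ⟨t, h1, h2, h3⟩ := h
  obtain ⟨t', h1', h2', h3'⟩ := h'
  refine ⟨_, Run.seq h1 h1', ?_, h3'⟩
  rw [Program.factor]
  refine (Nat.add_le_add h2 h2').trans ?_
  have e1 := Nat.zero_le (p.factor * (B + 1) ^ 2 * T')
  have e2 := Nat.zero_le (q.factor * (B + 1) ^ 2 * T)
  nlinarith

theorem Steps.cond_true {B : ℕ} {b : Expr} {p q : Program} {σ σ' : State} {T : ℕ}
    (hσ : σ.Bounded B) (hb : b.eval σ ≠ 0) (h : Steps B p σ σ' T) :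
    Steps B (.cond b p q) σ σ' (T + 1) := by
  obtain ⟨t, h1, h2, h3⟩ := h
  refine ⟨_, Run.cond_true hb h1, ?_, h3⟩
  have := b.cost_le hσ
  rw [Program.factor]
  have e : 1 ≤ (B + 1) ^ 2 := Nat.one_le_pow _ _ (Nat.succ_pos B)
  calc b.cost σ + 1 + t
      ≤ (b.factor * (B + 1) ^ 2 + (B + 1) ^ 2) + p.factor * (B + 1) ^ 2 * T := by omega
    _ ≤ (b.factor * (B + 1) ^ 2 + (B + 1) ^ 2) * (T + 1) + p.factor * (B + 1) ^ 2 * (T + 1)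
        + q.factor * (B + 1) ^ 2 * (T + 1) := by
      have := Nat.le_mul_of_pos_right (b.factor * (B + 1) ^ 2 + (B + 1) ^ 2) (Nat.succ_pos T)
      have := Nat.mul_le_mul_left (p.factor * (B + 1) ^ 2) (Nat.le_succ T)
      simp only [Nat.succ_eq_add_one] at *
      omega
    _ = _ := by ring

theorem Steps.cond_false {B : ℕ} {b : Expr} {p q : Program} {σ σ' : State} {T : ℕ}
    (hσ : σ.Bounded B) (hb : b.eval σ = 0) (h : Steps B q σ σ' T) :
    Steps B (.cond b p q) σ σ' (T + 1) := by
  obtain ⟨t, h1, h2, h3⟩ := h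
  refine ⟨_, Run.cond_false hb h1, ?_, h3⟩
  have := b.cost_le hσ
  rw [Program.factor]
  have e : 1 ≤ (B + 1) ^ 2 := Nat.one_le_pow _ _ (Nat.succ_pos B)
  calc b.cost σ + 1 + t
      ≤ (b.factor * (B + 1) ^ 2 + (B + 1) ^ 2) + q.factor * (B + 1) ^ 2 * T := by omega
    _ ≤ (b.factor * (B + 1) ^ 2 + (B + 1) ^ 2) * (T + 1) + p.factor * (B + 1) ^ 2 * (T + 1)
        + q.factor * (B + 1) ^ 2 * (T + 1) := by
      have := Nat.le_mul_of_pos_right (b.factor * (B + 1) ^ 2 + (B + 1) ^ 2) (Nat.succ_pos T)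
      have := Nat.mul_le_mul_left (q.factor * (B + 1) ^ 2) (Nat.le_succ T)
      simp only [Nat.succ_eq_add_one] at *
      omega
    _ = _ := by ring

theorem Steps.loop_done {B : ℕ} {b : Expr} {p : Program} {σ : State}
    (hσ : σ.Bounded B) (hb : b.eval σ = 0) : Steps B (.loop b p) σ σ 1 := by
  refine ⟨_, Run.loop_done hb, ?_, hσ⟩
  have := b.cost_le hσ
  rw [Program.factor]
  nlinarith [Nat.zero_le (p.factor * (B + 1) ^ 2), Nat.one_le_pow 2 _ (Nat.succ_pos B)]

theorem Steps.loop_step {B : ℕ} {b : Expr} {p : Program} {σ σ' σ'' : State} {T T' : ℕ}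
    (hσ : σ.Bounded B) (hb : b.eval σ ≠ 0) (h : Steps B p σ σ' T)
    (h' : Steps B (.loop b p) σ' σ'' T') :
    Steps B (.loop b p) σ σ'' (T + 1 + T') := by
  obtain ⟨t, h1, h2, h3⟩ := h
  obtain ⟨t', h1', h2', h3'⟩ := h'
  refine ⟨_, Run.loop_step hb h1 h1', ?_, h3'⟩
  have := b.cost_le hσ
  rw [Program.factor] at h2' ⊢
  have e : 1 ≤ (B + 1) ^ 2 := Nat.one_le_pow _ _ (Nat.succ_pos B)
  rw [Nat.mul_add _ (T + 1)]
  refine Nat.add_le_add ?_ h2'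
  calc b.cost σ + 1 + t
      ≤ (b.factor * (B + 1) ^ 2 + (B + 1) ^ 2) + p.factor * (B + 1) ^ 2 * T := by omega
    _ ≤ (b.factor * (B + 1) ^ 2 + (B + 1) ^ 2) * (T + 1) + p.factor * (B + 1) ^ 2 * (T + 1) := by
      have := Nat.le_mul_of_pos_right (b.factor * (B + 1) ^ 2 + (B + 1) ^ 2) (Nat.succ_pos T)
      have := Nat.mul_le_mul_left (p.factor * (B + 1) ^ 2) (Nat.le_succ T)
      simp only [Nat.succ_eq_add_one] at *
      omega
    _ = _ := by ring

/-- The counting loop `for v := 0, …, b - 1 do p`. The body must change neither `v` nor `b`. -/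
def Program.forLoop (v b : ℕ) (p : Program) : Program :=
  .seq (.assign v (.const 0)) (.loop (.bin .sub (.reg b) (.reg v))
    (.seq p (.assign v (.bin .add (.reg v) (.const 1)))))

/-- Counting loops: `I i` holds after `i` iterations, when the counter has the value `i`. -/
theorem Steps.forLoop {B : ℕ} {p : Program} {v b N T : ℕ} {σ : State} (hσ : σ.Bounded B)
    (hvb : v ≠ b) (hN : σ.reg b = N) (I : ℕ → State → Prop)
    (h0 : I 0 { σ with reg := Function.update σ.reg v 0 })
    (hstep : ∀ i < N, ∀ σ₁ : State, σ₁.Bounded B → σ₁.reg v = i → σ₁.reg b = N → I i σ₁ →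
      ∃ σ₂, Steps B p σ₁ σ₂ T ∧ σ₂.reg v = i ∧ σ₂.reg b = N ∧
        I (i + 1) { σ₂ with reg := Function.update σ₂.reg v (i + 1) }) :
    ∃ σ', Steps B (.forLoop v b p) σ σ' (N * (T + 2) + 2) ∧ σ'.reg v = N ∧ I N σ' := by
  have hNB : N.size ≤ B := hN ▸ hσ.1 b
  -- Induction on the number `j` of remaining iterations. The counter stays at most `N`, hence
  -- within `B` bits, since the register `b` already holds `N`.
  have key : ∀ j i, i + j = N → ∀ σ₁ : State, σ₁.Bounded B → σ₁.reg v = i → σ₁.reg b = N →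
      I i σ₁ → ∃ σ', Steps B (.loop (.bin .sub (.reg b) (.reg v))
        (.seq p (.assign v (.bin .add (.reg v) (.const 1))))) σ₁ σ' (j * (T + 2) + 1) ∧
        σ'.reg v = N ∧ I N σ' := by
    intro j
    induction j with
    | zero =>
      intro i hi σ₁ h1 h2 h3 h4
      obtain rfl : i = N := by omega
      refine ⟨σ₁, ?_, h2, h4⟩
      rw [Nat.zero_mul, Nat.zero_add]
      exact Steps.loop_done h1 (by simp [Expr.eval, Op.eval, h2, h3])
    | succ j ih =>
      intro i hi σ₁ h1 h2 h3 h4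
      obtain ⟨σ₂, k1, k2, k3, k4⟩ := hstep i (by omega) σ₁ h1 h2 h3 h4
      have hB2 : σ₂.Bounded B := k1.choose_spec.2.2
      have hi1 : (i + 1).size ≤ B := (Nat.size_le_size (by omega)).trans hNB
      have ha := Steps.assign hB2 v (.bin .add (.reg v) (.const 1))
        (by simpa [Expr.eval, Op.eval, k2] using hi1)
      simp only [Expr.eval, Op.eval, k2] at ha
      obtain ⟨σ', l1, l2, l3⟩ := ih (i + 1) (by omega) _ (hB2.update_reg v (i + 1) hi1)
        (by simp) (by simpa [hvb.symm] using k3) k4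
      refine ⟨σ', ?_, l2, l3⟩
      have := Steps.loop_step h1 (by simp [Expr.eval, Op.eval, h2, h3]; omega) (k1.seq ha) l1
      -- An iteration costs `T` for the body, one step for the increment and one for the test.
      exact this.mono (by rw [Nat.succ_mul]; omega)
  have hA := Steps.assign hσ v (.const 0) (by simp [Expr.eval])
  obtain ⟨σ', l1, l2, l3⟩ := key N 0 (by omega) _ (hσ.update_reg v 0 (by simp)) (by simp)
    (by simpa [hvb.symm] using hN) h0
  exact ⟨σ', (hA.seq l1).mono (by omega), l2, l3⟩

end RAM

/-! ### A language of counting loops over registers and arrays -/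

namespace LoopLang

open RAM (State Steps)

/-- A state: registers named by `V` and unbounded arrays named by `A`. -/
structure St (V A : Type) where
  reg : V → ℕ
  arr : A → ℕ → ℕ

inductive Ex (V A : Type)
  | const (c : ℕ)
  | var (v : V)
  | get (a : A) (i : Ex V A)
  | bin (op : RAM.Op) (x y : Ex V A)
  | mod (x y : Ex V A)

inductive Pr (V A : Type)
  | skip
  | assign (v : V) (e : Ex V A)
  | store (a : A) (i e : Ex V A)
  | seq (p q : Pr V A)
  | ite (e : Ex V A) (p q : Pr V A)
  | loop (v b : V) (p : Pr V A)

/-- Upper bounds for the contents of the registers and of the arrays. -/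
structure Bounds (V A : Type) where
  reg : V → ℕ
  arr : A → ℕ

variable {V A : Type}

def Ex.ev (s : St V A) : Ex V A → ℕ
  | .const c => c
  | .var v => s.reg v
  | .get a i => s.arr a (i.ev s)
  | .bin op x y => op.eval (x.ev s) (y.ev s)
  | .mod x y => x.ev s % y.ev s

variable [DecidableEq V] [DecidableEq A]

def St.set (s : St V A) (v : V) (x : ℕ) : St V A :=
  { s with reg := Function.update s.reg v x }

def St.put (s : St V A) (a : A) (i x : ℕ) : St V A :=
  { s with arr := Function.update s.arr a (Function.update (s.arr a) i x) }

/-- `iter f i s` applies `f 0`, `f 1`, …, `f (i - 1)` to `s`, in this order. -/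
def iter {S : Type} (f : ℕ → S → S) : ℕ → S → S
  | 0, s => s
  | i + 1, s => f i (iter f i s)

/-- The state after the execution; `loop v b p` executes `p` for `v = 0, …, b - 1`. -/
def Pr.run : Pr V A → St V A → St V A
  | .skip, s => s
  | .assign v e, s => s.set v (e.ev s)
  | .store a i e, s => s.put a (i.ev s) (e.ev s)
  | .seq p q, s => q.run (p.run s)
  | .ite e p q, s => if e.ev s ≠ 0 then p.run s else q.run s
  | .loop v b p, s => (iter (fun i s' => p.run (s'.set v i)) (s.reg b) s).set v (s.reg b)

/-- All numbers assigned during the execution respect the bounds. -/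
def Pr.Safe (β : Bounds V A) : Pr V A → St V A → Prop
  | .skip, _ => True
  | .assign v e, s => e.ev s ≤ β.reg v
  | .store a _ e, s => e.ev s ≤ β.arr a
  | .seq p q, s => p.Safe β s ∧ q.Safe β (p.run s)
  | .ite e p q, s => (e.ev s ≠ 0 → p.Safe β s) ∧ (e.ev s = 0 → q.Safe β s)
  | .loop v b p, s => s.reg b ≤ β.reg v ∧
      ∀ i < s.reg b, p.Safe β ((iter (fun i s' => p.run (s'.set v i)) i s).set v i)

/-- The number of steps that the bounds allow. -/
def Pr.steps (β : Bounds V A) : Pr V A → ℕ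
  | .skip => 1
  | .assign _ _ => 1
  | .store _ _ _ => 1
  | .seq p q => p.steps β + q.steps β
  | .ite _ p q => p.steps β + q.steps β + 1
  | .loop _ b p => β.reg b * (p.steps β + 2) + 2

/-- A computable test, so that for a concrete program `rfl` proves that a register is left alone. -/
def Pr.writes : Pr V A → V → Bool
  | .skip, _ => false
  | .assign v _, x => x == v
  | .store _ _ _, _ => false
  | .seq p q, x => p.writes x || q.writes x
  | .ite _ p q, x => p.writes x || q.writes x
  | .loop v _ p, x => x == v || p.writes x

def Pr.alters : Pr V A → A → Bool
  | .skip, _ => false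
  | .assign _ _, _ => false
  | .store a _ _, x => x == a
  | .seq p q, x => p.alters x || q.alters x
  | .ite _ p q, x => p.alters x || q.alters x
  | .loop _ _ p, x => p.alters x

/-- No loop body changes the counter or the bound of its loop. -/
def Pr.wf : Pr V A → Bool
  | .seq p q => p.wf && q.wf
  | .ite _ p q => p.wf && q.wf
  | .loop v b p => p.wf && !p.writes v && !p.writes b && !(v == b)
  | _ => true

@[simp] theorem St.set_reg (s : St V A) (v : V) (x : ℕ) (u : V) :
    (s.set v x).reg u = if u = v then x else s.reg u := by
  simp [St.set, Function.update_apply]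

@[simp] theorem St.set_arr (s : St V A) (v : V) (x : ℕ) : (s.set v x).arr = s.arr := rfl

@[simp] theorem St.put_reg (s : St V A) (a : A) (i x : ℕ) : (s.put a i x).reg = s.reg := rfl

@[simp] theorem St.put_arr (s : St V A) (a : A) (i x : ℕ) (c : A) (j : ℕ) :
    (s.put a i x).arr c j = if c = a ∧ j = i then x else s.arr c j := by
  by_cases h : c = a
  · subst h; simp [St.put, Function.update_apply]
  · simp [St.put, h]

theorem Pr.run_reg {x : V} : ∀ (p : Pr V A) (s : St V A), p.writes x = false →
    (p.run s).reg x = s.reg x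
  | .skip, s, _ => rfl
  | .assign v e, s, h => by
    have : x ≠ v := by simpa [Pr.writes] using h
    simp [Pr.run, this]
  | .store a i e, s, h => rfl
  | .seq p q, s, h => by
    simp only [Pr.writes, Bool.or_eq_false_iff] at h
    rw [Pr.run, Pr.run_reg q _ h.2, Pr.run_reg p _ h.1]
  | .ite e p q, s, h => by
    simp only [Pr.writes, Bool.or_eq_false_iff] at h
    rw [Pr.run]
    split
    · exact Pr.run_reg p _ h.1
    · exact Pr.run_reg q _ h.2
  | .loop v b p, s, h => by
    simp only [Pr.writes, Bool.or_eq_false_iff, beq_eq_false_iff_ne] at h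
    have key : ∀ i, (iter (fun i s' => p.run (s'.set v i)) i s).reg x = s.reg x := by
      intro i
      induction i with
      | zero => rfl
      | succ i ih => rw [iter, Pr.run_reg p _ h.2, St.set_reg, if_neg h.1, ih]
    rw [Pr.run, St.set_reg, if_neg h.1, key]

theorem Pr.run_arr {x : A} : ∀ (p : Pr V A) (s : St V A), p.alters x = false →
    (p.run s).arr x = s.arr x
  | .skip, s, _ => rfl
  | .assign v e, s, h => rfl
  | .store a i e, s, h => by
    have : x ≠ a := by simpa [Pr.alters] using h
    simp [Pr.run, St.put, this]
  | .seq p q, s, h => by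
    simp only [Pr.alters, Bool.or_eq_false_iff] at h
    rw [Pr.run, Pr.run_arr q _ h.2, Pr.run_arr p _ h.1]
  | .ite e p q, s, h => by
    simp only [Pr.alters, Bool.or_eq_false_iff] at h
    rw [Pr.run]
    split
    · exact Pr.run_arr p _ h.1
    · exact Pr.run_arr q _ h.2
  | .loop v b p, s, h => by
    simp only [Pr.alters] at h
    have key : ∀ i, (iter (fun i s' => p.run (s'.set v i)) i s).arr x = s.arr x := by
      intro i
      induction i with
      | zero => rfl
      | succ i ih => rw [iter, Pr.run_arr p _ h, St.set_arr, ih]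
    rw [Pr.run, St.set_arr, key]

/-- The state respects the bounds. -/
def St.Within (β : Bounds V A) (s : St V A) : Prop :=
  (∀ v, s.reg v ≤ β.reg v) ∧ ∀ a i, s.arr a i ≤ β.arr a

theorem St.Within.set {β : Bounds V A} {s : St V A} (h : s.Within β) {v : V} {x : ℕ}
    (hx : x ≤ β.reg v) : (s.set v x).Within β := by
  refine ⟨fun u => ?_, h.2⟩
  rw [St.set_reg]
  split
  · subst u; exact hx
  · exact h.1 u

theorem St.Within.put {β : Bounds V A} {s : St V A} (h : s.Within β) {a : A} {i x : ℕ}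
    (hx : x ≤ β.arr a) : (s.put a i x).Within β := by
  refine ⟨h.1, fun c j => ?_⟩
  rw [St.put_arr]
  split
  · next hc => rw [hc.1]; exact hx
  · exact h.2 c j

theorem Pr.run_within {β : Bounds V A} : ∀ (p : Pr V A) (s : St V A), p.Safe β s → s.Within β →
    (p.run s).Within β
  | .skip, s, _, h => h
  | .assign v e, s, hs, h => h.set hs
  | .store a i e, s, hs, h => h.put hs
  | .seq p q, s, hs, h => Pr.run_within q _ hs.2 (Pr.run_within p _ hs.1 h)
  | .ite e p q, s, hs, h => by
    rw [Pr.run]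
    split
    · next he => exact Pr.run_within p _ (hs.1 he) h
    · next he => exact Pr.run_within q _ (hs.2 (not_not.1 he)) h
  | .loop v b p, s, hs, h => by
    have key : ∀ i ≤ s.reg b, (iter (fun i s' => p.run (s'.set v i)) i s).Within β := by
      intro i
      induction i with
      | zero => exact fun _ => h
      | succ i ih =>
        intro hi
        rw [iter]
        exact Pr.run_within p _ (hs.2 i (by omega))
          ((ih (by omega)).set (by have := hs.1; omega))
    exact (key _ le_rfl).set hs.1

/-! #### Translation into RAM programs -/

/-- The placement of registers and arrays in the RAM: array `a` occupies the memory cells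
`base + K * i + ca a`, where `base` is kept in the register `0`. -/
structure Layout (V A : Type) where
  K : ℕ
  cv : V → ℕ
  ca : A → ℕ
  cv_inj : Function.Injective cv
  cv_pos : ∀ v, 2 ≤ cv v
  ca_inj : Function.Injective ca
  ca_lt : ∀ a, ca a < K

variable (l : Layout V A)

/-- The arrays are interleaved: the residue of the offset modulo `K` identifies the array, because
`ca a < K`, and then the index is found by cancelling `K`. -/
theorem Layout.address_inj {a c : A} {b i j : ℕ} :
    b + (l.K * i + l.ca a) = b + (l.K * j + l.ca c) ↔ a = c ∧ i = j := by
  refine ⟨fun h => ?_, fun h => by rw [h.1, h.2]⟩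
  have h1 := l.ca_lt a
  have h2 := l.ca_lt c
  have h3 : l.K * i + l.ca a = l.K * j + l.ca c := by omega
  have e1 : (l.K * i + l.ca a) % l.K = l.ca a := by
    rw [Nat.mul_add_mod, Nat.mod_eq_of_lt h1]
  have e2 : (l.K * j + l.ca c) % l.K = l.ca c := by
    rw [Nat.mul_add_mod, Nat.mod_eq_of_lt h2]
  have h4 : l.ca a = l.ca c := by rw [← e1, ← e2, h3]
  refine ⟨l.ca_inj h4, ?_⟩
  have h5 : l.K * i = l.K * j := by omega
  exact Nat.eq_of_mul_eq_mul_left (by omega) h5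

def Layout.address (a : A) (i : RAM.Expr) : RAM.Expr :=
  .bin .add (.reg 0) (.bin .add (.bin .mul (.const l.K) i) (.const (l.ca a)))

/-- The machine has no remainder operation. The formula used for `mod` is right for `y = 0` too,
since division by `0` gives `0` and `x % 0 = x`. -/
def Ex.compile : Ex V A → RAM.Expr
  | .const c => .const c
  | .var v => .reg (l.cv v)
  | .get a i => .load (l.address a i.compile)
  | .bin op x y => .bin op x.compile y.compile
  | .mod x y => .bin .sub x.compile (.bin .mul (.bin .div x.compile y.compile) y.compile)

def Pr.compile : Pr V A → RAM.Program
  | .skip => .skip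
  | .assign v e => .assign (l.cv v) (e.compile l)
  | .store a i e => .store (l.address a (i.compile l)) (e.compile l)
  | .seq p q => .seq p.compile q.compile
  | .ite e p q => .cond (e.compile l) p.compile q.compile
  | .loop v b p => .forLoop (l.cv v) (l.cv b) p.compile

/-- The RAM state `σ` represents the state `s`. -/
structure Represents (base : ℕ) (σ : State) (s : St V A) : Prop where
  origin : σ.reg 0 = base
  reg : ∀ v, σ.reg (l.cv v) = s.reg v
  arr : ∀ a i, σ.mem (base + (l.K * i + l.ca a)) = s.arr a i

variable {l}

theorem Ex.eval_compile {base : ℕ} {σ : State} {s : St V A} (h : Represents l base σ s) :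
    ∀ e : Ex V A, (e.compile l).eval σ = e.ev s
  | .const c => rfl
  | .var v => h.reg v
  | .get a i => by
    simp only [Ex.compile, RAM.Expr.eval, Layout.address, RAM.Op.eval, Ex.eval_compile h i, h.origin,
      h.arr, Ex.ev]
  | .bin op x y => by
    simp only [Ex.compile, RAM.Expr.eval, Ex.eval_compile h x, Ex.eval_compile h y, Ex.ev]
  | .mod x y => by
    simp only [Ex.compile, RAM.Expr.eval, Ex.eval_compile h x, Ex.eval_compile h y, Ex.ev,
      RAM.Op.eval]
    have := Nat.div_add_mod' (x.ev s) (y.ev s)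
    omega

theorem Represents.set {base : ℕ} {σ : State} {s : St V A} (h : Represents l base σ s)
    (v : V) (x : ℕ) :
    Represents l base { σ with reg := Function.update σ.reg (l.cv v) x } (s.set v x) where
  origin := by
    have := l.cv_pos v
    exact (Function.update_of_ne (by omega) _ _).trans h.origin
  reg u := by
    rw [St.set_reg]
    by_cases hu : u = v
    · simp [hu]
    · simp [hu, l.cv_inj.eq_iff, h.reg]
  arr := h.arr

theorem Represents.put {base : ℕ} {σ : State} {s : St V A} (h : Represents l base σ s)
    (a : A) (i x : ℕ) :
    Represents l base { σ with mem := Function.update σ.mem (base + (l.K * i + l.ca a)) x }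
      (s.put a i x) where
  origin := h.origin
  reg := h.reg
  arr c j := by
    simp only [St.put_arr, Function.update_apply, h.arr, l.address_inj]

/-- The translation simulates the program, within the number of steps that the bounds allow. -/
theorem Pr.steps_compile {β : Bounds V A} {B base : ℕ} (hv : ∀ v, (β.reg v).size ≤ B)
    (ha : ∀ a, (β.arr a).size ≤ B) : ∀ (p : Pr V A) (s : St V A) (σ : State), p.wf = true →
      p.Safe β s → s.Within β → σ.Bounded B → Represents l base σ s →
      ∃ σ', Steps B (p.compile l) σ σ' (p.steps β) ∧ Represents l base σ' (p.run s)
  | .skip, s, σ, _, _, _, hB, hR =>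
    ⟨σ, ⟨1, RAM.Run.skip, by
      simp [Pr.compile, RAM.Program.factor, Pr.steps, Nat.one_le_pow], hB⟩, hR⟩
  | .assign v e, s, σ, _, hs, hw, hB, hR => by
    have he := Ex.eval_compile hR e
    refine ⟨_, Steps.assign hB _ _ ?_, ?_⟩
    · rw [he]; exact (Nat.size_le_size hs).trans (hv v)
    · rw [he]; exact hR.set v _
  | .store a i e, s, σ, _, hs, hw, hB, hR => by
    have he := Ex.eval_compile hR e
    have hi := Ex.eval_compile hR i
    refine ⟨_, Steps.store hB _ _ ?_, ?_⟩
    · rw [he]; exact (Nat.size_le_size hs).trans (ha a)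
    · have : (l.address a (i.compile l)).eval σ = base + (l.K * i.ev s + l.ca a) := by
        simp only [Layout.address, RAM.Expr.eval, RAM.Op.eval, hi, hR.origin]
      rw [he, this]; exact hR.put a _ _
  | .seq p q, s, σ, hwf, hs, hw, hB, hR => by
    simp only [Pr.wf, Bool.and_eq_true] at hwf
    obtain ⟨σ₁, h1, h2⟩ := Pr.steps_compile hv ha p s σ hwf.1 hs.1 hw hB hR
    obtain ⟨σ₂, h3, h4⟩ := Pr.steps_compile hv ha q _ σ₁ hwf.2 hs.2 (p.run_within s hs.1 hw)
      h1.choose_spec.2.2 h2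
    exact ⟨σ₂, h1.seq h3, h4⟩
  | .ite e p q, s, σ, hwf, hs, hw, hB, hR => by
    simp only [Pr.wf, Bool.and_eq_true] at hwf
    have he := Ex.eval_compile hR e
    by_cases h0 : e.ev s = 0
    · obtain ⟨σ₁, h1, h2⟩ := Pr.steps_compile hv ha q s σ hwf.2 (hs.2 h0) hw hB hR
      refine ⟨σ₁, (Steps.cond_false hB (by rw [he, h0]) h1).mono ?_, by simpa [Pr.run, h0] using h2⟩
      simp only [Pr.steps]; omega
    · obtain ⟨σ₁, h1, h2⟩ := Pr.steps_compile hv ha p s σ hwf.1 (hs.1 h0) hw hB hR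
      refine ⟨σ₁, (Steps.cond_true hB (by rwa [he]) h1).mono ?_, by simpa [Pr.run, h0] using h2⟩
      simp only [Pr.steps]; omega
  | .loop v b p, s, σ, hwf, hs, hw, hB, hR => by
    simp only [Pr.wf, Bool.and_eq_true, Bool.not_eq_true', beq_eq_false_iff_ne] at hwf
    obtain ⟨⟨⟨hp, hpv⟩, hpb⟩, hvb⟩ := hwf
    set f := fun i s' => p.run (St.set s' v i) with hf
    have hwi : ∀ i ≤ s.reg b, (iter f i s).Within β := by
      intro i
      induction i with
      | zero => exact fun _ => hw
      | succ i ih =>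
        intro hi
        exact Pr.run_within p _ (hs.2 i (by omega)) ((ih (by omega)).set (by have := hs.1; omega))
    obtain ⟨σ', h1, h2, h3⟩ := Steps.forLoop (p := p.compile l) (T := p.steps β) (v := l.cv v) hB
      (fun h => hvb (l.cv_inj h)) (hR.reg b)
      (fun i σ => Represents l base σ ((iter f i s).set v i)) (hR.set v 0) (by
        intro i hi σ₁ k1 k2 k3 k4
        obtain ⟨σ₂, m1, m2⟩ := Pr.steps_compile hv ha p _ σ₁ hp (hs.2 i hi)
          ((hwi i hi.le).set (by have := hs.1; omega)) k1 k4
        refine ⟨σ₂, m1, ?_, ?_, m2.set v (i + 1)⟩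
        · rw [m2.reg, p.run_reg _ hpv, St.set_reg, if_pos rfl]
        · rw [m2.reg, p.run_reg _ hpb, ← k4.reg, k3])
    -- The actual number of iterations is replaced by the bound `β.reg b`; this is what makes
    -- `Pr.steps` independent of the state.
    exact ⟨σ', h1.mono (by
      have := Nat.mul_le_mul_right (p.steps β + 2) (hw.1 b)
      simp only [Pr.steps]; omega), h3⟩

/-! #### Program verification -/

/-- Started in `s`, the program respects the bounds and ends in a state with the property `Q`. -/
def Tr (β : Bounds V A) (p : Pr V A) (s : St V A) (Q : St V A → Prop) : Prop :=
  p.Safe β s ∧ Q (p.run s)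

/-- `s'` differs from `s` at most in what the program `p` may change. -/
structure Frame (p : Pr V A) (s s' : St V A) : Prop where
  reg : ∀ x, p.writes x = false → s'.reg x = s.reg x
  arr : ∀ a, p.alters a = false → s'.arr a = s.arr a

theorem Frame.run (p : Pr V A) (s : St V A) : Frame p s (p.run s) :=
  ⟨fun _ h => p.run_reg s h, fun _ h => p.run_arr s h⟩

variable {β : Bounds V A} {s : St V A} {Q : St V A → Prop}

@[simp] theorem Tr.skip_iff : Tr β .skip s Q ↔ Q s := by
  simp [Tr, Pr.Safe, Pr.run]

@[simp] theorem Tr.assign_iff {v : V} {e : Ex V A} :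
    Tr β (.assign v e) s Q ↔ e.ev s ≤ β.reg v ∧ Q (s.set v (e.ev s)) := Iff.rfl

@[simp] theorem Tr.store_iff {a : A} {i e : Ex V A} :
    Tr β (.store a i e) s Q ↔ e.ev s ≤ β.arr a ∧ Q (s.put a (i.ev s) (e.ev s)) := Iff.rfl

theorem Tr.seq_iff {p q : Pr V A} : Tr β (.seq p q) s Q ↔ Tr β p s fun s' => Tr β q s' Q := by
  simp [Tr, Pr.Safe, Pr.run, and_assoc]

theorem Tr.seq {p q : Pr V A} {R : St V A → Prop} (hp : Tr β p s R)
    (hq : ∀ s', Frame p s s' → R s' → Tr β q s' Q) : Tr β (.seq p q) s Q :=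
  Tr.seq_iff.2 ⟨hp.1, hq _ (Frame.run p s) hp.2⟩

theorem Tr.ite {p q : Pr V A} {e : Ex V A} (hp : e.ev s ≠ 0 → Tr β p s Q)
    (hq : e.ev s = 0 → Tr β q s Q) : Tr β (.ite e p q) s Q := by
  refine ⟨⟨fun h => (hp h).1, fun h => (hq h).1⟩, ?_⟩
  by_cases h : e.ev s = 0
  · simpa [Pr.run, h] using (hq h).2
  · simpa [Pr.run, h] using (hp h).2

theorem Tr.imp {p : Pr V A} {R : St V A → Prop} (hp : Tr β p s R)
    (h : ∀ s', Frame p s s' → R s' → Q s') : Tr β p s Q :=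
  ⟨hp.1, h _ (Frame.run p s) hp.2⟩

/-- Loops: `I i` holds after `i` iterations. -/
theorem Tr.loop {p : Pr V A} {v b : V} (I : ℕ → St V A → Prop) (N : ℕ) (hN : s.reg b = N)
    (hβ : N ≤ β.reg v) (h0 : I 0 s)
    (hstep : ∀ i < N, ∀ s', Frame (.loop v b p) s s' → I i s' → Tr β p (s'.set v i) (I (i + 1)))
    (hQ : ∀ s', Frame (.loop v b p) s s' → I N s' → Q (s'.set v N)) :
    Tr β (.loop v b p) s Q := by
  subst hN
  set f := fun i s' => p.run (St.set s' v i) with hf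
  have hF : ∀ i, Frame (.loop v b p) s (iter f i s) := by
    intro i
    induction i with
    | zero => exact ⟨fun _ _ => rfl, fun _ _ => rfl⟩
    | succ i ih =>
      refine ⟨fun x hx => ?_, fun a h => ?_⟩
      · have hx' := hx
        simp only [Pr.writes, Bool.or_eq_false_iff, beq_eq_false_iff_ne] at hx'
        rw [iter, p.run_reg _ hx'.2, St.set_reg, if_neg hx'.1, ih.reg x hx]
      · rw [iter, p.run_arr _ h, St.set_arr, ih.arr a h]
  have hI : ∀ i ≤ s.reg b, I i (iter f i s) := by
    intro i
    induction i with
    | zero => exact fun _ => h0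
    | succ i ih => exact fun hi => (hstep i (by omega) _ (hF i) (ih (by omega))).2
  exact ⟨⟨hβ, fun i hi => (hstep i hi _ (hF i) (hI i hi.le)).1⟩, hQ _ (hF _) (hI _ le_rfl)⟩

end LoopLang

/-! ### Input, output and the complete RAM program. -/

namespace LoopLang

open RAM (State Steps)

variable {V A : Type} [DecidableEq V] [DecidableEq A]

theorem exists_layout (V A : Type) [Fintype V] [Fintype A] : Nonempty (Layout V A) :=
  ⟨{ K := Fintype.card A
     cv := fun v => (Fintype.equivFin V v : ℕ) + 2
     ca := fun a => (Fintype.equivFin A a : ℕ)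
     cv_inj := fun v w h => (Fintype.equivFin V).injective (Fin.ext (by simpa using h))
     cv_pos := fun v => Nat.le_add_left _ _
     ca_inj := fun v w h => (Fintype.equivFin A).injective (Fin.ext h)
     ca_lt := fun a => (Fintype.equivFin A a).2 }⟩

/-- All registers and arrays are zero, but for the array `inp`, which holds the input. -/
def start (inp : A) (input : List ℕ) : St V A where
  reg := fun _ => 0
  arr := fun a i => if a = inp then input.getD i 0 else 0

/-- Move the input into the array `inp`. -/
def loadInput (l : Layout V A) (inp : A) : RAM.Program :=
  .seq (.assign 0 (.bin .add (.bin .mul (.load (.const 0)) (.load (.const 0))) (.const 2)))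
    (.forLoop 1 0 (.store (l.address inp (.reg 1)) (.load (.reg 1))))

/-- Move the first cells of the array `out` to the front of the memory. -/
def writeOutput (l : Layout V A) (out : A) (len : V) : RAM.Program :=
  .forLoop 1 (l.cv len) (.store (.reg 1) (.load (l.address out (.reg 1))))

theorem bounded_initial {input : List ℕ} {B : ℕ} (h : ∀ x ∈ input, x.size ≤ B) :
    (RAM.initial input).Bounded B := by
  refine ⟨fun r => by simp [RAM.initial], fun a => ?_⟩
  simp only [RAM.initial]
  by_cases ha : a < input.length
  · rw [List.getD_eq_getElem _ _ ha]; exact h _ (List.getElem_mem ha)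
  · rw [List.getD_eq_default _ _ (by omega)]; simp

/-- The first free cell is `n * n + 2`, the length of the input. Register `0` holds it both as the
loop bound and as the origin of the arrays, register `1` is the counter; the registers of the
translated program start at `2`. -/
theorem steps_loadInput (l : Layout V A) (inp : A) {input : List ℕ} {B n : ℕ}
    (hB : ∀ x ∈ input, x.size ≤ B) (hn : input.getD 0 0 = n) (hlen : input.length = n * n + 2)
    (hnB : (n * n + 2).size ≤ B) :
    ∃ σ, Steps B (loadInput l inp) (RAM.initial input) σ ((n * n + 2) * 3 + 3) ∧
      Represents l (n * n + 2) σ (start (V := V) inp input) := by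
  have h0 := bounded_initial hB
  have he : RAM.Expr.eval (RAM.initial input)
      (.bin .add (.bin .mul (.load (.const 0)) (.load (.const 0))) (.const 2)) = n * n + 2 := by
    simp only [RAM.Expr.eval, RAM.initial, RAM.Op.eval, hn]
  have h1 := Steps.assign h0 0 _ (by rw [he]; exact hnB)
  rw [he] at h1
  set b := n * n + 2 with hb
  obtain ⟨σ', h2, h3, h4⟩ := Steps.forLoop (N := b) (v := 1) (b := 0) (T := 1)
    (p := .store (l.address inp (.reg 1)) (.load (.reg 1)))
    (h0.update_reg 0 b hnB) (by norm_num) (by simp)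
    (fun i σ => σ.reg 0 = b ∧ (∀ r, 2 ≤ r → σ.reg r = 0) ∧ (∀ a < b, σ.mem a = input.getD a 0) ∧
      ∀ a j, σ.mem (b + (l.K * j + l.ca a)) = if a = inp ∧ j < i then input.getD j 0 else 0)
    (by
      refine ⟨by simp, fun r hr => ?_, fun a ha => rfl, fun a j => ?_⟩
      · simp [RAM.initial, show r ≠ 1 by omega, show r ≠ 0 by omega]
      · simp only [RAM.initial, Nat.not_lt_zero, and_false, if_false]
        exact List.getD_eq_default _ _ (by omega))
    (by
      rintro i hi σ₁ k1 k2 k3 ⟨m1, m2, m3, m4⟩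
      have e1 : RAM.Expr.eval σ₁ (.load (.reg 1)) = input.getD i 0 := by
        simp only [RAM.Expr.eval, k2, m3 i hi]
      have e2 : RAM.Expr.eval σ₁ (l.address inp (.reg 1)) = b + (l.K * i + l.ca inp) := by
        simp only [Layout.address, RAM.Expr.eval, k2, m1, RAM.Op.eval]
      have hs : (input.getD i 0).size ≤ B := (bounded_initial hB).2 i
      have := Steps.store k1 (l.address inp (.reg 1)) (.load (.reg 1)) (by rw [e1]; exact hs)
      rw [e1, e2] at this
      refine ⟨_, this, k2, k3, by simpa using m1, fun r hr => ?_, fun a ha => ?_, fun a j => ?_⟩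
      · simp [show r ≠ 1 by omega, m2 r hr]
      · simp only [Function.update_apply]
        rw [if_neg (by omega), m3 a ha]
      · simp only [Function.update_apply, l.address_inj, m4]
        by_cases ha : a = inp
        · by_cases hj : j = i
          · simp [ha, hj]
          · simp only [ha, hj, and_false, if_false, true_and]
            congr 1
            simp only [eq_iff_iff]
            omega
        · simp [ha])
  refine ⟨σ', (h1.seq h2).mono (by omega), h4.1, fun v => ?_, fun a i => ?_⟩
  · exact h4.2.1 _ (l.cv_pos v)
  · rw [h4.2.2.2, start]
    by_cases ha : a = inp
    · by_cases hi : i < b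
      · simp [ha, hi]
      · simp only [ha, hi, and_false, if_false, if_true]
        exact (List.getD_eq_default _ _ (by omega)).symm
    · simp [ha]

/-- The output overwrites cells below the origin `b` only, while the arrays lie from `b` on; so `N ≤
b` prevents interference. -/
theorem steps_writeOutput (l : Layout V A) (out : A) (len : V) {B b N : ℕ} {σ : State}
    {s : St V A} (hσ : σ.Bounded B) (hR : Represents l b σ s) (hN : s.reg len = N) (hNb : N ≤ b) :
    ∃ σ', Steps B (writeOutput l out len) σ σ' (N * 3 + 2) ∧ ∀ i < N, σ'.mem i = s.arr out i := by
  have hlen := l.cv_pos len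
  obtain ⟨σ', h2, h3, h4⟩ := Steps.forLoop (N := N) (v := 1) (T := 1) (b := l.cv len)
    (p := .store (.reg 1) (.load (l.address out (.reg 1)))) hσ (by omega) (by rw [hR.reg, hN])
    (fun i σ => σ.reg 0 = b ∧ (∀ j < i, σ.mem j = s.arr out j) ∧
      ∀ j, σ.mem (b + (l.K * j + l.ca out)) = s.arr out j)
    ⟨by simpa using hR.origin, by simp, hR.arr out⟩
    (by
      rintro i hi σ₁ k1 k2 k3 ⟨m1, m2, m3⟩
      have e1 : RAM.Expr.eval σ₁ (.load (l.address out (.reg 1))) = s.arr out i := by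
        simp only [RAM.Expr.eval, Layout.address, k2, m1, RAM.Op.eval, m3]
      have := Steps.store k1 (.reg 1) (.load (l.address out (.reg 1)))
        (by rw [e1, ← m3]; exact k1.2 _)
      rw [e1, show RAM.Expr.eval σ₁ (.reg 1) = i from k2] at this
      refine ⟨_, this, k2, k3, by simpa using m1, fun j hj => ?_, fun j => ?_⟩
      · simp only [Function.update_apply]
        split
        · next h => rw [h]
        · exact m2 j (by omega)
      · simp only [Function.update_apply]
        rw [if_neg (by omega), m3])
  exact ⟨σ', h2.mono (by omega), h4.2.1⟩

/-- A verified loop program yields a RAM program, whose cost is the number of steps up to a factor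
quadratic in the bit length of the numbers that occur. -/
theorem exists_program [Fintype V] [Fintype A] (p : Pr V A) (hwf : p.wf = true) (inp out : A)
    (len : V) : ∃ (P : RAM.Program) (K : ℕ), ∀ (input output : List ℕ) (β : Bounds V A) (B n : ℕ),
      input.getD 0 0 = n → input.length = n * n + 2 → (∀ x ∈ input, x.size ≤ B) →
      (n * n + 2).size ≤ B → (∀ v, (β.reg v).size ≤ B) → (∀ a, (β.arr a).size ≤ B) →
      (∀ x ∈ input, x ≤ β.arr inp) → output.length ≤ n * n + 2 →
      Tr β p (start inp input) (fun s => s.reg len = output.length ∧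
        ∀ (i : ℕ) (h : i < output.length), s.arr out i = output[i]) →
      ∃ t, P.Computes input output t ∧ t ≤ K * (B + 1) ^ 2 * (p.steps β + 6 * (n * n + 2) + 5) := by
  obtain ⟨l⟩ := exists_layout V A
  set P : RAM.Program := .seq (loadInput l inp) (.seq (p.compile l) (writeOutput l out len))
  refine ⟨P, P.factor, ?_⟩
  intro input output β B n hn hlen hB hnB hv ha hinp hout ⟨hsafe, hlast, hval⟩
  obtain ⟨σ₁, h1, h2⟩ := steps_loadInput (V := V) l inp hB hn hlen hnB
  have hw : (start (V := V) inp input).Within β := by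
    refine ⟨fun v => Nat.zero_le _, fun a i => ?_⟩
    simp only [start]
    split
    · next h =>
      subst h
      by_cases hi : i < input.length
      · rw [List.getD_eq_getElem _ _ hi]; exact hinp _ (List.getElem_mem hi)
      · rw [List.getD_eq_default _ _ (by omega)]; exact Nat.zero_le _
    · exact Nat.zero_le _
  obtain ⟨σ₂, h3, h4⟩ := Pr.steps_compile (l := l) hv ha p _ σ₁ hwf hsafe hw
    h1.choose_spec.2.2 h2
  obtain ⟨σ₃, h5, h6⟩ := steps_writeOutput l out len h3.choose_spec.2.2 h4 hlast hout
  obtain ⟨t, r1, r2, r3⟩ := (h1.seq (h3.seq h5)).mono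
    (T' := p.steps β + 6 * (n * n + 2) + 5) (by omega)
  exact ⟨t, ⟨σ₃, r1, fun i hi => by rw [h6 i hi, hval i hi]⟩, r2⟩

end LoopLang

/-! ### From straight-line programs to bilinear algorithms -/

namespace MatMul

open MvPolynomial

section

variable {σ : Type}

/-- The coefficient of `X a * X b` in `f`, for `a ≠ b`. -/
noncomputable def mixed (f : MvPolynomial σ ℚ) (a b : σ) : ℚ :=
  constantCoeff (pderiv a (pderiv b f))

/-- Leibniz's rule, applied twice. As matrices in `(a, b)`, the first two terms are multiples of the
matrices of `f` and `g`, and the last two have rank one. -/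
theorem mixed_mul (f g : MvPolynomial σ ℚ) (a b : σ) :
    mixed (f * g) a b = constantCoeff g * mixed f a b + constantCoeff f * mixed g a b +
      constantCoeff (pderiv a f) * constantCoeff (pderiv b g) +
      constantCoeff (pderiv a g) * constantCoeff (pderiv b f) := by
  simp only [mixed, Derivation.leibniz, map_add, smul_eq_mul, map_mul]
  ring

theorem mixed_X [DecidableEq σ] (i a b : σ) : mixed (X i : MvPolynomial σ ℚ) a b = 0 := by
  rw [mixed, pderiv_X]
  by_cases h : i = b
  · subst h; simp
  · simp [h]

/-- The matrices of mixed second-order coefficients of all results of a straight-line program with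
`L` operations lie in the span of `2 * L` matrices of rank one. -/
theorem StraightLine.exists_rank_one {L : ℕ} {S : Set (MvPolynomial σ ℚ)} (h : StraightLine L S) :
    ∃ u v : ℕ → σ → ℚ, ∀ f ∈ S, ∃ c : ℕ → ℚ, ∀ a b,
      mixed f a b = ∑ r ∈ Finset.range (2 * L), c r * u r a * v r b := by
  classical
  -- The matrix of each new result is a combination of two old matrices plus two rank-one terms,
  -- which receive the indices `2 * L` and `2 * L + 1`. For sums and differences these two terms are
  -- zero.
  have extend : ∀ {L : ℕ} {S : Set (MvPolynomial σ ℚ)} {p : MvPolynomial σ ℚ},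
      (∃ u v : ℕ → σ → ℚ, ∀ f ∈ S, ∃ c : ℕ → ℚ, ∀ a b,
        mixed f a b = ∑ r ∈ Finset.range (2 * L), c r * u r a * v r b) →
      (∃ f ∈ S, ∃ g ∈ S, ∃ (y z : ℚ) (u v u' v' : σ → ℚ), ∀ a b,
        mixed p a b = y * mixed f a b + z * mixed g a b + u a * v b + u' a * v' b) →
      ∃ u v : ℕ → σ → ℚ, ∀ f ∈ insert p S, ∃ c : ℕ → ℚ, ∀ a b,
        mixed f a b = ∑ r ∈ Finset.range (2 * (L + 1)), c r * u r a * v r b := by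
    rintro L S p ⟨u, v, h⟩ ⟨f, hf, g, hg, y, z, u₁, v₁, u₂, v₂, hp⟩
    have hlt : ∀ {r}, r ∈ Finset.range (2 * L) → r ≠ 2 * L ∧ r ≠ 2 * L + 1 := by
      intro r hr; have := Finset.mem_range.1 hr; omega
    refine ⟨fun r => if r = 2 * L then u₁ else if r = 2 * L + 1 then u₂ else u r,
      fun r => if r = 2 * L then v₁ else if r = 2 * L + 1 then v₂ else v r, fun e he => ?_⟩
    have split : ∀ (c : ℕ → ℚ) a b, ∑ r ∈ Finset.range (2 * (L + 1)),
        c r * (if r = 2 * L then u₁ else if r = 2 * L + 1 then u₂ else u r) a *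
          (if r = 2 * L then v₁ else if r = 2 * L + 1 then v₂ else v r) b =
        ∑ r ∈ Finset.range (2 * L), c r * u r a * v r b + c (2 * L) * u₁ a * v₁ b +
          c (2 * L + 1) * u₂ a * v₂ b := by
      intro c a b
      rw [show 2 * (L + 1) = 2 * L + 1 + 1 by ring, Finset.sum_range_succ, Finset.sum_range_succ]
      congr 1
      · congr 1
        · refine Finset.sum_congr rfl fun r hr => ?_
          simp [(hlt hr).1, (hlt hr).2]
        · simp
      · simp
    rcases he with rfl | he
    · obtain ⟨cf, hcf⟩ := h f hf
      obtain ⟨cg, hcg⟩ := h g hg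
      refine ⟨fun r => if r = 2 * L then 1 else if r = 2 * L + 1 then 1 else y * cf r + z * cg r,
        fun a b => ?_⟩
      rw [split, hp, hcf, hcg, Finset.mul_sum, Finset.mul_sum, ← Finset.sum_add_distrib]
      congr 1
      · congr 1
        · refine Finset.sum_congr rfl fun r hr => ?_
          simp only [(hlt hr).1, (hlt hr).2, if_false]
          ring
        · simp
      · simp
    · obtain ⟨c, hc⟩ := h e he
      refine ⟨fun r => if r = 2 * L then 0 else if r = 2 * L + 1 then 0 else c r, fun a b => ?_⟩
      rw [split, hc]
      simp only [if_true, zero_mul, add_zero, Nat.succ_ne_self, if_false]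
      refine Finset.sum_congr rfl fun r hr => ?_
      simp only [(hlt hr).1, (hlt hr).2, if_false]
  induction h with
  | start =>
    refine ⟨fun _ _ => 0, fun _ _ => 0, ?_⟩
    rintro f (⟨i, rfl⟩ | ⟨c, rfl⟩)
    · exact ⟨fun _ => 0, fun a b => by simp [mixed_X]⟩
    · exact ⟨fun _ => 0, fun a b => by simp [mixed]⟩
  | add _ hf hg ih =>
    exact extend ih ⟨_, hf, _, hg, 1, 1, 0, 0, 0, 0, fun a b => by simp [mixed]⟩
  | sub _ hf hg ih =>
    exact extend ih ⟨_, hf, _, hg, 1, -1, 0, 0, 0, 0, fun a b => by simp [mixed, sub_eq_add_neg]⟩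
  | mul _ hf hg ih =>
    exact extend ih ⟨_, hf, _, hg, _, _, _, _, _, _, fun a b => mixed_mul _ _ a b⟩

/-- A straight-line program with `L` operations adds at most `L` results. -/
theorem StraightLine.exists_finset {L : ℕ} {S : Set (MvPolynomial σ ℚ)} (h : StraightLine L S) :
    ∃ F : Finset (MvPolynomial σ ℚ), F.card ≤ L ∧ S ⊆ (Set.range X ∪ Set.range C) ∪ F := by
  classical
  have extend : ∀ {L : ℕ} {S : Set (MvPolynomial σ ℚ)} (p : MvPolynomial σ ℚ),
      (∃ F : Finset (MvPolynomial σ ℚ), F.card ≤ L ∧ S ⊆ (Set.range X ∪ Set.range C) ∪ F) →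
      ∃ F : Finset (MvPolynomial σ ℚ), F.card ≤ L + 1 ∧
        insert p S ⊆ (Set.range X ∪ Set.range C) ∪ F := by
    rintro L S p ⟨F, h1, h2⟩
    refine ⟨insert p F, (Finset.card_insert_le _ _).trans (by omega), ?_⟩
    rintro e (rfl | he)
    · exact Or.inr (by simp)
    · rcases h2 he with h | h
      · exact Or.inl h
      · exact Or.inr (by simp only [Finset.coe_insert]; exact Set.mem_insert_of_mem _ h)
  induction h with
  | start => exact ⟨∅, le_rfl, fun _ h => Or.inl h⟩
  | add _ _ _ ih => exact extend _ ih
  | sub _ _ _ ih => exact extend _ ih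
  | mul _ _ _ ih => exact extend _ ih

end

/-! ### The matrix multiplication tensor and its exponent. -/

section

variable {N : ℕ}

/-- These coefficients form the matrix multiplication tensor, so writing them by rank-one matrices
is a rank decomposition. -/
theorem mixed_productEntry (i j a b c d : Fin N) :
    mixed (productEntry N i j) (Sum.inl (a, b)) (Sum.inr (c, d)) =
      if i = a ∧ b = c ∧ d = j then 1 else 0 := by
  have hX : ∀ x y : (Fin N × Fin N) ⊕ (Fin N × Fin N),
      constantCoeff (pderiv x (X y : MvPolynomial _ ℚ)) = if y = x then 1 else 0 := by
    intro x y
    rw [pderiv_X, Pi.single_apply]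
    split_ifs <;> simp
  have hsum : mixed (productEntry N i j) (Sum.inl (a, b)) (Sum.inr (c, d)) =
      ∑ l : Fin N, mixed (X (Sum.inl (i, l)) * X (Sum.inr (l, j))) (Sum.inl (a, b))
        (Sum.inr (c, d)) := by
    simp only [mixed, productEntry, map_sum]
  rw [hsum, Finset.sum_eq_single b]
  · simp only [mixed_mul, mixed_X, hX, Sum.inl.injEq, Sum.inr.injEq, Prod.mk.injEq]
    by_cases h1 : i = a <;> by_cases h2 : b = c <;> by_cases h3 : j = d <;>
      simp [h1, h2, h3, eq_comm]
  · intro l _ hl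
    simp [mixed_mul, mixed_X, hl]
  · simp

/-- The evaluation point at which exactly the product entry `(i, j)` does not vanish. -/
def probe (x : ℚ) (i j : Fin N) : (Fin N × Fin N) ⊕ (Fin N × Fin N) → ℚ
  | Sum.inl (a, b) => if a = i ∧ b = i then x else 0
  | Sum.inr (a, b) => if a = i ∧ b = j then x else 0

theorem eval_probe (x : ℚ) (i j a b : Fin N) :
    eval (probe x i j) (productEntry N a b) = if a = i ∧ b = j then x * x else 0 := by
  simp only [productEntry, map_sum, map_mul, eval_X, probe]
  by_cases h1 : a = i <;> by_cases h2 : b = j <;> simp [h1, h2]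

theorem productEntry_injective :
    Function.Injective fun p : Fin N × Fin N => productEntry N p.1 p.2 := by
  rintro ⟨i, j⟩ ⟨a, b⟩ h
  have h1 := eval_probe 1 i j i j
  have h2 := eval_probe 1 i j a b
  simp only at h
  rw [h] at h1
  rw [h1] at h2
  by_cases hab : a = i ∧ b = j
  · simp [hab.1, hab.2]
  · simp [hab] at h2

/-- Along `probe x i j` the entry is quadratic in `x`, a variable is linear or zero, and a constant
does not change; the points `0`, `1`, `2` tell them apart. -/
theorem productEntry_notMem_start (i j : Fin N) :
    productEntry N i j ∉ (Set.range X ∪ Set.range C : Set (MvPolynomial _ ℚ)) := by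
  have h0 := eval_probe 0 i j i j
  have h1 := eval_probe 1 i j i j
  have h2 := eval_probe 2 i j i j
  rintro (⟨v, hv⟩ | ⟨c, hc⟩)
  · rw [← hv, eval_X] at h1 h2
    rcases v with ⟨a, b⟩ | ⟨a, b⟩ <;> simp only [probe] at h1 h2 <;> split_ifs at h1 h2 <;>
      simp_all
  · rw [← hc, eval_C] at h0 h1
    rw [h0] at h1
    simp at h1

/-- The `N ^ 2` entries are distinct and none of them is an input, so each takes an operation of its
own. -/
theorem MultipliableWith.sq_le {N L : ℕ} (h : MultipliableWith N L) : N ^ 2 ≤ L := by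
  classical
  obtain ⟨S, hS, hmem⟩ := h
  obtain ⟨F, hF, hSF⟩ := hS.exists_finset
  have : (Finset.univ.image fun p : Fin N × Fin N => productEntry N p.1 p.2) ⊆ F := by
    intro f hf
    obtain ⟨p, -, rfl⟩ := Finset.mem_image.1 hf
    rcases hSF (hmem p.1 p.2) with h | h
    · exact absurd h (productEntry_notMem_start p.1 p.2)
    · exact h
  have h2 := Finset.card_le_card this
  rw [Finset.card_image_of_injective _ productEntry_injective] at h2
  simp only [Finset.card_univ, Fintype.card_prod, Fintype.card_fin] at h2
  nlinarith

/-- The exponents that the definition of `omega` ranges over. -/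
def exponents : Set ℝ :=
  {τ : ℝ | ∃ C : ℝ, ∀ N : ℕ, ∃ L : ℕ, MultipliableWith N L ∧ (L : ℝ) ≤ C * (N : ℝ) ^ τ}

theorem two_le_of_mem_exponents {τ : ℝ} (h : τ ∈ exponents) : 2 ≤ τ := by
  obtain ⟨C, hC⟩ := h
  by_contra! hτ
  have hlim : Filter.Tendsto (fun N : ℕ => (N : ℝ) ^ (2 - τ)) Filter.atTop Filter.atTop :=
    (tendsto_rpow_atTop (by linarith)).comp tendsto_natCast_atTop_atTop
  obtain ⟨N, hN1, hN2⟩ := ((hlim.eventually_gt_atTop C).and (Filter.eventually_ge_atTop 1)).exists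
  obtain ⟨L, hL, hLC⟩ := hC N
  have h1 : ((N : ℝ)) ^ 2 ≤ L := by exact_mod_cast hL.sq_le
  have hpos : (0 : ℝ) < N := by exact_mod_cast hN2
  have h2 : (N : ℝ) ^ (2 - τ) * (N : ℝ) ^ τ = (N : ℝ) ^ 2 := by
    rw [← Real.rpow_add hpos, sub_add_cancel, Real.rpow_two]
  have h3 : C * (N : ℝ) ^ τ < (N : ℝ) ^ (2 - τ) * (N : ℝ) ^ τ :=
    mul_lt_mul_of_pos_right hN1 (Real.rpow_pos_of_pos hpos _)
  linarith

theorem StraightLine.exists_inner {σ : Type} {L : ℕ} {S : Set (MvPolynomial σ ℚ)}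
    (h : StraightLine L S) (hS : Set.range X ∪ Set.range C ⊆ S) {ι : Type} (s : Finset ι)
    (x y : ι → σ) : ∃ S', StraightLine (L + 2 * s.card) S' ∧ S ⊆ S' ∧
      ∑ l ∈ s, (X (x l) * X (y l) : MvPolynomial σ ℚ) ∈ S' := by
  classical
  induction s using Finset.induction_on with
  | empty => exact ⟨S, h, subset_rfl, hS (Or.inr ⟨0, by simp⟩)⟩
  | insert a s ha ih =>
    obtain ⟨S', h1, h2, h3⟩ := ih
    have hx : ∀ i, (X i : MvPolynomial σ ℚ) ∈ S' := fun i => h2 (hS (Or.inl ⟨i, rfl⟩))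
    refine ⟨insert (X (x a) * X (y a) + ∑ l ∈ s, (X (x l) * X (y l) : MvPolynomial σ ℚ))
      (insert (X (x a) * X (y a)) S'), ?_,
      (h2.trans (Set.subset_insert _ _)).trans (Set.subset_insert _ _), ?_⟩
    rotate_left
    · rw [Finset.sum_insert ha]; exact Set.mem_insert _ _
    · rw [Finset.card_insert_of_notMem ha]
      exact StraightLine.add (StraightLine.mul h1 (hx _) (hx _)) (Set.mem_insert _ _)
        (Set.mem_insert_of_mem _ h3)

theorem multipliableWith_naive (N : ℕ) : MultipliableWith N (2 * N ^ 3) := by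
  classical
  have : ∀ s : Finset (Fin N × Fin N), ∃ S : Set (MvPolynomial _ ℚ),
      StraightLine (s.card * (2 * N)) S ∧ Set.range X ∪ Set.range C ⊆ S ∧
        ∀ p ∈ s, productEntry N p.1 p.2 ∈ S := by
    intro s
    induction s using Finset.induction_on with
    | empty => exact ⟨_, by simpa using StraightLine.start, subset_rfl, by simp⟩
    | insert p s hp ih =>
      obtain ⟨S, h1, h2, h3⟩ := ih
      obtain ⟨S', k1, k2, k3⟩ := h1.exists_inner h2 (Finset.univ : Finset (Fin N))
        (fun l => Sum.inl (p.1, l)) (fun l => Sum.inr (l, p.2))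
      refine ⟨S', ?_, h2.trans k2, ?_⟩
      · rw [Finset.card_insert_of_notMem hp, Nat.succ_mul]; simpa using k1
      · intro e he
        rcases Finset.mem_insert.1 he with rfl | he
        · exact k3
        · exact k2 (h3 e he)
  obtain ⟨S, h1, -, h3⟩ := this Finset.univ
  refine ⟨S, ?_, fun i j => h3 (i, j) (Finset.mem_univ _)⟩
  have e : (Finset.univ : Finset (Fin N × Fin N)).card * (2 * N) = 2 * N ^ 3 := by
    simp only [Finset.card_univ, Fintype.card_prod, Fintype.card_fin]; ring
  rwa [e] at h1

/-- Without a witness, here from schoolbook multiplication, the infimum defining `omega` could be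
the default value `0` of an empty set. -/
theorem exponents_nonempty : exponents.Nonempty := by
  refine ⟨3, 2, fun N => ⟨_, multipliableWith_naive N, ?_⟩⟩
  push_cast
  norm_cast

/-- Needed twice: to have `g ^ 2` below `g ^ (omega + ε)`, and to have `n ^ (2 * k)` below the
claimed running time. -/
theorem two_le_omega : 2 ≤ omega :=
  le_csInf exponents_nonempty fun _ h => two_le_of_mem_exponents h

/-- A rank decomposition of the matrix multiplication tensor over the integers, up to a positive
factor `D`. The matrix entry `(i, j)` has the index `i * g + j`. -/
structure Decomposition where
  g : ℕ
  R : ℕ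
  D : ℕ
  coef : ℕ → ℕ → ℕ → ℤ
  two_le : 2 ≤ g
  sq_le : g ^ 2 ≤ R
  D_pos : 0 < D
  identity : ∀ i < g, ∀ j < g, ∀ j' < g, ∀ l < g, ∀ l' < g, ∀ i' < g,
    ∑ r ∈ Finset.range R, coef 0 r (i * g + j) * coef 1 r (j' * g + l) * coef 2 r (l' * g + i') =
      if j = j' ∧ l = l' ∧ i = i' then (D : ℤ) else 0

/-- A common denominator. -/
theorem exists_common_denominator (P Q : ℕ) (f : ℕ → ℕ → ℚ) :
    ∃ (d : ℕ) (z : ℕ → ℕ → ℤ), 0 < d ∧ ∀ p < P, ∀ q < Q, (z p q : ℚ) = d * f p q := by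
  set d := ∏ p ∈ Finset.range P, ∏ q ∈ Finset.range Q, (f p q).den with hd
  refine ⟨d, fun p q => ⌊(d : ℚ) * f p q⌋,
    Finset.prod_pos fun p _ => Finset.prod_pos fun q _ => (f p q).den_pos, fun p hp q hq => ?_⟩
  have h1 : (f p q).den ∣ d :=
    (Finset.dvd_prod_of_mem (fun q => (f p q).den) (Finset.mem_range.2 hq)).trans
      (Finset.dvd_prod_of_mem (fun p => ∏ q ∈ Finset.range Q, (f p q).den) (Finset.mem_range.2 hp))
  obtain ⟨e, he⟩ := h1
  have : (d : ℚ) * f p q = ((e * (f p q).num : ℤ) : ℚ) := by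
    rw [he]
    push_cast
    have := Rat.mul_den_eq_num (f p q)
    linear_combination (e : ℚ) * this
  simp only [this, Int.floor_intCast]

/-- The first two coefficient families are the rank-one factors, the third expresses the entry `(i',
l')` by them and is stored under the transposed index `(l', i')`. The transposition gives the tensor
its cyclic form, that of the trace of a triple product. Rows from `2 * L` on are zero padding, and
`D` is the product of three common denominators. -/
theorem exists_decomposition {g L R : ℕ} (hg : 2 ≤ g) (h : MultipliableWith g L)
    (hLR : 2 * L ≤ R) (hR : g ^ 2 ≤ R) :
    ∃ d : Decomposition, d.g = g ∧ d.R = R := by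
  obtain ⟨S, hS, hmem⟩ := h
  obtain ⟨u, v, huv⟩ := hS.exists_rank_one
  have hc : ∀ i j : Fin g, ∃ c : ℕ → ℚ, ∀ a b, mixed (productEntry g i j) a b =
      ∑ r ∈ Finset.range (2 * L), c r * u r a * v r b := fun i j => huv _ (hmem i j)
  choose c hc using hc
  have hg0 : 0 < g := by omega
  let fin : ℕ → Fin g := fun x => ⟨x % g, Nat.mod_lt _ hg0⟩
  have fin_inj : ∀ {x y}, x < g → y < g → (fin x = fin y ↔ x = y) := by
    intro x y hx hy
    simp [fin, Fin.ext_iff, Nat.mod_eq_of_lt hx, Nat.mod_eq_of_lt hy]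
  have hdm : ∀ {x y}, y < g → (x * g + y) / g = x ∧ fin (x * g + y) = fin y := by
    intro x y hy
    refine ⟨by rw [Nat.mul_comm, Nat.mul_add_div hg0, Nat.div_eq_of_lt hy, Nat.add_zero], ?_⟩
    simp [fin]
  obtain ⟨d₀, z₀, hd₀, hz₀⟩ := exists_common_denominator R (g * g)
    fun r e => if r < 2 * L then u r (Sum.inl (fin (e / g), fin e)) else 0
  obtain ⟨d₁, z₁, hd₁, hz₁⟩ := exists_common_denominator R (g * g)
    fun r e => if r < 2 * L then v r (Sum.inr (fin (e / g), fin e)) else 0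
  obtain ⟨d₂, z₂, hd₂, hz₂⟩ := exists_common_denominator R (g * g)
    fun r e => if r < 2 * L then c (fin e) (fin (e / g)) r else 0
  refine ⟨⟨g, R, d₀ * d₁ * d₂, fun t => if t = 0 then z₀ else if t = 1 then z₁ else z₂, hg, hR,
    by positivity, ?_⟩, rfl, rfl⟩
  intro i hi j hj j' hj' l hl l' hl' i' hi'
  have hlt : ∀ {x y}, x < g → y < g → x * g + y < g * g := fun {x y} hx hy => by nlinarith
  have key := hc (fin i') (fin l') (Sum.inl (fin i, fin j)) (Sum.inr (fin j', fin l))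
  simp only [mixed_productEntry, fin_inj hi' hi, fin_inj hj hj', fin_inj hl hl'] at key
  have hsum : (∑ r ∈ Finset.range R, (z₀ r (i * g + j) : ℚ) * z₁ r (j' * g + l) *
      z₂ r (l' * g + i')) = (d₀ * d₁ * d₂ : ℕ) * ∑ r ∈ Finset.range (2 * L),
        c (fin i') (fin l') r * u r (Sum.inl (fin i, fin j)) * v r (Sum.inr (fin j', fin l)) := by
    rw [← Finset.sum_subset (Finset.range_mono hLR), Finset.mul_sum]
    · refine Finset.sum_congr rfl fun r hr => ?_
      have hr2 := Finset.mem_range.1 hr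
      rw [hz₀ r (by omega) _ (hlt hi hj), hz₁ r (by omega) _ (hlt hj' hl),
        hz₂ r (by omega) _ (hlt hl' hi')]
      simp only [hr2, if_true, (hdm hj).1, (hdm hj).2, (hdm hl).1, (hdm hl).2, (hdm hi').1,
        (hdm hi').2]
      push_cast
      ring
    · intro r hr hr2
      rw [Finset.mem_range] at hr hr2
      rw [hz₀ r hr _ (hlt hi hj)]
      simp [hr2]
  rw [← key] at hsum
  have : ((∑ r ∈ Finset.range R, z₀ r (i * g + j) * z₁ r (j' * g + l) * z₂ r (l' * g + i') : ℤ) : ℚ)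
      = ((if j = j' ∧ l = l' ∧ i = i' then ((d₀ * d₁ * d₂ : ℕ) : ℤ) else 0 : ℤ) : ℚ) := by
    push_cast at hsum ⊢
    rw [hsum]
    by_cases h1 : i' = i <;> by_cases h2 : j = j' <;> by_cases h3 : l = l' <;>
      simp [h1, h2, h3, eq_comm]
    exact fun h => absurd h.symm h1
  exact_mod_cast this

/-- Decompositions exist with an exponent as close to `omega` as desired. -/
theorem exists_decomposition_rpow {ε : ℝ} (hε : 0 < ε) :
    ∃ d : Decomposition, (d.R : ℝ) ≤ (d.g : ℝ) ^ (omega + ε) := by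
  obtain ⟨τ, ⟨C, hC⟩, hτ⟩ := Real.lt_sInf_add_pos exponents_nonempty hε
  change τ < omega + ε at hτ
  -- For large `g` the surplus `g ^ (omega + ε - τ)` absorbs both the constant `C` and the factor
  -- `2` in the rank.
  have hlim : Filter.Tendsto (fun N : ℕ => (N : ℝ) ^ (omega + ε - τ)) Filter.atTop Filter.atTop :=
    (tendsto_rpow_atTop (by linarith)).comp tendsto_natCast_atTop_atTop
  obtain ⟨g, hg1, hg2⟩ := ((hlim.eventually_ge_atTop (2 * C)).and
    (Filter.eventually_ge_atTop 2)).exists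
  obtain ⟨L, hL, hLC⟩ := hC g
  obtain ⟨d, hd1, hd2⟩ := exists_decomposition hg2 hL (R := max (2 * L) (g ^ 2))
    (le_max_left _ _) (le_max_right _ _)
  refine ⟨d, ?_⟩
  rw [hd1, hd2]
  have hpos : (1 : ℝ) ≤ g := by exact_mod_cast (by omega : 1 ≤ g)
  push_cast
  refine max_le ?_ ?_
  · have h2 : (g : ℝ) ^ (omega + ε - τ) * (g : ℝ) ^ τ = (g : ℝ) ^ (omega + ε) := by
      rw [← Real.rpow_add (by linarith), sub_add_cancel]
    have h3 := mul_le_mul_of_nonneg_right hg1 (Real.rpow_nonneg (by linarith : (0 : ℝ) ≤ g) τ)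
    linarith
  · rw [← Real.rpow_two]
    exact Real.rpow_le_rpow_of_exponent_le hpos (by linarith [two_le_omega])

end

end MatMul

/-! ### Tensor powers, digits and traces -/

namespace CliqueAlg

open Finset

/-- The digit number `i` of `x` in base `b`. -/
def dg (b i x : ℕ) : ℕ := x / b ^ i % b

theorem dg_lt {b : ℕ} (hb : 0 < b) (i x : ℕ) : dg b i x < b := Nat.mod_lt _ hb

theorem dg_low {b t i : ℕ} (hi : i < t) (c x : ℕ) : dg b i (c * b ^ t + x) = dg b i x := by
  rcases Nat.eq_zero_or_pos b with rfl | hb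
  · simp only [dg, Nat.mod_zero]
    rw [zero_pow (by omega : t ≠ 0), Nat.mul_zero, Nat.zero_add]
  · unfold dg
    obtain ⟨e, rfl⟩ := Nat.exists_eq_add_of_lt hi
    rw [show c * b ^ (i + e + 1) + x = b ^ i * (b * (c * b ^ e)) + x by ring,
      Nat.mul_add_div (by positivity), Nat.mul_add_mod]

theorem dg_top {b t c x : ℕ} (hc : c < b) (hx : x < b ^ t) : dg b t (c * b ^ t + x) = c := by
  unfold dg
  rw [Nat.mul_comm, Nat.mul_add_div (by omega), Nat.div_eq_of_lt hx, Nat.add_zero,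
    Nat.mod_eq_of_lt hc]

theorem dg_high {b t x : ℕ} (hb : 0 < b) (hx : x < b ^ t) (i c : ℕ) :
    dg b (t + i) (c * b ^ t + x) = dg b i c := by
  unfold dg
  rw [pow_add, ← Nat.div_div_eq_div_mul, Nat.mul_comm c, Nat.mul_add_div (by positivity),
    Nat.div_eq_of_lt hx, Nat.add_zero]

theorem sum_range_mul {K : Type*} [AddCommMonoid K] (a b : ℕ) (F : ℕ → K) :
    ∑ x ∈ range (a * b), F x = ∑ i ∈ range a, ∑ j ∈ range b, F (i * b + j) := by
  induction a with
  | zero => simp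
  | succ a ih => rw [Nat.succ_mul, sum_range_add, ih, sum_range_succ]

section Tensor

variable {K : Type*} [CommRing K]

/-- The entry `(ρ, δ)` of the `t`-th tensor power of the `R × s` matrix `co`. -/
def tpow (R s : ℕ) (co : ℕ → ℕ → K) (t ρ δ : ℕ) : K :=
  ∏ i ∈ range t, co (dg R i ρ) (dg s i δ)

theorem tpow_succ {R s : ℕ} (co : ℕ → ℕ → K) {t r d ρ δ : ℕ} (hr : r < R) (hd : d < s)
    (hρ : ρ < R ^ t) (hδ : δ < s ^ t) :
    tpow R s co (t + 1) (r * R ^ t + ρ) (d * s ^ t + δ) = co r d * tpow R s co t ρ δ := by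
  rw [tpow, prod_range_succ, dg_top hr hρ, dg_top hd hδ, mul_comm]
  congr 1
  refine prod_congr rfl fun i hi => ?_
  rw [dg_low (mem_range.1 hi), dg_low (mem_range.1 hi)]

/-- `V'` arises from `V` by transforming the last digit, and moving it to the front. -/
def IsPass (R s : ℕ) (co : ℕ → ℕ → K) (Q : ℕ) (V V' : ℕ → K) : Prop :=
  ∀ r < R, ∀ h < Q, V' (r * Q + h) = ∑ d ∈ range s, co r d * V (h * s + d)

/-- `V` arises from `V₀` by transforming `t` of its `m` digits. -/
def IsTransform (R s : ℕ) (co : ℕ → ℕ → K) (m t : ℕ) (V₀ V : ℕ → K) : Prop :=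
  ∀ ρ < R ^ t, ∀ h < s ^ (m - t),
    V (ρ * s ^ (m - t) + h) = ∑ δ ∈ range (s ^ t), tpow R s co t ρ δ * V₀ (h * s ^ t + δ)

theorem IsTransform.zero (R s : ℕ) (co : ℕ → ℕ → K) (m : ℕ) (V₀ : ℕ → K) :
    IsTransform R s co m 0 V₀ V₀ := by
  intro ρ hρ h hh
  obtain rfl : ρ = 0 := by simpa using hρ
  simp [tpow]

/-- The digits rotate: a pass takes the lowest digit, still in base `s`, and puts its transform in
base `R` in front. After `m` passes all digits are transformed and stand in their original order.
Each pass sums only over one digit, so the full `R ^ m × s ^ m` matrix is never formed. -/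
theorem IsTransform.succ {R s m t : ℕ} {co : ℕ → ℕ → K} {V₀ V V' : ℕ → K} (ht : t < m)
    (hV : IsTransform R s co m t V₀ V)
    (hp : IsPass R s co (R ^ t * s ^ (m - t - 1)) V V') :
    IsTransform R s co m (t + 1) V₀ V' := by
  intro ρ' hρ' h hh
  obtain ⟨e, rfl⟩ := Nat.exists_eq_add_of_lt ht
  have e1 : t + e + 1 - t = e + 1 := by omega
  have e2 : t + e + 1 - t - 1 = e := by omega
  have e3 : t + e + 1 - (t + 1) = e := by omega
  rw [e3] at hh ⊢
  rw [e2] at hp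
  unfold IsTransform at hV
  rw [e1] at hV
  have hRt : 0 < R ^ t := by
    rcases Nat.eq_zero_or_pos (R ^ t) with h0 | h0
    · rw [pow_succ, h0] at hρ'; omega
    · exact h0
  have hr : ρ' / R ^ t < R := Nat.div_lt_of_lt_mul (by rwa [← pow_succ])
  have hρ : ρ' % R ^ t < R ^ t := Nat.mod_lt _ hRt
  have hsplit : ρ' = ρ' / R ^ t * R ^ t + ρ' % R ^ t := (Nat.div_add_mod' _ _).symm
  set r := ρ' / R ^ t
  set ρ := ρ' % R ^ t
  rw [hsplit]
  have hlt : ρ * s ^ e + h < R ^ t * s ^ e := by nlinarith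
  rw [show (r * R ^ t + ρ) * s ^ e + h = r * (R ^ t * s ^ e) + (ρ * s ^ e + h) by ring,
    hp r hr _ hlt, pow_succ s t, mul_comm (s ^ t) s, sum_range_mul]
  refine sum_congr rfl fun d hd => ?_
  have hd' := mem_range.1 hd
  have hlt2 : h * s + d < s ^ (e + 1) := by rw [pow_succ]; nlinarith
  rw [show (ρ * s ^ e + h) * s + d = ρ * s ^ (e + 1) + (h * s + d) by ring, hV ρ hρ _ hlt2,
    mul_sum]
  refine sum_congr rfl fun δ hδ => ?_
  rw [tpow_succ co hr hd' hρ (mem_range.1 hδ),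
    show (h * s + d) * s ^ t + δ = h * (s * s ^ t) + (d * s ^ t + δ) by ring]
  ring

theorem IsTransform.eq {R s m : ℕ} {co : ℕ → ℕ → K} {V₀ V : ℕ → K}
    (h : IsTransform R s co m m V₀ V) {ρ : ℕ} (hρ : ρ < R ^ m) :
    V ρ = ∑ δ ∈ range (s ^ m), tpow R s co m ρ δ * V₀ δ := by
  simpa using h ρ hρ 0 (by simp)

/-- The row of the matrix entry with index `e`: digits in base `g * g` encode pairs of digits. -/
def rowOf (g t e : ℕ) : ℕ := ∑ i ∈ range t, dg (g * g) i e / g * g ^ i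

def colOf (g t e : ℕ) : ℕ := ∑ i ∈ range t, dg (g * g) i e % g * g ^ i

theorem rowOf_succ {g t a b δ : ℕ} (ha : a < g) (hb : b < g) (hδ : δ < (g * g) ^ t) :
    rowOf g (t + 1) ((a * g + b) * (g * g) ^ t + δ) = a * g ^ t + rowOf g t δ := by
  have h : a * g + b < g * g := by nlinarith
  rw [rowOf, sum_range_succ, dg_top h hδ, Nat.mul_comm a g, Nat.mul_add_div (by omega),
    Nat.div_eq_of_lt hb, Nat.add_zero, add_comm]
  congr 1
  exact sum_congr rfl fun i hi => by rw [dg_low (mem_range.1 hi)]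

theorem colOf_succ {g t a b δ : ℕ} (ha : a < g) (hb : b < g) (hδ : δ < (g * g) ^ t) :
    colOf g (t + 1) ((a * g + b) * (g * g) ^ t + δ) = b * g ^ t + colOf g t δ := by
  have h : a * g + b < g * g := by nlinarith
  rw [colOf, sum_range_succ, dg_top h hδ, Nat.mul_comm a g, Nat.mul_add_mod,
    Nat.mod_eq_of_lt hb, add_comm]
  congr 1
  exact sum_congr rfl fun i hi => by rw [dg_low (mem_range.1 hi)]

theorem rowOf_lt {g : ℕ} (hg : 0 < g) (t e : ℕ) : rowOf g t e < g ^ t := by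
  induction t with
  | zero => simp [rowOf]
  | succ t ih =>
    rw [rowOf, sum_range_succ, ← rowOf, pow_succ]
    have : dg (g * g) t e / g < g := Nat.div_lt_of_lt_mul (dg_lt (by positivity) _ _)
    nlinarith

theorem colOf_lt {g : ℕ} (hg : 0 < g) (t e : ℕ) : colOf g t e < g ^ t := by
  induction t with
  | zero => simp [colOf]
  | succ t ih =>
    rw [colOf, sum_range_succ, ← colOf, pow_succ]
    have : dg (g * g) t e % g < g := Nat.mod_lt _ hg
    nlinarith

/-- The `t`-th tensor power of the coefficient matrix number `c`, applied to a matrix. -/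
def transform (d : MatMul.Decomposition) (c t : ℕ) (X : ℕ → ℕ → K) (ρ : ℕ) : K :=
  ∑ δ ∈ range ((d.g * d.g) ^ t), tpow d.R (d.g * d.g) (fun r e => (d.coef c r e : K)) t ρ δ *
    X (rowOf d.g t δ) (colOf d.g t δ)

/-- Splitting off the leading digit means viewing `X` as a `g × g` matrix of blocks and combining
the blocks with the coefficients of row `r`. -/
theorem transform_succ (d : MatMul.Decomposition) (c t : ℕ) (X : ℕ → ℕ → K) {r ρ : ℕ}
    (hr : r < d.R) (hρ : ρ < d.R ^ t) :
    transform d c (t + 1) X (r * d.R ^ t + ρ) = transform d c t (fun i j =>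
      ∑ a ∈ range d.g, ∑ b ∈ range d.g,
        (d.coef c r (a * d.g + b) : K) * X (a * d.g ^ t + i) (b * d.g ^ t + j)) ρ := by
  have hg := d.two_le
  rw [transform, pow_succ, mul_comm _ (d.g * d.g), sum_range_mul, sum_range_mul, transform]
  simp only [mul_sum]
  conv_rhs => rw [sum_comm]
  refine sum_congr rfl fun a ha => ?_
  conv_rhs => rw [sum_comm]
  refine sum_congr rfl fun b hb => sum_congr rfl fun δ hδ => ?_
  rw [mem_range] at ha hb hδ
  rw [tpow_succ _ hr (by nlinarith) hρ hδ, rowOf_succ ha hb hδ, colOf_succ ha hb hδ]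
  ring

/-- The case of a single level: after expansion into triples of index pairs, `d.identity` leaves
just the cyclically matching triples, each with the factor `D`. -/
theorem trilinear_expand (d : MatMul.Decomposition) (X Y Z : ℕ → ℕ → K) :
    ∑ r ∈ range d.R,
      (∑ a ∈ range d.g, ∑ b ∈ range d.g, (d.coef 0 r (a * d.g + b) : K) * X a b) *
      (∑ a ∈ range d.g, ∑ b ∈ range d.g, (d.coef 1 r (a * d.g + b) : K) * Y a b) *
      (∑ a ∈ range d.g, ∑ b ∈ range d.g, (d.coef 2 r (a * d.g + b) : K) * Z a b) =
    d.D * ∑ a ∈ range d.g, ∑ b ∈ range d.g, ∑ c ∈ range d.g, X a b * Y b c * Z c a := by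
  set G := range d.g ×ˢ range d.g with hG
  have h1 : ∀ r, (∑ a ∈ range d.g, ∑ b ∈ range d.g, (d.coef 0 r (a * d.g + b) : K) * X a b) *
      (∑ a ∈ range d.g, ∑ b ∈ range d.g, (d.coef 1 r (a * d.g + b) : K) * Y a b) *
      (∑ a ∈ range d.g, ∑ b ∈ range d.g, (d.coef 2 r (a * d.g + b) : K) * Z a b) =
      ∑ x ∈ G, ∑ y ∈ G, ∑ z ∈ G, ((d.coef 0 r (x.1 * d.g + x.2) * d.coef 1 r (y.1 * d.g + y.2) *
        d.coef 2 r (z.1 * d.g + z.2) : ℤ) : K) * (X x.1 x.2 * Y y.1 y.2 * Z z.1 z.2) := by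
    intro r
    rw [hG, ← sum_product', ← sum_product', ← sum_product', sum_mul_sum, sum_mul]
    refine sum_congr rfl fun x _ => ?_
    rw [sum_mul_sum]
    refine sum_congr rfl fun y _ => sum_congr rfl fun z _ => ?_
    push_cast
    ring
  have h2 : ∀ x ∈ G, ∀ y ∈ G, ∀ z ∈ G, ∑ r ∈ range d.R,
      ((d.coef 0 r (x.1 * d.g + x.2) * d.coef 1 r (y.1 * d.g + y.2) *
        d.coef 2 r (z.1 * d.g + z.2) : ℤ) : K) * (X x.1 x.2 * Y y.1 y.2 * Z z.1 z.2) =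
      if y.1 = x.2 then (if z.1 = y.2 then (if z.2 = x.1 then
        (d.D : K) * (X x.1 x.2 * Y y.1 y.2 * Z z.1 z.2) else 0) else 0) else 0 := by
    intro x hx y hy z hz
    simp only [hG, mem_product, mem_range] at hx hy hz
    rw [← sum_mul, ← Int.cast_sum,
      d.identity x.1 hx.1 x.2 hx.2 y.1 hy.1 y.2 hy.2 z.1 hz.1 z.2 hz.2]
    by_cases e1 : y.1 = x.2 <;> by_cases e2 : z.1 = y.2 <;> by_cases e3 : z.2 = x.1 <;>
      simp [e1, e2, e3, eq_comm]
    · exact fun h => absurd h.symm e3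
  simp only [h1]
  rw [sum_comm]
  rw [mul_sum, hG, sum_product]
  refine sum_congr rfl fun a ha => ?_
  rw [mul_sum]
  refine sum_congr rfl fun b hb => ?_
  rw [← hG, sum_comm]
  have hab : (a, b) ∈ G := by simp [hG, mem_range.1 ha, mem_range.1 hb]
  have h3 : ∀ y ∈ G, ∑ r ∈ range d.R, ∑ z ∈ G,
      ((d.coef 0 r (a * d.g + b) * d.coef 1 r (y.1 * d.g + y.2) *
        d.coef 2 r (z.1 * d.g + z.2) : ℤ) : K) * (X a b * Y y.1 y.2 * Z z.1 z.2) =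
      if y.1 = b then (d.D : K) * (X a b * Y y.1 y.2 * Z y.2 a) else 0 := by
    intro y hy
    rw [sum_comm, sum_congr rfl (h2 (a, b) hab y hy), hG, sum_product]
    simp only [hG, mem_product, mem_range] at hy
    by_cases e : y.1 = b
    · simp only [e, if_true]
      rw [sum_eq_single_of_mem y.2 (mem_range.2 hy.2) (fun c _ hc => by simp [hc])]
      simp only [if_true]
      rw [sum_eq_single_of_mem a ha (fun c _ hc => by simp [hc])]
      simp
    · simp [e]
  rw [sum_congr rfl h3, hG, sum_product, sum_eq_single_of_mem b hb (fun c _ hc => by simp [hc]),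
    mul_sum]
  simp

/-- The trace of a product of three matrices, computed by a decomposition of the matrix
multiplication tensor. -/
theorem sum_transform (d : MatMul.Decomposition) (t : ℕ) (X Y Z : ℕ → ℕ → K) :
    ∑ ρ ∈ range (d.R ^ t), transform d 0 t X ρ * transform d 1 t Y ρ * transform d 2 t Z ρ =
      (d.D : K) ^ t * ∑ i ∈ range (d.g ^ t), ∑ j ∈ range (d.g ^ t), ∑ l ∈ range (d.g ^ t),
        X i j * Y j l * Z l i := by
  induction t generalizing X Y Z with
  | zero => simp [transform, tpow, rowOf, colOf]
  | succ t ih =>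
    rw [pow_succ, mul_comm _ d.R, sum_range_mul]
    have h1 : ∀ r ∈ range d.R, ∑ ρ ∈ range (d.R ^ t),
        transform d 0 (t + 1) X (r * d.R ^ t + ρ) * transform d 1 (t + 1) Y (r * d.R ^ t + ρ) *
          transform d 2 (t + 1) Z (r * d.R ^ t + ρ) =
        (d.D : K) ^ t * ∑ i ∈ range (d.g ^ t), ∑ j ∈ range (d.g ^ t), ∑ l ∈ range (d.g ^ t),
          (∑ a ∈ range d.g, ∑ b ∈ range d.g,
            (d.coef 0 r (a * d.g + b) : K) * X (a * d.g ^ t + i) (b * d.g ^ t + j)) *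
          (∑ a ∈ range d.g, ∑ b ∈ range d.g,
            (d.coef 1 r (a * d.g + b) : K) * Y (a * d.g ^ t + j) (b * d.g ^ t + l)) *
          (∑ a ∈ range d.g, ∑ b ∈ range d.g,
            (d.coef 2 r (a * d.g + b) : K) * Z (a * d.g ^ t + l) (b * d.g ^ t + i)) := by
      intro r hr
      rw [← ih]
      refine sum_congr rfl fun ρ hρ => ?_
      rw [transform_succ d 0 t X (mem_range.1 hr) (mem_range.1 hρ),
        transform_succ d 1 t Y (mem_range.1 hr) (mem_range.1 hρ),
        transform_succ d 2 t Z (mem_range.1 hr) (mem_range.1 hρ)]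
    rw [sum_congr rfl h1, ← mul_sum, pow_succ, mul_assoc]
    congr 1
    -- Each of the three indices is split into its block and its place inside the block. With the
    -- places fixed, the sums over blocks form an instance of `trilinear_expand`.
    have h2 : ∀ F : ℕ → ℕ → ℕ → K, ∑ i ∈ range (d.g ^ (t + 1)), ∑ j ∈ range (d.g ^ (t + 1)),
        ∑ l ∈ range (d.g ^ (t + 1)), F i j l =
        ∑ i ∈ range (d.g ^ t), ∑ j ∈ range (d.g ^ t), ∑ l ∈ range (d.g ^ t),
          ∑ a ∈ range d.g, ∑ b ∈ range d.g, ∑ c ∈ range d.g,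
            F (a * d.g ^ t + i) (b * d.g ^ t + j) (c * d.g ^ t + l) := by
      intro F
      have e : ∀ f : ℕ → K, ∑ i ∈ range (d.g ^ (t + 1)), f i =
          ∑ i ∈ range (d.g ^ t), ∑ a ∈ range d.g, f (a * d.g ^ t + i) := by
        intro f
        rw [pow_succ, mul_comm, sum_range_mul, sum_comm]
      simp only [e]
      refine sum_congr rfl fun i _ => ?_
      rw [sum_comm]
      refine sum_congr rfl fun j _ => ?_
      have : ∀ a ∈ range d.g, ∑ b ∈ range d.g, ∑ l ∈ range (d.g ^ t), ∑ c ∈ range d.g,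
          F (a * d.g ^ t + i) (b * d.g ^ t + j) (c * d.g ^ t + l) =
          ∑ l ∈ range (d.g ^ t), ∑ b ∈ range d.g, ∑ c ∈ range d.g,
          F (a * d.g ^ t + i) (b * d.g ^ t + j) (c * d.g ^ t + l) := fun a _ => sum_comm
      rw [sum_congr rfl this, sum_comm]
    rw [h2, mul_sum, sum_comm]
    refine sum_congr rfl fun i _ => ?_
    rw [mul_sum, sum_comm]
    refine sum_congr rfl fun j _ => ?_
    rw [mul_sum, sum_comm]
    refine sum_congr rfl fun l _ => ?_
    exact trilinear_expand d (fun a b => X (a * d.g ^ t + i) (b * d.g ^ t + j))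
      (fun a b => Y (a * d.g ^ t + j) (b * d.g ^ t + l))
      (fun a b => Z (a * d.g ^ t + l) (b * d.g ^ t + i))

end Tensor

end CliqueAlg

namespace CliqueAlg

open Finset

/-! ### Sums over tuples of vertices -/

section Tuples

variable {K : Type*} [CommRing K]

/-- The product of `E` over all pairs of positions of the `q`-tuple of digits of `x`. -/
def pairProd (n q : ℕ) (E : ℕ → ℕ → K) (x : ℕ) : K :=
  ∏ u ∈ range q, ∏ t ∈ range u, E (dg n t x) (dg n u x)

/-- The product of `E` over all pairs of positions of two `k`-tuples. -/
def crossProd (n k : ℕ) (E : ℕ → ℕ → K) (x y : ℕ) : K :=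
  ∏ u ∈ range k, ∏ t ∈ range k, E (dg n t x) (dg n u y)

theorem crossProd_comm {n k : ℕ} {E : ℕ → ℕ → K} (hE : ∀ a < n, ∀ b < n, E a b = E b a)
    (hn : 0 < n) (x y : ℕ) : crossProd n k E x y = crossProd n k E y x := by
  rw [crossProd, prod_comm]
  exact prod_congr rfl fun u _ => prod_congr rfl fun t _ => hE _ (dg_lt hn _ _) _ (dg_lt hn _ _)

theorem pairProd_append {n k j : ℕ} (hn : 0 < n) (E : ℕ → ℕ → K) {x : ℕ} (y : ℕ)
    (hx : x < n ^ k) : pairProd n (k + j) E (y * n ^ k + x) = pairProd n k E x *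
      ((∏ u ∈ range j, ∏ t ∈ range k, E (dg n t x) (dg n u y)) * pairProd n j E y) := by
  rw [pairProd, prod_range_add]
  congr 1
  · refine prod_congr rfl fun u hu => prod_congr rfl fun t ht => ?_
    rw [mem_range] at hu ht
    rw [dg_low hu, dg_low (by omega)]
  · rw [pairProd, ← prod_mul_distrib]
    refine prod_congr rfl fun u _ => ?_
    rw [prod_range_add]
    congr 1
    · refine prod_congr rfl fun t ht => ?_
      rw [dg_low (mem_range.1 ht), dg_high hn hx]
    · refine prod_congr rfl fun t ht => ?_
      rw [dg_high hn hx, dg_high hn hx]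

/-- The trace of the third power of the matrix that joins `k`-tuples. -/
theorem trace_eq {n : ℕ} (hn : 0 < n) (k : ℕ) (E : ℕ → ℕ → K)
    (hE : ∀ a < n, ∀ b < n, E a b = E b a) :
    ∑ i ∈ range (n ^ k), ∑ j ∈ range (n ^ k), ∑ l ∈ range (n ^ k),
      (pairProd n k E i * crossProd n k E i j) * (pairProd n k E j * crossProd n k E j l) *
        (pairProd n k E l * crossProd n k E l i) =
    ∑ x ∈ range (n ^ (3 * k)), pairProd n (3 * k) E x := by
  have e : n ^ (3 * k) = n ^ k * n ^ k * n ^ k := by rw [← pow_add, ← pow_add]; congr 1; ring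
  rw [e, sum_range_mul, sum_range_mul]
  refine sum_congr rfl fun a ha => ?_
  -- The tuple consists of `a = i` (high digits), `b = l` and `c = j` (low digits). All cross
  -- products then have the orientation found in the tuple, save that of `a` and `c`; there the
  -- symmetry of `E` is used.
  rw [sum_comm]
  refine sum_congr rfl fun b hb => sum_congr rfl fun c hc => ?_
  rw [mem_range] at ha hb hc
  rw [show 3 * k = k + (k + k) by ring, pairProd_append hn E _ hc, pairProd_append hn E _ hb,
    prod_range_add]
  have h1 : ∏ u ∈ range k, ∏ t ∈ range k, E (dg n t c) (dg n u (a * n ^ k + b)) =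
      crossProd n k E c b :=
    prod_congr rfl fun u hu => prod_congr rfl fun t _ => by rw [dg_low (mem_range.1 hu)]
  have h2 : ∏ u ∈ range k, ∏ t ∈ range k, E (dg n t c) (dg n (k + u) (a * n ^ k + b)) =
      crossProd n k E c a :=
    prod_congr rfl fun u hu => prod_congr rfl fun t _ => by rw [dg_high hn hb]
  rw [h1, h2, ← crossProd, crossProd_comm hE hn a c]
  ring

/-- Matrices padded with zeros have the same traces. -/
theorem trace_padded {N N' : ℕ} (h : N ≤ N') (X : ℕ → ℕ → K) :
    ∑ i ∈ range N', ∑ j ∈ range N', ∑ l ∈ range N',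
      (if i < N ∧ j < N then X i j else 0) * (if j < N ∧ l < N then X j l else 0) *
        (if l < N ∧ i < N then X l i else 0) =
    ∑ i ∈ range N, ∑ j ∈ range N, ∑ l ∈ range N, X i j * X j l * X l i := by
  symm
  have e : ∀ f : ℕ → K, (∀ i, ¬ i < N → f i = 0) →
      ∑ i ∈ range N, f i = ∑ i ∈ range N', f i := fun f hf =>
    sum_subset (range_mono h) fun i _ hi => hf i (by simpa using hi)
  rw [← e _ (fun i hi => by simp [hi])]
  refine sum_congr rfl fun i hi => ?_
  rw [← e _ (fun j hj => by simp [hj])]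
  refine sum_congr rfl fun j hj => ?_
  rw [← e _ (fun l hl => by simp [hl])]
  refine sum_congr rfl fun l hl => ?_
  rw [mem_range] at hi hj hl
  simp [hi, hj, hl]

end Tuples

/-! ### Weights of tuples -/

/-- An edge array `ef` holds, at `a * n + b`, the weight plus one, or `0` for a non-edge. -/
def TupleClique (n q : ℕ) (ef : ℕ → ℕ) (x : ℕ) : Prop :=
  ∀ u < q, ∀ t < u, ef (dg n t x * n + dg n u x) ≠ 0

instance (n q : ℕ) (ef : ℕ → ℕ) : DecidablePred (TupleClique n q ef) :=
  fun _ => inferInstanceAs (Decidable (∀ u < q, ∀ t < u, _))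

def tupleWeight (n q : ℕ) (ef : ℕ → ℕ) (x : ℕ) : ℕ :=
  ∑ u ∈ range q, ∑ t ∈ range u, (ef (dg n t x * n + dg n u x) - 1)

/-- The maximum weight of a clique of `q` vertices plus one, or `0` if there is none. -/
def optVal (n q : ℕ) (ef : ℕ → ℕ) : ℕ :=
  ((range (n ^ q)).filter (TupleClique n q ef)).sup fun x => tupleWeight n q ef x + 1

theorem tupleWeight_le {n q Wm : ℕ} {ef : ℕ → ℕ} (hn : 0 < n)
    (hef : ∀ a < n, ∀ b < n, ef (a * n + b) ≤ Wm) (x : ℕ) :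
    tupleWeight n q ef x ≤ q * q * Wm := by
  calc tupleWeight n q ef x ≤ ∑ u ∈ range q, ∑ t ∈ range u, Wm := by
        refine sum_le_sum fun u _ => sum_le_sum fun t _ => ?_
        have := hef _ (dg_lt hn t x) _ (dg_lt hn u x)
        omega
    _ ≤ ∑ u ∈ range q, q * Wm := by
        refine sum_le_sum fun u hu => ?_
        rw [sum_const, card_range, smul_eq_mul]
        exact Nat.mul_le_mul_right _ (mem_range.1 hu).le
    _ = q * q * Wm := by rw [sum_const, card_range, smul_eq_mul]; ring

/-- `x ^ weight`, and `0` for a non-edge. -/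
def edgePow {K : Type*} [CommRing K] (n : ℕ) (ef : ℕ → ℕ) (x : K) (a b : ℕ) : K :=
  if ef (a * n + b) = 0 then 0 else x ^ (ef (a * n + b) - 1)

theorem pairProd_edgePow {K : Type*} [CommRing K] (n q : ℕ) (ef : ℕ → ℕ) (x : K) (i : ℕ) :
    pairProd n q (edgePow n ef x) i =
      if TupleClique n q ef i then x ^ tupleWeight n q ef i else 0 := by
  unfold pairProd
  split_ifs with h
  · rw [tupleWeight, ← prod_pow_eq_pow_sum]
    refine prod_congr rfl fun u hu => ?_
    rw [← prod_pow_eq_pow_sum]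
    refine prod_congr rfl fun t ht => ?_
    rw [edgePow, if_neg (h u (mem_range.1 hu) t (mem_range.1 ht))]
  · unfold TupleClique at h
    push Not at h
    obtain ⟨u, hu, t, ht, h0⟩ := h
    refine prod_eq_zero (mem_range.2 hu) (prod_eq_zero (mem_range.2 ht) ?_)
    rw [edgePow, if_pos h0]

/-- So the sum is a polynomial in `x` whose coefficient at `x ^ e` counts the clique tuples of
weight `e`. -/
theorem sum_pairProd_edgePow {K : Type*} [CommRing K] (n q : ℕ) (ef : ℕ → ℕ) (x : K) :
    ∑ i ∈ range (n ^ q), pairProd n q (edgePow n ef x) i =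
      ∑ i ∈ (range (n ^ q)).filter (TupleClique n q ef), x ^ tupleWeight n q ef i := by
  rw [sum_filter]
  exact sum_congr rfl fun i _ => pairProd_edgePow n q ef x i

/-! ### Degrees by finite differences -/

open fwdDiff in
-- The `e`-th difference annihilates lower powers and turns `x ^ e` into the constant `e!`; it
-- therefore isolates the coefficient at `x ^ e`.
theorem fwdDiff_iter_sum_pow {K ι : Type*} [CommRing K] (c : K) (s : Finset ι) (w : ι → ℕ) {e : ℕ}
    (he : ∀ i ∈ s, w i ≤ e) (y : K) :
    (fwdDiff 1)^[e] (fun x : K => c * ∑ i ∈ s, x ^ w i) y =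
      c * ((s.filter fun i => w i = e).card * e.factorial : ℕ) := by
  have h1 : (fun x : K => c * ∑ i ∈ s, x ^ w i) = c • ∑ i ∈ s, fun x : K => x ^ w i := by
    ext x; simp
  rw [h1, fwdDiff_iter_const_smul, fwdDiff_iter_finsetSum, Pi.smul_apply, Finset.sum_apply, smul_eq_mul]
  congr 1
  have h2 : ∀ i ∈ s, (fwdDiff 1)^[e] (fun x : K => x ^ w i) y =
      if w i = e then (e.factorial : K) else 0 := by
    intro i hi
    split_ifs with h
    · rw [h, fwdDiff_iter_eq_factorial]; simp
    · rw [fwdDiff_iter_pow_eq_zero_of_lt (lt_of_le_of_ne (he i hi) h)]; simp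
  rw [sum_congr rfl h2, ← sum_filter, sum_const, nsmul_eq_mul]
  push_cast
  rfl

/-- Meant for `a` the number of optimal tuples, which `p` may divide. As `0 < a < p ^ j`, the full
power `p ^ j` does not, and this is the reason for a prime power as modulus. -/
theorem natCast_ne_zero_of_coprime {p j a b : ℕ} (hp : p.Prime) (ha : 0 < a) (haM : a < p ^ j)
    (hb : ¬ p ∣ b) : ((a * b : ℕ) : ZMod (p ^ j)) ≠ 0 := by
  rw [Ne, ZMod.natCast_eq_zero_iff]
  intro h
  have hc : Nat.Coprime (p ^ j) b := Nat.Coprime.pow_left _ ((Nat.Prime.coprime_iff_not_dvd hp).2 hb)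
  exact absurd (Nat.le_of_dvd ha (hc.dvd_of_dvd_mul_right h)) (by omega)

/-- The largest `e ≤ D` with a nonzero `e`-th difference at `0` determines the maximal weight. -/
theorem sup_eq_of_differences {ι : Type*} {p j D d m : ℕ} (hp : p.Prime) (hD : D < p)
    (hd : 0 < d) (hdp : d < p) (s : Finset ι) (w : ι → ℕ) (hw : ∀ i ∈ s, w i ≤ D)
    (hs : s.card < p ^ j) {val : ℕ}
    (hval : val = ((range (D + 1)).filter fun e =>
      (fwdDiff 1)^[e] (fun x : ZMod (p ^ j) => (d : ZMod (p ^ j)) ^ m * ∑ i ∈ s, x ^ w i) 0 ≠ 0).sup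
        (· + 1)) :
    val = s.sup fun i => w i + 1 := by
  subst hval
  set f := fun x : ZMod (p ^ j) => (d : ZMod (p ^ j)) ^ m * ∑ i ∈ s, x ^ w i
  apply le_antisymm
  · refine Finset.sup_le fun e he => ?_
    rw [mem_filter, mem_range] at he
    by_contra! hlt
    have h1 : ∀ i ∈ s, w i < e := fun i hi => by
      have := Finset.le_sup (f := fun i => w i + 1) hi
      omega
    apply he.2
    rw [fwdDiff_iter_sum_pow _ _ _ fun i hi => (h1 i hi).le]
    rw [filter_eq_empty_iff.2 fun i hi => (h1 i hi).ne]
    simp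
  · refine Finset.sup_le fun i hi => ?_
    obtain ⟨i₀, hi₀, hmax⟩ := exists_max_image s w ⟨i, hi⟩
    refine (Nat.add_le_add_right (hmax i hi) 1).trans ?_
    refine Finset.le_sup (f := fun e => e + 1) ?_
    rw [mem_filter, mem_range]
    have hi₀D := hw i₀ hi₀
    refine ⟨by omega, ?_⟩
    rw [fwdDiff_iter_sum_pow _ _ _ hmax]
    -- The scaling `d ^ m` and the factorial are prime to `p`, since `d < p` and `w i₀ ≤ D < p`.
    have := natCast_ne_zero_of_coprime (p := p) (j := j)
      (a := (s.filter fun i => w i = w i₀).card) (b := d ^ m * (w i₀).factorial) hp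
      (card_pos.2 ⟨i₀, by simp [hi₀]⟩) ((card_filter_le _ _).trans_lt hs) (by
        rw [hp.dvd_mul]
        rintro (h | h)
        · exact absurd (Nat.le_of_dvd hd (hp.dvd_of_dvd_pow h)) (by omega)
        · rw [hp.dvd_factorial] at h; omega)
    convert this using 1
    push_cast
    ring

end CliqueAlg

/-! ### Cliques and tuples -/

namespace CliqueAlg

open Finset WeightedClique

variable {n q : ℕ} {G : SimpleGraph (Fin n)}

/-- The pairs `t < u` of positions in a `q`-tuple. -/
def posPairs (q : ℕ) : Finset (Fin q × Fin q) := univ.filter fun p => p.1 < p.2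

theorem sum_posPairs {M : Type*} [AddCommMonoid M] (q : ℕ) (F : ℕ → ℕ → M) :
    ∑ p ∈ posPairs q, F p.1 p.2 = ∑ u ∈ range q, ∑ t ∈ range u, F t u := by
  rw [posPairs, sum_filter, Fintype.sum_prod_type, sum_comm,
    ← Fin.sum_univ_eq_sum_range (fun u => ∑ t ∈ range u, F t u) q]
  refine sum_congr rfl fun u _ => ?_
  simp only [Fin.lt_def]
  rw [Fin.sum_univ_eq_sum_range (fun t => if t < (u : ℕ) then F t u else 0) q, ← sum_filter]
  congr 1
  ext t
  simp only [mem_filter, mem_range]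
  have := u.2
  omega

/-- Adjacent vertices differ, so `f` is injective and every edge inside the image comes from exactly
one increasing pair of positions. -/
theorem weight_image (w : Sym2 (Fin n) → ℕ) (f : Fin q → Fin n)
    (hf : ∀ t u, t < u → G.Adj (f t) (f u)) :
    weight G w (univ.image f) = ∑ p ∈ posPairs q, w s(f p.1, f p.2) := by
  classical
  have hadj : ∀ t u, t ≠ u → G.Adj (f t) (f u) := fun t u h =>
    (lt_or_gt_of_ne h).elim (hf t u) fun h => (hf u t h).symm
  have hinj : Function.Injective f := fun t u h => by
    by_contra hne
    exact (hadj t u hne).ne h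
  unfold weight
  symm
  refine sum_bij (fun p _ => s(f p.1, f p.2)) ?_ ?_ ?_ ?_
  · intro p hp
    simp only [posPairs, mem_filter, mem_univ, true_and] at hp
    simp only [mem_filter, mem_univ, true_and, SimpleGraph.mem_edgeSet]
    refine ⟨hf _ _ hp, fun v hv => ?_⟩
    rcases Sym2.mem_iff.1 hv with rfl | rfl <;> simp
  · rintro ⟨t, u⟩ h1 ⟨t', u'⟩ h2 h
    simp only [posPairs, mem_filter, mem_univ, true_and] at h1 h2
    simp only [Sym2.eq_iff, hinj.eq_iff] at h
    rcases h with ⟨rfl, rfl⟩ | ⟨rfl, rfl⟩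
    · rfl
    · exact absurd h1 (not_lt.2 h2.le)
  · intro e he
    induction e using Sym2.ind with
    | _ a b =>
      simp only [mem_filter, mem_univ, true_and, SimpleGraph.mem_edgeSet] at he
      obtain ⟨t, -, rfl⟩ := mem_image.1 (he.2 a (Sym2.mem_mk_left _ _))
      obtain ⟨u, -, rfl⟩ := mem_image.1 (he.2 b (Sym2.mem_mk_right _ _))
      have hne : t ≠ u := fun h => he.1.ne (by rw [h])
      rcases lt_or_gt_of_ne hne with h | h
      · exact ⟨(t, u), by simpa [posPairs] using h, rfl⟩
      · exact ⟨(u, t), by simpa [posPairs] using h, Sym2.eq_swap⟩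
  · intro p hp
    rfl

theorem isNClique_image (f : Fin q → Fin n) (hf : ∀ t u, t < u → G.Adj (f t) (f u)) :
    G.IsNClique q (univ.image f) := by
  classical
  have hadj : ∀ t u, t ≠ u → G.Adj (f t) (f u) := fun t u h =>
    (lt_or_gt_of_ne h).elim (hf t u) fun h => (hf u t h).symm
  have hinj : Function.Injective f := fun t u h => by
    by_contra hne
    exact (hadj t u hne).ne h
  refine ⟨?_, by rw [card_image_of_injective _ hinj, card_univ, Fintype.card_fin]⟩
  intro a ha b hb hab
  simp only [coe_image, coe_univ, Set.image_univ, Set.mem_range] at ha hb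
  obtain ⟨t, rfl⟩ := ha
  obtain ⟨u, rfl⟩ := hb
  exact hadj t u fun h => hab (by rw [h])

theorem exists_tuple {T : Finset (Fin n)} (hT : G.IsNClique q T) :
    ∃ f : Fin q → Fin n, univ.image f = T ∧ ∀ t u, t < u → G.Adj (f t) (f u) := by
  refine ⟨T.orderEmbOfFin hT.card_eq, ?_, fun t u h => ?_⟩
  · apply coe_injective
    rw [coe_image, coe_univ, Set.image_univ, range_orderEmbOfFin]
  · refine hT.isClique (orderEmbOfFin_mem _ _ _) (orderEmbOfFin_mem _ _ _) fun he => ?_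
    exact h.ne ((T.orderEmbOfFin hT.card_eq).injective he)

/-- The weights `c - w` have the complementary sums on `q`-cliques. -/
theorem weight_complement {w w' : Sym2 (Fin n) → ℕ} {c : ℕ}
    (h : ∀ e ∈ G.edgeSet, w' e + w e = c) {T : Finset (Fin n)} (hT : G.IsNClique q T) :
    weight G w' T + weight G w T = (posPairs q).card * c := by
  obtain ⟨f, rfl, hf⟩ := exists_tuple hT
  rw [weight_image w f hf, weight_image w' f hf, ← sum_add_distrib, ← smul_eq_mul, ← sum_const]
  refine sum_congr rfl fun p hp => h _ ?_
  exact hf _ _ (by simpa [posPairs] using hp)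

/-- `ef` represents the weighted graph induced by `U`. -/
def IsEdgeArray (G : SimpleGraph (Fin n)) (w : Sym2 (Fin n) → ℕ) (U : Finset (Fin n))
    (ef : ℕ → ℕ) : Prop :=
  ∀ a b : Fin n, (G.Adj a b ∧ a ∈ U ∧ b ∈ U → ef (a * n + b) = w s(a, b) + 1) ∧
    (¬ (G.Adj a b ∧ a ∈ U ∧ b ∈ U) → ef (a * n + b) = 0)

theorem IsEdgeArray.ne_zero_iff {w : Sym2 (Fin n) → ℕ} {U : Finset (Fin n)} {ef : ℕ → ℕ}
    (h : IsEdgeArray G w U ef) (a b : Fin n) :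
    ef (a * n + b) ≠ 0 ↔ G.Adj a b ∧ a ∈ U ∧ b ∈ U := by
  refine ⟨fun h0 => ?_, fun h0 => by rw [(h a b).1 h0]; omega⟩
  by_contra hc
  exact h0 ((h a b).2 hc)

open Classical in
/-- The maximum weight of a `q`-clique inside `U` plus one, or `0` if there is none. -/
noncomputable def cliqueOpt (G : SimpleGraph (Fin n)) (w : Sym2 (Fin n) → ℕ) (q : ℕ)
    (U : Finset (Fin n)) : ℕ :=
  (univ.filter fun T => G.IsNClique q T ∧ T ⊆ U).sup fun T => weight G w T + 1

theorem le_cliqueOpt {w : Sym2 (Fin n) → ℕ} {U T : Finset (Fin n)} (hT : G.IsNClique q T)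
    (hU : T ⊆ U) : weight G w T + 1 ≤ cliqueOpt G w q U :=
  Finset.le_sup (f := fun T => weight G w T + 1) (by simp [hT, hU])

theorem cliqueOpt_mono {w : Sym2 (Fin n) → ℕ} {U U' : Finset (Fin n)} (h : U ⊆ U') :
    cliqueOpt G w q U ≤ cliqueOpt G w q U' := by
  classical
  refine Finset.sup_le fun T hT => ?_
  simp only [mem_filter, mem_univ, true_and] at hT
  exact le_cliqueOpt hT.1 (hT.2.trans h)

theorem exists_cliqueOpt {w : Sym2 (Fin n) → ℕ} {U : Finset (Fin n)}
    (h : cliqueOpt G w q U ≠ 0) :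
    ∃ T, G.IsNClique q T ∧ T ⊆ U ∧ weight G w T + 1 = cliqueOpt G w q U := by
  classical
  have hne : (univ.filter fun T => G.IsNClique q T ∧ T ⊆ U).Nonempty := by
    by_contra h0
    rw [not_nonempty_iff_eq_empty] at h0
    apply h
    unfold cliqueOpt
    rw [h0, sup_empty]
    rfl
  obtain ⟨T, hT, hT'⟩ := exists_mem_eq_sup _ hne fun T => weight G w T + 1
  simp only [mem_filter, mem_univ, true_and] at hT
  exact ⟨T, hT.1, hT.2, hT'.symm⟩

theorem tupleWeight_eq {w : Sym2 (Fin n) → ℕ} {U : Finset (Fin n)} {ef : ℕ → ℕ}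
    (h : IsEdgeArray G w U ef) (f : Fin q → Fin n) {x : ℕ}
    (hx : ∀ t : Fin q, dg n t x = f t) (hf : ∀ t u, t < u → G.Adj (f t) (f u) ∧ f t ∈ U ∧ f u ∈ U) :
    tupleWeight n q ef x = weight G w (univ.image f) := by
  rw [weight_image w f fun t u htu => (hf t u htu).1, tupleWeight,
    ← sum_posPairs q fun t u => ef (dg n t x * n + dg n u x) - 1]
  refine sum_congr rfl fun p hp => ?_
  rw [hx, hx, (h _ _).1 (hf _ _ (by simpa [posPairs] using hp))]
  omega

theorem tupleClique_iff {w : Sym2 (Fin n) → ℕ} {U : Finset (Fin n)} {ef : ℕ → ℕ}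
    (h : IsEdgeArray G w U ef) (f : Fin q → Fin n) {x : ℕ} (hx : ∀ t : Fin q, dg n t x = f t) :
    TupleClique n q ef x ↔ ∀ t u, t < u → G.Adj (f t) (f u) ∧ f t ∈ U ∧ f u ∈ U := by
  constructor
  · intro hc t u htu
    have := hc u u.2 t htu
    rwa [hx, hx, h.ne_zero_iff] at this
  · intro hc u hu t ht
    have := hc ⟨t, ht.trans hu⟩ ⟨u, hu⟩ ht
    rw [← h.ne_zero_iff, ← hx, ← hx] at this
    exact this

/-- Tuples with a repeated vertex are no cliques, as a vertex is not adjacent to itself, and every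
clique is the image of a tuple. That a vertex lies in `U` is seen from a pair that contains it. For
`q = 1` there is no pair, so this case is excluded; `q = 3 * k` never meets it. -/
theorem optVal_eq_cliqueOpt {w : Sym2 (Fin n) → ℕ} {U : Finset (Fin n)} {ef : ℕ → ℕ}
    (hq : q ≠ 1) (h : IsEdgeArray G w U ef) : optVal n q ef = cliqueOpt G w q U := by
  classical
  apply le_antisymm
  · refine Finset.sup_le fun x hx => ?_
    rw [mem_filter, mem_range] at hx
    set f : Fin q → Fin n := finFunctionFinEquiv.symm ⟨x, hx.1⟩ with hfdef
    have hf : ∀ t : Fin q, dg n t x = f t := fun t => by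
      simp [hfdef, dg, finFunctionFinEquiv_symm_apply_val]
    have hc := (tupleClique_iff h f hf).1 hx.2
    rw [tupleWeight_eq h f hf hc]
    refine le_cliqueOpt (isNClique_image f fun t u htu => (hc t u htu).1) fun v hv => ?_
    obtain ⟨t, -, rfl⟩ := mem_image.1 hv
    have hq2 : 2 ≤ q := by have := t.2; omega
    by_cases ht : (t : ℕ) = 0
    · exact (hc t ⟨1, hq2⟩ (by rw [Fin.lt_def, ht]; exact Nat.one_pos)).2.1
    · exact (hc ⟨0, by omega⟩ t (by rw [Fin.lt_def]; exact Nat.pos_of_ne_zero ht)).2.2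
  · refine Finset.sup_le fun T hT => ?_
    simp only [mem_filter, mem_univ, true_and] at hT
    obtain ⟨f, rfl, hadj⟩ := exists_tuple hT.1
    have hU : ∀ t, f t ∈ U := fun t => hT.2 (mem_image_of_mem f (mem_univ t))
    set x := finFunctionFinEquiv f with hx
    have hf : ∀ t : Fin q, dg n t (x : ℕ) = f t := fun t => by
      have := finFunctionFinEquiv_symm_apply_val x t
      rw [hx, Equiv.symm_apply_apply] at this
      exact this.symm
    have hc : ∀ t u, t < u → G.Adj (f t) (f u) ∧ f t ∈ U ∧ f u ∈ U :=
      fun t u htu => ⟨hadj t u htu, hU t, hU u⟩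
    rw [← tupleWeight_eq h f hf hc]
    exact Finset.le_sup (f := fun x => tupleWeight n q ef x + 1)
      (by rw [mem_filter, mem_range]; exact ⟨x.2, (tupleClique_iff h f hf).2 hc⟩)

/-! ### Finding a clique by deleting vertices -/

open Classical in
/-- The vertices left after an attempt to delete each of the first `v` vertices. -/
noncomputable def greedy (G : SimpleGraph (Fin n)) (w : Sym2 (Fin n) → ℕ) (q : ℕ) :
    ℕ → Finset (Fin n)
  | 0 => univ
  | v + 1 =>
    let X := (greedy G w q v).filter fun a : Fin n => (a : ℕ) ≠ v
    if cliqueOpt G w q X = cliqueOpt G w q univ then X else greedy G w q v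

theorem greedy_succ_subset (w : Sym2 (Fin n) → ℕ) (v : ℕ) :
    greedy G w q (v + 1) ⊆ greedy G w q v := by
  rw [greedy]
  split_ifs
  · exact filter_subset _ _
  · exact subset_rfl

theorem greedy_subset (w : Sym2 (Fin n) → ℕ) {v v' : ℕ} (h : v ≤ v') :
    greedy G w q v' ⊆ greedy G w q v :=
  antitone_nat_of_succ_le (fun v => greedy_succ_subset w v) h

theorem cliqueOpt_greedy (w : Sym2 (Fin n) → ℕ) (v : ℕ) :
    cliqueOpt G w q (greedy G w q v) = cliqueOpt G w q univ := by
  induction v with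
  | zero => rfl
  | succ v ih =>
    rw [greedy]
    split_ifs with h
    · exact h
    · exact ih

/-- The final set still contains an optimal clique `T`. A further vertex `v` cannot be left: when
its turn came, `T` was present and avoided `v`, so deleting `v` kept the optimum and would have been
carried out. -/
theorem isOptimal_greedy {w : Sym2 (Fin n) → ℕ} (h : cliqueOpt G w q univ ≠ 0) :
    IsOptimal G w q (greedy G w q n) .maximize := by
  have h1 := cliqueOpt_greedy (G := G) (q := q) w n
  obtain ⟨T, hT, hsub, hw⟩ := exists_cliqueOpt (h1 ▸ h : cliqueOpt G w q (greedy G w q n) ≠ 0)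
  have hTeq : greedy G w q n = T := by
    refine subset_antisymm (fun v hv => ?_) hsub
    by_contra hvT
    have h2 := greedy_subset w (Nat.succ_le_of_lt v.2) hv
    rw [Nat.succ_eq_add_one, greedy] at h2
    have hX : T ⊆ (greedy G w q v).filter fun a => (a : ℕ) ≠ v := fun a ha => by
      rw [mem_filter]
      refine ⟨greedy_subset w v.2.le (hsub ha), fun hav => hvT ?_⟩
      rwa [← Fin.ext hav]
    have h3 : cliqueOpt G w q ((greedy G w q v).filter fun a => (a : ℕ) ≠ v) =
        cliqueOpt G w q univ := by
      refine le_antisymm (cliqueOpt_mono (subset_univ _)) ?_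
      rw [← h1, ← hw]
      exact le_cliqueOpt hT hX
    simp only [h3, if_true, mem_filter] at h2
    exact h2.2 rfl
  rw [hTeq]
  refine ⟨hT, fun T' hT' => ?_⟩
  have := le_cliqueOpt (w := w) hT' (subset_univ T')
  omega

theorem cliqueFree_of_cliqueOpt {w : Sym2 (Fin n) → ℕ} (h : cliqueOpt G w q univ = 0) :
    G.CliqueFree q := fun T hT => by
  have := le_cliqueOpt (w := w) hT (subset_univ T)
  omega

/-- The weights that are to be maximized. -/
def workWeight (obj : Objective) (c : ℕ) (w : Sym2 (Fin n) → ℕ) : Sym2 (Fin n) → ℕ :=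
  match obj with
  | .maximize => w
  | .minimize => fun e => c - w e

theorem isOptimal_of_workWeight {obj : Objective} {c : ℕ} {w : Sym2 (Fin n) → ℕ}
    (hc : ∀ e ∈ G.edgeSet, w e ≤ c) {T : Finset (Fin n)}
    (h : IsOptimal G (workWeight obj c w) q T .maximize) : IsOptimal G w q T obj := by
  cases obj with
  | maximize => exact h
  | minimize =>
    refine ⟨h.1, fun T' hT' => ?_⟩
    have hcw : ∀ e ∈ G.edgeSet, workWeight .minimize c w e + w e = c :=
      fun e he => Nat.sub_add_cancel (hc e he)
    have h1 := weight_complement hcw h.1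
    have h2 := weight_complement hcw hT'
    have h3 := h.2 T' hT'
    omega

end CliqueAlg

/-! ### The program -/

namespace CliqueAlg

open LoopLang

/-- The registers of the program. -/
inductive Var
  | n | q₀ | q | k | nn | wm | nk | g | R | s | d₀ | three | best | val | v | a | b
  | N | x | y | t | u | e | ok | sm
  | D | D₁ | i | cand | fl | j | p | M | nq | m | gm | sN | rN
  | point | wl | acc | r | c | z | I | J | pw | dd | ln | Q | h | len
  deriving DecidableEq

/-- The arrays of the program. -/
inductive Arr
  | inp | adj | al | ef | dig | ys | pows | vec | tmp | prd | pos | neg | out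
  deriving DecidableEq

/-- Only finiteness matters; any number not less than that of the constructors would serve in place
of `60`, and of `20` below. -/
instance : Fintype Var :=
  Fintype.ofSurjective (fun i : Fin 60 => Var.ofNat i) fun v =>
    ⟨⟨v.ctorIdx, by cases v <;> decide⟩, Var.ofNat_ctorIdx v⟩

instance : Fintype Arr :=
  Fintype.ofSurjective (fun i : Fin 20 => Arr.ofNat i) fun v =>
    ⟨⟨v.ctorIdx, by cases v <;> decide⟩, Arr.ofNat_ctorIdx v⟩

abbrev E := Ex Var Arr
abbrev P := Pr Var Arr

instance : Add E := ⟨.bin .add⟩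
-- Subtraction is truncated, so `x - y` used as a test succeeds exactly for `y < x`.
instance : Sub E := ⟨.bin .sub⟩
instance : Mul E := ⟨.bin .mul⟩
instance : Div E := ⟨.bin .div⟩
instance : Mod E := ⟨.mod⟩

abbrev rg (v : Var) : E := .var v
abbrev cn (c : ℕ) : E := .const c
abbrev ar (a : Arr) (i : E) : E := .get a i

notation:40 p:41 ";;" q:40 => Pr.seq p q

theorem ev_add (σ : St Var Arr) (x y : E) : (x + y).ev σ = x.ev σ + y.ev σ := rfl
theorem ev_sub (σ : St Var Arr) (x y : E) : (x - y).ev σ = x.ev σ - y.ev σ := rfl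
theorem ev_mul (σ : St Var Arr) (x y : E) : (x * y).ev σ = x.ev σ * y.ev σ := rfl
theorem ev_div (σ : St Var Arr) (x y : E) : (x / y).ev σ = x.ev σ / y.ev σ := rfl
theorem ev_mod (σ : St Var Arr) (x y : E) : (x % y).ev σ = x.ev σ % y.ev σ := rfl
theorem ev_var (σ : St Var Arr) (v : Var) : (Ex.var v : E).ev σ = σ.reg v := rfl
theorem ev_const (σ : St Var Arr) (c : ℕ) : (Ex.const c : E).ev σ = c := rfl
theorem ev_get (σ : St Var Arr) (a : Arr) (i : E) : (Ex.get a i).ev σ = σ.arr a (i.ev σ) := rfl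

/-- `v := base ^ ex`. -/
def powProg (v base ex : Var) : P :=
  .assign v (cn 1);; .loop .i ex (.assign v (rg v * rg base))

/-- Write the `cnt` lowest digits of `y` in base `n` into the array `dig`, from `off` on. -/
def digitsProg (cnt : Var) (off : E) : P :=
  .loop .t cnt (.store .dig (off + rg .t) (rg .y % rg .n);; .assign .y (rg .y / rg .n))

/-- The weight of the tuple `dig`, and whether it is a clique. -/
def tupleProg : P :=
  .assign .ok (cn 1);; .assign .sm (cn 0);;
  .loop .u .q (.loop .t .u (
    .assign .e (ar .ef (ar .dig (rg .t) * rg .n + ar .dig (rg .u)));;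
    .ite (rg .e) (.assign .sm (rg .sm + (rg .e - cn 1))) (.assign .ok (cn 0))))

def bruteProg : P :=
  powProg .N .n .q;; .assign .val (cn 0);;
  .loop .x .N (
    .assign .y (rg .x);; digitsProg .q (cn 0);; tupleProg;;
    .ite (rg .ok) (.ite (rg .sm + cn 1 - rg .val) (.assign .val (rg .sm + cn 1)) .skip) .skip)

/-- A prime between `D` and `2 * D`. -/
def primeProg : P :=
  .loop .i .D (
    .assign .cand (rg .D + cn 1 + rg .i);; .assign .fl (cn 1);;
    .loop .j .cand (.ite (rg .j - cn 1) (.ite (rg .cand % rg .j) .skip (.assign .fl (cn 0))) .skip);;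
    .ite (rg .fl) (.assign .p (rg .cand)) .skip)

/-- The least `m` with `nk ≤ g ^ m`, and powers with the exponent `m`. -/
def sizeProg : P :=
  .assign .m (cn 0);; .assign .gm (cn 1);; .assign .sN (cn 1);; .assign .rN (cn 1);;
  .loop .i .nq (.ite (rg .nk - rg .gm)
    (.assign .gm (rg .gm * rg .g);; .assign .sN (rg .sN * rg .s);;
      .assign .rN (rg .rN * rg .R);; .assign .m (rg .m + cn 1)) .skip)

/-- The powers of `point` with the edge weights as exponents. -/
def edgeProg : P :=
  .loop .j .nn (.ite (ar .ef (rg .j))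
    (.assign .acc (cn 1);; .assign .wl (ar .ef (rg .j) - cn 1);;
      .loop .i .wl (.assign .acc (rg .acc * rg .point % rg .M));;
      .store .pows (rg .j) (rg .acc))
    (.store .pows (rg .j) (cn 0)))

/-- The matrix entry `(I, J)`. -/
def entryProg : P :=
  .assign .y (rg .I);; digitsProg .k (cn 0);; .assign .y (rg .J);; digitsProg .k (rg .k);;
  .assign .acc (cn 1);;
  .loop .u .k (
    .loop .t .u (.assign .acc
      (rg .acc * ar .pows (ar .dig (rg .t) * rg .n + ar .dig (rg .u)) % rg .M));;
    .loop .t .k (.assign .acc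
      (rg .acc * ar .pows (ar .dig (rg .t) * rg .n + ar .dig (rg .k + rg .u)) % rg .M)))

/-- Row and column of the matrix entry with index `z`. -/
def positionProg : P :=
  .assign .y (rg .z);; .assign .I (cn 0);; .assign .J (cn 0);; .assign .pw (cn 1);;
  .loop .t .m (
    .assign .dd (rg .y % rg .s);; .assign .y (rg .y / rg .s);;
    .assign .I (rg .I + rg .dd / rg .g * rg .pw);; .assign .J (rg .J + rg .dd % rg .g * rg .pw);;
    .assign .pw (rg .pw * rg .g))

def matrixProg : P :=
  .loop .z .sN (positionProg;;
    .ite ((rg .nk - rg .I) * (rg .nk - rg .J))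
      (entryProg;; .store .vec (rg .z) (rg .acc)) (.store .vec (rg .z) (cn 0)))

/-- One pass of the tensor power transformation. -/
def passProg : P :=
  .assign .Q (rg .ln / rg .s);;
  .loop .h .Q (.loop .r .R (
    .assign .acc (cn 0);;
    -- Cells hold natural numbers: the negative part of a coefficient is multiplied by `M - 1`,
    -- which is `-1` modulo `M`.
    .loop .dd .s (.assign .acc ((rg .acc +
      (ar .pos ((rg .c * rg .R + rg .r) * rg .s + rg .dd) +
        ar .neg ((rg .c * rg .R + rg .r) * rg .s + rg .dd) * (rg .M - cn 1)) *
      ar .vec (rg .h * rg .s + rg .dd)) % rg .M));;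
    .store .tmp (rg .r * rg .Q + rg .h) (rg .acc)));;
  .assign .ln (rg .Q * rg .R);;
  .loop .i .ln (.store .vec (rg .i) (ar .tmp (rg .i)))

def transformProg : P :=
  .assign .ln (rg .sN);; .loop .t .m passProg

/-- The value at `point`, into the register `y`. -/
def evalProg : P :=
  edgeProg;;
  .loop .r .rN (.store .prd (rg .r) (cn 1));;
  .loop .c .three (matrixProg;; transformProg;;
    .loop .r .rN (.store .prd (rg .r) (ar .prd (rg .r) * ar .vec (rg .r) % rg .M)));;
  .assign .y (cn 0);;
  .loop .r .rN (.assign .y ((rg .y + ar .prd (rg .r)) % rg .M))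

/-- One plus the largest order of a nonzero difference. -/
def differenceProg : P :=
  .assign .val (cn 0);;
  .loop .e .D₁ (
    .ite (ar .ys (cn 0)) (.assign .val (rg .e + cn 1)) .skip;;
    .loop .i .D (.store .ys (rg .i) ((ar .ys (rg .i + cn 1) + (rg .M - ar .ys (rg .i))) % rg .M)))

/-- `D` is chosen at least the degree of the trace polynomial and larger than `d₀`. A prime above
`D` is thus prime to `d₀` and to all relevant factorials. The exponent `n * q + 1` lifts the modulus
above the number of tuples. -/
def fastProg : P :=
  .assign .D (rg .q * rg .q * rg .wm + rg .d₀ + cn 1);; .assign .D₁ (rg .D + cn 1);;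
  primeProg;; .assign .nq (rg .n * rg .q + cn 1);; powProg .M .p .nq;; sizeProg;;
  .loop .point .D₁ (evalProg;; .store .ys (rg .point) (rg .y));;
  differenceProg

/-- The indicator `al` of the remaining vertices erases the edges at deleted ones. Exhaustive search
is chosen exactly for `n ^ k < wm`. -/
def optProg : P :=
  .loop .a .n (.loop .b .n (.store .ef (rg .a * rg .n + rg .b)
    (ar .adj (rg .a * rg .n + rg .b) * (ar .al (rg .a) * ar .al (rg .b)))));;
  .ite (rg .wm - rg .nk) bruteProg fastProg

def solveProg : P :=
  .assign .q (rg .q₀);; .assign .k (rg .q / cn 3);; powProg .nk .n .k;;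
  .loop .i .n (.store .al (rg .i) (cn 1));;
  optProg;; .assign .best (rg .val);;
  .ite (rg .best)
    (.loop .v .n (.store .al (rg .v) (cn 0);; optProg;;
        .ite (rg .best - rg .val) (.store .al (rg .v) (cn 1)) .skip);;
      .store .out (cn 0) (cn 1);;
      .loop .i .n (.store .out (rg .i + cn 1) (ar .al (rg .i)));;
      .assign .len (rg .n + cn 1))
    (.store .out (cn 0) (cn 0);; .assign .len (cn 1))

/-- An edge of weight `w` has the entry `w + 1`, and `wm` is the largest entry. So `wm + 1 - (w +
1)` is the entry for the reversed weight `(wm - 1) - w`, and it is positive. -/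
def adjEntry : WeightedClique.Objective → P
  | .maximize => .store .adj (rg .i) (ar .inp (rg .i + cn 2))
  | .minimize => .ite (ar .inp (rg .i + cn 2))
      (.store .adj (rg .i) (rg .wm + cn 1 - ar .inp (rg .i + cn 2))) (.store .adj (rg .i) (cn 0))

/-- Write the positive and negative parts of the first `N` values of `f`. -/
def storeList (f : ℕ → ℤ) : ℕ → P
  | 0 => .skip
  | N + 1 => storeList f N;; .store .pos (cn N) (cn (f N).toNat);;
      .store .neg (cn N) (cn (-f N).toNat)

/-- The coefficients of a decomposition, listed row by row. -/
def coefList (d : MatMul.Decomposition) (x : ℕ) : ℤ :=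
  d.coef (x / (d.g * d.g) / d.R) (x / (d.g * d.g) % d.R) (x % (d.g * d.g))

def setupProg (d : MatMul.Decomposition) (obj : WeightedClique.Objective) : P :=
  .assign .n (ar .inp (cn 0));; .assign .q₀ (ar .inp (cn 1));; .assign .nn (rg .n * rg .n);;
  .assign .g (cn d.g);; .assign .R (cn d.R);; .assign .s (cn (d.g * d.g));;
  .assign .d₀ (cn d.D);; .assign .three (cn 3);; storeList (coefList d) (3 * d.R * (d.g * d.g));;
  .assign .wm (cn 0);;
  .loop .i .nn (.ite (ar .inp (rg .i + cn 2) - rg .wm)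
    (.assign .wm (ar .inp (rg .i + cn 2))) .skip);;
  .loop .i .nn (adjEntry obj)

/-- There is no clique on more than `n` vertices. Answering early keeps the loop bounds `q` and `k`
at most `n`, whereas `q₀` itself can be exponential in its bit length. -/
def mainProg (d : MatMul.Decomposition) (obj : WeightedClique.Objective) : P :=
  setupProg d obj;;
  .ite (rg .q₀ - rg .n) (.store .out (cn 0) (cn 0);; .assign .len (cn 1)) solveProg

theorem storeList_wf (f : ℕ → ℤ) (N : ℕ) : (storeList f N).wf = true := by
  induction N with
  | zero => rfl
  | succ N ih => simp [storeList, Pr.wf, ih]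

theorem mainProg_wf (d : MatMul.Decomposition) (obj : WeightedClique.Objective) :
    (mainProg d obj).wf = true := by
  have h : solveProg.wf = true := rfl
  cases obj <;> simp [mainProg, setupProg, Pr.wf, storeList_wf, adjEntry, Pr.writes, h]

end CliqueAlg

/-! ### Verification of the program -/

namespace CliqueAlg

open LoopLang Finset

/-- Limits for the registers that bound loops, and a common limit `U` for everything else. -/
structure Lim where
  (n q k N D nq W rN sN R s U : ℕ)

/-- The individual limits enter the number of steps, `U` just the bit lengths. The counter `u` and
the candidate `cand` have limits of their own as they bound inner loops. -/
def Lim.bounds (L : Lim) : Bounds Var Arr where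
  reg
    | .n => L.n
    | .nn => L.n * L.n
    | .q | .u => L.q
    | .k => L.k
    | .N => L.N
    | .D => L.D
    | .cand => 2 * L.D
    | .D₁ => L.D + 1
    | .nq | .m => L.nq
    | .wl => L.W
    | .rN | .ln | .Q => L.rN
    | .sN => L.sN
    | .R => L.R
    | .s => L.s
    | .three => 3
    | _ => L.U
  arr _ := L.U

variable {L : Lim} {σ : St Var Arr}

theorem powProg_spec {v base ex : Var} (hv : v ≠ base) (hvi : v ≠ .i) (hbi : base ≠ .i)
    (hve : v ≠ ex) {b N : ℕ} (hb : σ.reg base = b) (hN : σ.reg ex = N) (hNU : N ≤ L.U)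
    (hle : ∀ i ≤ N, b ^ i ≤ L.bounds.reg v) :
    Tr L.bounds (powProg v base ex) σ fun σ' => σ'.reg v = b ^ N := by
  refine Tr.seq (R := fun σ' => σ'.reg v = 1 ∧ σ'.reg base = b ∧ σ'.reg ex = N) ?_ ?_
  · have := hle 0 (Nat.zero_le _)
    simp [ev_const, hv.symm, hve.symm, hb, hN]
    simpa using this
  · rintro σ₁ - ⟨h1, h2, h3⟩
    refine Tr.loop (fun i σ' => σ'.reg v = b ^ i) N h3 hNU (by simpa using h1) ?_ ?_
    · intro i hi σ₂ hF hI
      have hb2 : σ₂.reg base = b := by rw [hF.reg base (by simp [Pr.writes, hv.symm, hbi]), h2]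
      simp only [Tr.assign_iff, ev_mul, ev_var, St.set_reg, hvi, hbi, if_false, hb2, hI, if_true,
        ← pow_succ, and_true]
      exact hle _ hi
    · intro σ₂ hF hI
      simpa [hvi] using hI

theorem digitsProg_spec {cnt : Var} {off : E} {n y N o : ℕ} (hn : σ.reg .n = n)
    (hy : σ.reg .y = y) (hyU : y ≤ L.U) (hN : σ.reg cnt = N) (hNU : N ≤ L.U)
    (hoff : ∀ σ' : St Var Arr, (∀ x, x ≠ .t → x ≠ .y → σ'.reg x = σ.reg x) → off.ev σ' = o) :
    Tr L.bounds (digitsProg cnt off) σ fun σ' =>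
      (∀ i < N, σ'.arr .dig (o + i) = dg n i y) ∧
      ∀ j, j < o → σ'.arr .dig j = σ.arr .dig j := by
  refine Tr.loop (fun i σ' => σ'.reg .y = y / n ^ i ∧
    (∀ i' < i, σ'.arr .dig (o + i') = dg n i' y) ∧
      ∀ j, j < o → σ'.arr .dig j = σ.arr .dig j) N hN hNU (by simp [hy]) ?_ ?_
  · rintro i hi σ₁ hF ⟨h1, h2, h3⟩
    have hn1 : σ₁.reg .n = n := by rw [hF.reg _ rfl, hn]
    have ho : off.ev (σ₁.set .t i) = o := hoff _ fun x hx hx' => by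
      rw [St.set_reg, if_neg hx, hF.reg x (by simp [Pr.writes, hx, hx'])]
    have hdiv : y / n ^ i ≤ L.U := (Nat.div_le_self _ _).trans hyU
    simp only [Tr.seq_iff, Tr.store_iff, Tr.assign_iff, ev_add, ev_mod, ev_div, ev_var, ho,
      St.set_reg, St.put_reg, St.put_arr, St.set_arr, reduceCtorEq, if_false, if_true, hn1, h1]
    refine ⟨(Nat.mod_le _ _).trans hdiv, (Nat.div_le_self _ _).trans hdiv, ?_, ?_, ?_⟩
    · rw [pow_succ, Nat.div_div_eq_div_mul]
    · intro i' hi'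
      by_cases h : i' = i
      · subst h; simp [dg]
      · rw [if_neg (by omega), h2 i' (by omega)]
    · intro j hj
      rw [if_neg (by omega), h3 j hj]
  · rintro σ₁ hF ⟨h1, h2, h3⟩
    exact ⟨h2, h3⟩

theorem tupleProg_spec {n q x Wm : ℕ} (hn : σ.reg .n = n) (hq : σ.reg .q = q) (hn0 : 0 < n)
    (hdig : ∀ t < q, σ.arr .dig t = dg n t x)
    (hef : ∀ a < n, ∀ b < n, σ.arr .ef (a * n + b) ≤ Wm) (hWU : q * q * Wm ≤ L.U)
    (hWm : Wm ≤ L.U) (h1U : 1 ≤ L.U) (hqL : q ≤ L.q) (hqU : q ≤ L.U) :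
    Tr L.bounds tupleProg σ fun σ' => σ'.reg .sm = tupleWeight n q (σ.arr .ef) x ∧
      (σ'.reg .ok ≠ 0 ↔ TupleClique n q (σ.arr .ef) x) := by
  set ef := σ.arr .ef with hefdef
  refine Tr.seq_iff.2 ⟨h1U, Tr.seq_iff.2 ⟨Nat.zero_le _, ?_⟩⟩
  refine Tr.loop (fun u σ' =>
    σ'.reg .sm = ∑ u' ∈ range u, ∑ t ∈ range u', (ef (dg n t x * n + dg n u' x) - 1) ∧
    σ'.reg .sm ≤ u * q * Wm ∧
    (σ'.reg .ok ≠ 0 ↔ ∀ u' < u, ∀ t < u', ef (dg n t x * n + dg n u' x) ≠ 0)) q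
    (by simp [Pr.run, hq]) hqL (by simp [Pr.run, ev_const]) ?_ ?_
  · rintro u hu σ₁ hF ⟨h1, h2, h3⟩
    have hn1 : σ₁.reg .n = n := by rw [hF.reg _ rfl]; simpa [Pr.run] using hn
    have hdig1 : σ₁.arr .dig = σ.arr .dig := by rw [hF.arr _ rfl]; rfl
    have hef1 : σ₁.arr .ef = ef := by rw [hF.arr _ rfl]; rfl
    refine Tr.loop (fun t σ' =>
      σ'.reg .sm = ∑ u' ∈ range u, ∑ t ∈ range u', (ef (dg n t x * n + dg n u' x) - 1) +
        ∑ t' ∈ range t, (ef (dg n t' x * n + dg n u x) - 1) ∧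
      σ'.reg .sm ≤ (u * q + t) * Wm ∧
      (σ'.reg .ok ≠ 0 ↔ (∀ u' < u, ∀ t < u', ef (dg n t x * n + dg n u' x) ≠ 0) ∧
        ∀ t' < t, ef (dg n t' x * n + dg n u x) ≠ 0)) u (by simp) (hu.le.trans hqU)
      (by simp [h1, h3]; simpa [h1] using h2) ?_ ?_
    · rintro t ht σ₂ hF2 ⟨k1, k2, k3⟩
      have hn2 : σ₂.reg .n = n := by rw [hF2.reg _ rfl]; simpa using hn1
      have hu2 : σ₂.reg .u = u := by rw [hF2.reg _ rfl]; simp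
      have hdig2 : σ₂.arr .dig = σ.arr .dig := by rw [hF2.arr _ rfl]; exact hdig1
      have hef2 : σ₂.arr .ef = ef := by rw [hF2.arr _ rfl]; exact hef1
      have he : ef (dg n t x * n + dg n u x) ≤ Wm := hef _ (dg_lt hn0 _ _) _ (dg_lt hn0 _ _)
      refine Tr.seq_iff.2 ?_
      simp only [Tr.assign_iff, ev_add, ev_mul, ev_get, ev_var, St.set_reg, St.set_arr,
        reduceCtorEq, if_false, if_true, hn2, hu2, hdig2, hef2, hdig t (by omega), hdig u hu]
      refine ⟨he.trans hWm, Tr.ite ?_ ?_⟩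
      · intro h0
        simp only [ev_var, St.set_reg, if_true] at h0
        have hle : σ₂.reg .sm + (ef (dg n t x * n + dg n u x) - 1) ≤ (u * q + (t + 1)) * Wm := by
          have : (u * q + (t + 1)) * Wm = (u * q + t) * Wm + Wm := by ring
          omega
        have hle2 : (u * q + (t + 1)) * Wm ≤ q * q * Wm := Nat.mul_le_mul_right _ (by nlinarith)
        simp only [Tr.assign_iff, ev_add, ev_sub, ev_var, ev_const, St.set_reg, reduceCtorEq,
          if_false, if_true]
        refine ⟨hle.trans (hle2.trans hWU), ?_, hle, ?_⟩
        · rw [k1, sum_range_succ]; omega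
        · rw [k3]
          refine and_congr_right fun _ => ⟨fun h t' ht' => ?_, fun h t' ht' => h t' (by omega)⟩
          by_cases e : t' = t
          · rw [e]; exact h0
          · exact h t' (by omega)
      · intro h0
        simp only [ev_var, St.set_reg, if_true] at h0
        simp only [Tr.assign_iff, ev_const, St.set_reg, reduceCtorEq, if_false, if_true]
        refine ⟨Nat.zero_le _, ?_, k2.trans (Nat.mul_le_mul_right _ (by omega)), ?_⟩
        -- A non-edge contributes `0 - 1 = 0`, so the sum remains right although `sm` is not
        -- touched.
        · rw [k1, sum_range_succ, h0]; omega
        · simp only [ne_eq, not_true_eq_false, false_iff, not_and]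
          intro _ h
          exact h t (by omega) h0
    · rintro σ₂ hF2 ⟨k1, k2, k3⟩
      simp only [St.set_reg, reduceCtorEq, if_false]
      refine ⟨by rw [k1, sum_range_succ], k2.trans (Nat.mul_le_mul_right _ (by nlinarith)), ?_⟩
      rw [k3]
      refine ⟨fun h u' hu' => ?_, fun h => ⟨fun u' hu' => h u' (by omega), h u (by omega)⟩⟩
      by_cases e : u' = u
      · rw [e]; exact h.2
      · exact h.1 u' (by omega)
  · rintro σ₁ hF ⟨h1, h2, h3⟩
    simp only [St.set_reg, reduceCtorEq, if_false]
    exact ⟨h1, h3⟩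

end CliqueAlg

/-! ### Correctness of the exhaustive search, the prime search and the choice of the matrix size. -/

namespace CliqueAlg

open LoopLang Finset

variable {L : Lim} {σ : St Var Arr}

theorem bruteProg_spec {n q Wm : ℕ} (hn : σ.reg .n = n) (hq : σ.reg .q = q) (hn0 : 0 < n)
    (hef : ∀ a < n, ∀ b < n, σ.arr .ef (a * n + b) ≤ Wm) (hWU : q * q * Wm + 1 ≤ L.U)
    (hWm : Wm ≤ L.U) (hqL : q ≤ L.q) (hqU : q ≤ L.U) (hNL : n ^ q ≤ L.N) (hNU : n ^ q ≤ L.U) :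
    Tr L.bounds bruteProg σ fun σ' => σ'.reg .val = optVal n q (σ.arr .ef) := by
  set ef := σ.arr .ef with hefdef
  refine Tr.seq (powProg_spec (by decide) (by decide) (by decide) (by decide) hn hq hqU
    fun i hi => (Nat.pow_le_pow_right hn0 hi).trans hNL) ?_
  intro σ₁ hF hN
  refine Tr.seq_iff.2 ⟨Nat.zero_le _, ?_⟩
  refine Tr.loop (fun i σ' => σ'.reg .val =
    ((range i).filter (TupleClique n q ef)).sup fun x => tupleWeight n q ef x + 1) (n ^ q)
    (by simpa [Pr.run] using hN) hNU (by simp [Pr.run, ev_const]) ?_ ?_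
  · intro x hx σ₂ hF2 h1
    have hn2 : σ₂.reg .n = n := by
      rw [hF2.reg _ rfl]; simp only [Pr.run, St.set_reg, reduceCtorEq, if_false]
      rw [hF.reg _ rfl, hn]
    have hq2 : σ₂.reg .q = q := by
      rw [hF2.reg _ rfl]; simp only [Pr.run, St.set_reg, reduceCtorEq, if_false]
      rw [hF.reg _ rfl, hq]
    have hef2 : σ₂.arr .ef = ef := by
      rw [hF2.arr _ rfl]; simp only [Pr.run, St.set_arr]; rw [hF.arr _ rfl]
    refine Tr.seq_iff.2 ⟨by
      change (σ₂.set .x x).reg .x ≤ L.U; simpa using hx.le.trans hNU, ?_⟩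
    refine Tr.seq (digitsProg_spec (L := L) (n := n) (y := x) (N := q) (o := 0)
      (by simpa [Pr.run] using hn2) (by simp [Pr.run, ev_var]) (hx.le.trans hNU)
      (by simpa [Pr.run] using hq2) hqU (fun _ _ => rfl)) ?_
    rintro σ₃ hF3 ⟨hd, -⟩
    have hn3 : σ₃.reg .n = n := by rw [hF3.reg _ rfl]; simpa [Pr.run] using hn2
    have hq3 : σ₃.reg .q = q := by rw [hF3.reg _ rfl]; simpa [Pr.run] using hq2
    have hef3 : σ₃.arr .ef = ef := by rw [hF3.arr _ rfl]; simpa [Pr.run] using hef2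
    have hv3 : σ₃.reg .val = σ₂.reg .val := by rw [hF3.reg _ rfl]; simp [Pr.run]
    refine Tr.seq (tupleProg_spec hn3 hq3 hn0 (x := x) (Wm := Wm)
      (fun t ht => by simpa using hd t ht) (by rw [hef3]; exact hef) (by omega) hWm (by omega)
      hqL hqU) ?_
    rintro σ₄ hF4 ⟨hsm, hok⟩
    rw [hef3] at hsm hok
    have hv4 : σ₄.reg .val = σ₂.reg .val := by rw [hF4.reg _ rfl, hv3]
    have htw : tupleWeight n q ef x ≤ q * q * Wm := tupleWeight_le hn0 hef x
    simp only [range_add_one, filter_insert]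
    rw [h1] at hv4
    refine Tr.ite ?_ ?_
    · intro h
      have hc := hok.1 h
      rw [if_pos hc, sup_insert]
      refine Tr.ite ?_ ?_
      · intro h'
        simp only [ev_sub, ev_add, ev_var, ev_const, hsm, hv4] at h'
        simp only [Tr.assign_iff, ev_add, ev_var, ev_const, hsm, St.set_reg, if_true]
        refine ⟨?_, (max_eq_left ?_).symm⟩
        · change _ ≤ L.U; omega
        · omega
      · intro h'
        simp only [ev_sub, ev_add, ev_var, ev_const, hsm, hv4] at h'
        simp only [Tr.skip_iff, hv4]
        exact (max_eq_right (by omega)).symm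
    · intro h
      have hc : ¬ TupleClique n q ef x := fun hc => (hok.2 hc) h
      rw [if_neg hc]
      simpa using hv4
  · intro σ₂ hF2 h1
    simpa [optVal] using h1

/-- The invariant is conditional: as soon as one of the tested candidates is prime, `p` holds such a
prime. Bertrand's postulate discharges the condition at the end. -/
theorem primeProg_spec {D : ℕ} (hD : σ.reg .D = D) (hD0 : D ≠ 0) (hDL : D ≤ L.D)
    (hDU : 2 * D ≤ L.U) :
    Tr L.bounds primeProg σ fun σ' => (σ'.reg .p).Prime ∧ D < σ'.reg .p ∧ σ'.reg .p ≤ 2 * D := by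
  refine Tr.loop (fun i σ' => (∃ p, p.Prime ∧ D < p ∧ p < D + 1 + i) →
    (σ'.reg .p).Prime ∧ D < σ'.reg .p ∧ σ'.reg .p ≤ 2 * D) D hD (by change D ≤ L.U; omega)
    (by rintro ⟨p, -, h1, h2⟩; omega) ?_ ?_
  · intro i hi σ₁ hF h1
    have hD1 : σ₁.reg .D = D := by rw [hF.reg _ rfl, hD]
    refine Tr.seq_iff.2 ⟨?_, Tr.seq_iff.2 ⟨?_, ?_⟩⟩
    · change (σ₁.set .i i).reg .D + 1 + (σ₁.set .i i).reg .i ≤ 2 * L.D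
      simp only [St.set_reg, reduceCtorEq, if_false, hD1, if_true]
      omega
    · change 1 ≤ L.U; omega
    set cand := D + 1 + i with hc
    refine Tr.seq (R := fun σ' => σ'.reg .fl ≠ 0 ↔ cand.Prime) ?_ ?_
    · refine Tr.loop (fun j σ' => σ'.reg .fl ≠ 0 ↔ ∀ d < j, 2 ≤ d → ¬ d ∣ cand) cand
        (by simp [Pr.run, ev_add, ev_var, ev_const, hD1, hc]) (by change cand ≤ L.U; omega)
        (by simp [Pr.run, ev_const]) ?_ ?_
      · intro j hj σ₂ hF2 h2
        have hc2 : σ₂.reg .cand = cand := by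
          rw [hF2.reg _ rfl]; simp [Pr.run, ev_add, ev_var, ev_const, hD1, hc]
        refine Tr.ite ?_ ?_
        · intro h3
          have hj2 : 2 ≤ j := by simp [ev_sub, ev_var, ev_const] at h3; omega
          refine Tr.ite ?_ ?_
          · intro h4
            simp only [ev_mod, ev_var, St.set_reg, reduceCtorEq, if_false, if_true, hc2] at h4
            simp only [Tr.skip_iff, St.set_reg, reduceCtorEq, if_false]
            rw [h2]
            refine ⟨fun h d hd hd2 => ?_, fun h d hd => h d (by omega)⟩
            by_cases e : d = j
            · rw [e]; exact fun hdvd => h4 (Nat.mod_eq_zero_of_dvd hdvd)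
            · exact h d (by omega) hd2
          · intro h4
            simp only [ev_mod, ev_var, St.set_reg, reduceCtorEq, if_false, if_true, hc2] at h4
            simp only [Tr.assign_iff, ev_const, St.set_reg, if_true]
            refine ⟨Nat.zero_le _, ?_⟩
            simp only [ne_eq, not_true_eq_false, false_iff, not_forall]
            exact ⟨j, by omega, hj2, not_not.2 (Nat.dvd_of_mod_eq_zero h4)⟩
        · intro h3
          have hj2 : j < 2 := by simp [ev_sub, ev_var, ev_const] at h3; omega
          simp only [Tr.skip_iff, St.set_reg, reduceCtorEq, if_false]
          rw [h2]
          exact ⟨fun h d hd hd2 => by omega, fun h d hd => h d (by omega)⟩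
      · intro σ₂ hF2 h2
        simp only [St.set_reg, reduceCtorEq, if_false]
        rw [h2, Nat.prime_def_lt']
        exact ⟨fun h => ⟨by omega, fun d hd hd' => h d hd' hd⟩, fun h d hd hd' => h.2 d hd' hd⟩
    · intro σ₂ hF2 h2
      have hc2 : σ₂.reg .cand = cand := by
        rw [hF2.reg _ rfl]; simp [Pr.run, ev_add, ev_var, ev_const, hD1, hc]
      have hp2 : σ₂.reg .p = σ₁.reg .p := by rw [hF2.reg _ rfl]; simp [Pr.run]
      refine Tr.ite ?_ ?_
      · intro h3
        have hp := h2.1 h3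
        simp only [Tr.assign_iff, ev_var, hc2, St.set_reg, if_true]
        exact ⟨by change cand ≤ L.U; omega, fun _ => ⟨hp, by omega, by omega⟩⟩
      · intro h3
        have hp : ¬ cand.Prime := fun hp => (h2.2 hp) h3
        simp only [Tr.skip_iff, hp2]
        rintro ⟨p, hp1, hp2, hp3⟩
        refine h1 ⟨p, hp1, hp2, ?_⟩
        have : p ≠ cand := fun h => hp (h ▸ hp1)
        omega
  · intro σ₁ hF h1
    obtain ⟨p, hp1, hp2, hp3⟩ := Nat.exists_prime_lt_and_le_two_mul D hD0
    simpa using h1 ⟨p, hp1, hp2, by omega⟩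

/-- The least `m` with `N ≤ g ^ m`. -/
noncomputable def levels (g N : ℕ) : ℕ := Nat.clog g N

/-- A counting loop cannot stop early. It runs `nq` times, and the powers freeze once `nk ≤ g ^ m`,
whence the minimum in the invariant. -/
theorem sizeProg_spec {nk g s R nq : ℕ} (hnk : σ.reg .nk = nk) (hg : σ.reg .g = g)
    (hs : σ.reg .s = s) (hR : σ.reg .R = R) (hnq : σ.reg .nq = nq) (hg2 : 2 ≤ g)
    (hm : levels g nk ≤ nq) (hnqL : nq ≤ L.nq) (hnqU : nq ≤ L.U) (hs1 : 1 ≤ s) (hR1 : 1 ≤ R)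
    (hsL : s ^ levels g nk ≤ L.sN) (hRL : R ^ levels g nk ≤ L.rN) (hgU : g ^ levels g nk ≤ L.U) :
    Tr L.bounds sizeProg σ fun σ' => σ'.reg .m = levels g nk ∧
      σ'.reg .sN = s ^ levels g nk ∧ σ'.reg .rN = R ^ levels g nk := by
  have hsL1 : 1 ≤ L.sN := (Nat.one_le_pow _ _ hs1).trans hsL
  have hRL1 : 1 ≤ L.rN := (Nat.one_le_pow _ _ hR1).trans hRL
  have hgU1 : 1 ≤ L.U := (Nat.one_le_pow _ _ (by omega)).trans hgU
  refine Tr.seq_iff.2 ⟨Nat.zero_le _, Tr.seq_iff.2 ⟨hgU1, Tr.seq_iff.2 ⟨hsL1, Tr.seq_iff.2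
    ⟨hRL1, ?_⟩⟩⟩⟩
  refine Tr.loop (fun i σ' => σ'.reg .m = min i (levels g nk) ∧
    σ'.reg .gm = g ^ min i (levels g nk) ∧ σ'.reg .sN = s ^ min i (levels g nk) ∧
    σ'.reg .rN = R ^ min i (levels g nk)) nq (by simpa [Pr.run] using hnq) hnqU
    (by simp [Pr.run, ev_const]) ?_ ?_
  · rintro i hi σ₁ hF ⟨h1, h2, h3, h4⟩
    have hnk1 : σ₁.reg .nk = nk := by rw [hF.reg _ rfl]; simpa [Pr.run] using hnk
    have hg1 : σ₁.reg .g = g := by rw [hF.reg _ rfl]; simpa [Pr.run] using hg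
    have hs1' : σ₁.reg .s = s := by rw [hF.reg _ rfl]; simpa [Pr.run] using hs
    have hR1' : σ₁.reg .R = R := by rw [hF.reg _ rfl]; simpa [Pr.run] using hR
    refine Tr.ite ?_ ?_
    · intro h
      simp only [ev_sub, ev_var, St.set_reg, reduceCtorEq, if_false, hnk1, h2] at h
      have hlt : i < levels g nk := by
        by_contra hge
        rw [min_eq_right (by omega)] at h
        have := Nat.le_pow_clog (by omega : 1 < g) nk
        unfold levels at h
        omega
      have e1 : min i (levels g nk) = i := min_eq_left hlt.le
      have e2 : min (i + 1) (levels g nk) = i + 1 := min_eq_left hlt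
      rw [e1] at h1 h2 h3 h4
      rw [e2]
      simp only [Tr.seq_iff, Tr.assign_iff, ev_mul, ev_add, ev_var, ev_const, St.set_reg,
        reduceCtorEq, if_false, if_true, hg1, hs1', hR1', h1, h2, h3, h4, ← pow_succ, and_true]
      exact ⟨(Nat.pow_le_pow_right (by omega) hlt).trans hgU,
        (Nat.pow_le_pow_right hs1 hlt).trans hsL, (Nat.pow_le_pow_right hR1 hlt).trans hRL,
        by change i + 1 ≤ L.nq; omega⟩
    · intro h
      simp only [ev_sub, ev_var, St.set_reg, reduceCtorEq, if_false, hnk1, h2] at h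
      have hle : levels g nk ≤ i := by
        by_contra hlt
        rw [min_eq_left (by omega)] at h
        have := (Nat.lt_clog_iff_pow_lt (by omega : 1 < g)).1 (not_le.1 hlt)
        omega
      rw [min_eq_right hle] at h1 h2 h3 h4
      rw [min_eq_right (by omega)]
      simp only [Tr.skip_iff, St.set_reg, reduceCtorEq, if_false]
      exact ⟨h1, h2, h3, h4⟩
  · rintro σ₁ hF ⟨h1, h2, h3, h4⟩
    rw [min_eq_right hm] at h1 h3 h4
    simp only [St.set_reg, reduceCtorEq, if_false]
    exact ⟨h1, h3, h4⟩

end CliqueAlg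

/-! ### Correctness of the matrix entries modulo `M`. -/

namespace CliqueAlg

open LoopLang Finset

variable {L : Lim} {σ : St Var Arr}

theorem edgeProg_spec {N M x Wm : ℕ} {ef : ℕ → ℕ} (hnn : σ.reg .nn = N) (hM : σ.reg .M = M)
    (hx : σ.reg .point = x) (hefσ : σ.arr .ef = ef) (hM2 : 2 ≤ M) (hef : ∀ j < N, ef j ≤ Wm)
    (hWL : Wm ≤ L.W) (hWU : Wm ≤ L.U) (hNU : N ≤ L.U) (hMU : M ≤ L.U) :
    Tr L.bounds edgeProg σ fun σ' => ∀ j < N, (σ'.arr .pows j : ZMod M) =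
      if ef j = 0 then 0 else (x : ZMod M) ^ (ef j - 1) := by
  refine Tr.loop (fun i σ' => ∀ j < i, (σ'.arr .pows j : ZMod M) =
      if ef j = 0 then 0 else (x : ZMod M) ^ (ef j - 1)) N hnn hNU (by simp) ?_
    (fun σ₁ _ h => h)
  intro j hj σ₁ hF h1
  have hM1 : σ₁.reg .M = M := by rw [hF.reg _ rfl, hM]
  have hx1 : σ₁.reg .point = x := by rw [hF.reg _ rfl, hx]
  have hef1 : σ₁.arr .ef = ef := by rw [hF.arr _ rfl, hefσ]
  have hfin : ∀ (σ₂ : St Var Arr) (v : ℕ), σ₂.arr .pows = σ₁.arr .pows →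
      (v : ZMod M) = (if ef j = 0 then 0 else (x : ZMod M) ^ (ef j - 1)) →
      ∀ j' < j + 1, ((σ₂.put .pows j v).arr .pows j' : ZMod M) =
        if ef j' = 0 then 0 else (x : ZMod M) ^ (ef j' - 1) := by
    intro σ₂ v h2 hv j' hj'
    rw [St.put_arr]
    by_cases e : j' = j
    · rw [if_pos ⟨rfl, e⟩, e, hv]
    · rw [if_neg (fun h => e h.2), h2, h1 j' (by omega)]
  refine Tr.ite ?_ ?_
  · intro h0
    simp only [ev_get, ev_var, St.set_arr, St.set_reg, if_true, hef1] at h0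
    refine Tr.seq_iff.2 ⟨by change 1 ≤ L.U; omega, Tr.seq_iff.2 ⟨?_, ?_⟩⟩
    · simp only [Pr.Safe, Pr.run, ev_sub, ev_get, ev_var, ev_const, St.set_arr, St.set_reg,
        if_true, hef1, reduceCtorEq, if_false]
      have := hef j hj
      change _ ≤ L.W; omega
    refine Tr.seq (R := fun σ' => σ'.reg .acc < M ∧
      (σ'.reg .acc : ZMod M) = (x : ZMod M) ^ (ef j - 1)) ?_ ?_
    · refine Tr.loop (fun i σ' => σ'.reg .acc < M ∧ (σ'.reg .acc : ZMod M) = (x : ZMod M) ^ i)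
        (ef j - 1) (by simp [Pr.run, ev_sub, ev_get, ev_var, ev_const, hef1])
        (by have := hef j hj; change _ ≤ L.U; omega)
        (by simp [Pr.run, ev_const]; omega) ?_ (fun σ₂ _ h => by simpa using h)
      rintro i hi σ₂ hF2 ⟨h2, h3⟩
      have hM2 : σ₂.reg .M = M := by rw [hF2.reg _ rfl]; simpa [Pr.run] using hM1
      have hx2 : σ₂.reg .point = x := by rw [hF2.reg _ rfl]; simpa [Pr.run] using hx1
      simp only [Tr.assign_iff, ev_mod, ev_mul, ev_var, St.set_reg, reduceCtorEq, if_false,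
        if_true, hM2, hx2, ZMod.natCast_mod]
      have hlt : σ₂.reg .acc * x % M < M := Nat.mod_lt _ (by omega)
      refine ⟨hlt.le.trans hMU, hlt, ?_⟩
      push_cast
      rw [h3, pow_succ]
    · rintro σ₂ hF2 ⟨h2, h3⟩
      have hj2 : σ₂.reg .j = j := by rw [hF2.reg _ rfl]; simp [Pr.run]
      refine ⟨by change σ₂.reg .acc ≤ L.U; omega, ?_⟩
      change ∀ j' < j + 1, ((σ₂.put .pows (σ₂.reg .j) (σ₂.reg .acc)).arr .pows j' : ZMod M) = _
      rw [hj2]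
      exact hfin σ₂ _ (by rw [hF2.arr _ rfl]; rfl) (by rw [h3, if_neg h0])
  · intro h0
    simp only [ev_get, ev_var, St.set_arr, St.set_reg, if_true, hef1] at h0
    refine ⟨Nat.zero_le _, ?_⟩
    change ∀ j' < j + 1, (((σ₁.set .j j).put .pows ((σ₁.set .j j).reg .j) 0).arr .pows j' :
      ZMod M) = _
    rw [St.set_reg, if_pos rfl]
    exact hfin _ 0 rfl (by rw [if_pos h0, Nat.cast_zero])

/-- The digits of `I` occupy the places from `0` on in `dig`, those of `J` the places from `k` on.
Pairs inside `J` are left out: in the trace they come from the next factor, whose row is `J`. -/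
theorem entryProg_spec {n k M I J : ℕ} {F : ℕ → ℕ → ZMod M} (hn : σ.reg .n = n)
    (hk : σ.reg .k = k) (hM : σ.reg .M = M) (hI : σ.reg .I = I) (hJ : σ.reg .J = J)
    (hF : ∀ a < n, ∀ b < n, (σ.arr .pows (a * n + b) : ZMod M) = F a b)
    (hn0 : 0 < n) (hM2 : 2 ≤ M) (hMU : M ≤ L.U) (hIU : I ≤ L.U) (hJU : J ≤ L.U) (hkq : k ≤ L.q)
    (hkU : k ≤ L.U) :
    Tr L.bounds entryProg σ fun σ' => σ'.reg .acc < M ∧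
      (σ'.reg .acc : ZMod M) = pairProd n k F I * crossProd n k F I J := by
  refine Tr.seq_iff.2 ⟨by change σ.reg .I ≤ L.U; omega, ?_⟩
  refine Tr.seq (digitsProg_spec (L := L) (n := n) (y := I) (N := k) (o := 0)
    (by simpa [Pr.run] using hn) (by simpa [Pr.run, ev_var] using hI) hIU
    (by simpa [Pr.run] using hk) hkU (fun _ _ => rfl)) ?_
  rintro σ₁ hF1 ⟨hd1, -⟩
  have hn1 : σ₁.reg .n = n := by rw [hF1.reg _ rfl]; simpa [Pr.run] using hn
  have hk1 : σ₁.reg .k = k := by rw [hF1.reg _ rfl]; simpa [Pr.run] using hk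
  have hJ1 : σ₁.reg .J = J := by rw [hF1.reg _ rfl]; simpa [Pr.run] using hJ
  have hM1 : σ₁.reg .M = M := by rw [hF1.reg _ rfl]; simpa [Pr.run] using hM
  have hp1 : σ₁.arr .pows = σ.arr .pows := by rw [hF1.arr _ rfl]; rfl
  refine Tr.seq_iff.2 ⟨by change σ₁.reg .J ≤ L.U; omega, ?_⟩
  refine Tr.seq (digitsProg_spec (L := L) (n := n) (y := J) (N := k) (o := k)
    (by simpa [Pr.run] using hn1) (by simpa [Pr.run, ev_var] using hJ1) hJU
    (by simpa [Pr.run] using hk1) hkU (fun σ' h => by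
      rw [ev_var, h _ (by decide) (by decide)]; simpa [Pr.run] using hk1)) ?_
  rintro σ₂ hF2 ⟨hd2, hd2'⟩
  have hn2 : σ₂.reg .n = n := by rw [hF2.reg _ rfl]; simpa [Pr.run] using hn1
  have hk2 : σ₂.reg .k = k := by rw [hF2.reg _ rfl]; simpa [Pr.run] using hk1
  have hM2' : σ₂.reg .M = M := by rw [hF2.reg _ rfl]; simpa [Pr.run] using hM1
  have hp2 : σ₂.arr .pows = σ.arr .pows := by rw [hF2.arr _ rfl]; simpa [Pr.run] using hp1
  have hdI : ∀ t < k, σ₂.arr .dig t = dg n t I := fun t ht => by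
    rw [hd2' t ht]; simpa [Pr.run] using hd1 t ht
  refine Tr.seq_iff.2 ⟨by change 1 ≤ L.U; omega, ?_⟩
  refine Tr.loop (fun u σ' => σ'.reg .acc < M ∧ (σ'.reg .acc : ZMod M) =
    ∏ u' ∈ range u, ((∏ t ∈ range u', F (dg n t I) (dg n u' I)) *
      ∏ t ∈ range k, F (dg n t I) (dg n u' J))) k (by simpa [Pr.run] using hk2) hkq
    (by simp [Pr.run, ev_const]; omega) ?_ ?_
  · rintro u hu σ₃ hF3 ⟨h1, h2⟩
    have hn3 : σ₃.reg .n = n := by rw [hF3.reg _ rfl]; simpa [Pr.run] using hn2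
    have hk3 : σ₃.reg .k = k := by rw [hF3.reg _ rfl]; simpa [Pr.run] using hk2
    have hM3 : σ₃.reg .M = M := by rw [hF3.reg _ rfl]; simpa [Pr.run] using hM2'
    have hp3 : σ₃.arr .pows = σ.arr .pows := by rw [hF3.arr _ rfl]; simpa [Pr.run] using hp2
    have hd3 : σ₃.arr .dig = σ₂.arr .dig := by rw [hF3.arr _ rfl]; rfl
    rw [prod_range_succ]
    set A := ∏ u' ∈ range u, ((∏ t ∈ range u', F (dg n t I) (dg n u' I)) *
      ∏ t ∈ range k, F (dg n t I) (dg n u' J)) with hA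
    refine Tr.seq (R := fun σ' => σ'.reg .acc < M ∧ (σ'.reg .acc : ZMod M) =
      A * ∏ t ∈ range u, F (dg n t I) (dg n u I)) ?_ ?_
    · refine Tr.loop (fun t σ' => σ'.reg .acc < M ∧ (σ'.reg .acc : ZMod M) =
        A * ∏ t' ∈ range t, F (dg n t' I) (dg n u I)) u (by simp) (hu.le.trans hkU)
        (by simpa using ⟨h1, h2⟩) ?_ (fun σ₄ _ h => by simpa using h)
      rintro t ht σ₄ hF4 ⟨k1, k2⟩
      have hn4 : σ₄.reg .n = n := by rw [hF4.reg _ rfl]; simpa using hn3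
      have hM4 : σ₄.reg .M = M := by rw [hF4.reg _ rfl]; simpa using hM3
      have hu4 : σ₄.reg .u = u := by rw [hF4.reg _ rfl]; simp
      have hp4 : σ₄.arr .pows = σ.arr .pows := by rw [hF4.arr _ rfl]; simpa using hp3
      have hd4 : σ₄.arr .dig = σ₂.arr .dig := by rw [hF4.arr _ rfl]; simpa using hd3
      simp only [Tr.assign_iff, ev_mod, ev_mul, ev_add, ev_get, ev_var, St.set_reg, St.set_arr,
        reduceCtorEq, if_false, if_true, hM4, hn4, hu4, hp4, hd4, hdI t (by omega), hdI u hu,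
        ZMod.natCast_mod]
      refine ⟨(Nat.mod_lt _ (by omega)).le.trans hMU, Nat.mod_lt _ (by omega), ?_⟩
      rw [Nat.cast_mul, k2, hF _ (dg_lt hn0 _ _) _ (dg_lt hn0 _ _), prod_range_succ, mul_assoc]
    · rintro σ₄ hF4 ⟨k1, k2⟩
      rw [← mul_assoc, ← k2]
      have hn4 : σ₄.reg .n = n := by rw [hF4.reg _ rfl]; simpa using hn3
      have hk4 : σ₄.reg .k = k := by rw [hF4.reg _ rfl]; simpa using hk3
      have hM4 : σ₄.reg .M = M := by rw [hF4.reg _ rfl]; simpa using hM3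
      have hu4 : σ₄.reg .u = u := by rw [hF4.reg _ rfl]; simp
      have hp4 : σ₄.arr .pows = σ.arr .pows := by rw [hF4.arr _ rfl]; simpa using hp3
      have hd4 : σ₄.arr .dig = σ₂.arr .dig := by rw [hF4.arr _ rfl]; simpa using hd3
      refine Tr.loop (fun t σ' => σ'.reg .acc < M ∧ (σ'.reg .acc : ZMod M) =
        (σ₄.reg .acc : ZMod M) * ∏ t' ∈ range t, F (dg n t' I) (dg n u J)) k hk4 hkU
        (by simpa using k1) ?_ (fun σ₅ _ h => by simpa using h)
      rintro t ht σ₅ hF5 ⟨m1, m2⟩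
      have hn5 : σ₅.reg .n = n := by rw [hF5.reg _ rfl, hn4]
      have hk5 : σ₅.reg .k = k := by rw [hF5.reg _ rfl, hk4]
      have hM5 : σ₅.reg .M = M := by rw [hF5.reg _ rfl, hM4]
      have hu5 : σ₅.reg .u = u := by rw [hF5.reg _ rfl, hu4]
      have hp5 : σ₅.arr .pows = σ.arr .pows := by rw [hF5.arr _ rfl, hp4]
      have hd5 : σ₅.arr .dig = σ₂.arr .dig := by rw [hF5.arr _ rfl, hd4]
      simp only [Tr.assign_iff, ev_mod, ev_mul, ev_add, ev_get, ev_var, St.set_reg, St.set_arr,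
        reduceCtorEq, if_false, if_true, hM5, hn5, hu5, hk5, hp5, hd5, hdI t ht, hd2 u hu,
        ZMod.natCast_mod]
      refine ⟨(Nat.mod_lt _ (by omega)).le.trans hMU, Nat.mod_lt _ (by omega), ?_⟩
      rw [Nat.cast_mul, m2, hF _ (dg_lt hn0 _ _) _ (dg_lt hn0 _ _), prod_range_succ, mul_assoc]
  · rintro σ₃ hF3 ⟨h1, h2⟩
    simp only [St.set_reg, reduceCtorEq, if_false]
    rw [prod_mul_distrib] at h2
    exact ⟨h1, h2⟩

theorem positionProg_spec {g m z : ℕ} (hg : σ.reg .g = g) (hs : σ.reg .s = g * g)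
    (hm : σ.reg .m = m) (hz : σ.reg .z = z) (hg0 : 0 < g) (hzU : z ≤ L.U) (hmU : m ≤ L.U)
    (hgU : g ^ m ≤ L.U) (hggU : g * g ≤ L.U) :
    Tr L.bounds positionProg σ fun σ' =>
      σ'.reg .I = rowOf g m z ∧ σ'.reg .J = colOf g m z := by
  have hU1 : 1 ≤ L.U := (Nat.one_le_pow _ _ hg0).trans hgU
  refine Tr.seq_iff.2 ⟨by change σ.reg .z ≤ L.U; omega, Tr.seq_iff.2 ⟨Nat.zero_le _,
    Tr.seq_iff.2 ⟨Nat.zero_le _, Tr.seq_iff.2 ⟨hU1, ?_⟩⟩⟩⟩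
  refine Tr.loop (fun t σ' => σ'.reg .y = z / (g * g) ^ t ∧ σ'.reg .I = rowOf g t z ∧
    σ'.reg .J = colOf g t z ∧ σ'.reg .pw = g ^ t) m (by simpa [Pr.run] using hm) hmU
    (by simp [Pr.run, ev_const, ev_var, hz, rowOf, colOf]) ?_ ?_
  · rintro t ht σ₁ hF ⟨h1, h2, h3, h4⟩
    have hg1 : σ₁.reg .g = g := by rw [hF.reg _ rfl]; simpa [Pr.run] using hg
    have hs1 : σ₁.reg .s = g * g := by rw [hF.reg _ rfl]; simpa [Pr.run] using hs
    simp only [Tr.seq_iff, Tr.assign_iff, ev_mod, ev_div, ev_mul, ev_add, ev_var, St.set_reg,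
      reduceCtorEq, if_false, if_true, hg1, hs1, h1, h2, h3, h4]
    have hpow : g ^ (t + 1) ≤ L.U := (Nat.pow_le_pow_right hg0 ht).trans hgU
    have hr := rowOf_lt hg0 (t + 1) z
    have hc := colOf_lt hg0 (t + 1) z
    have er : rowOf g (t + 1) z = rowOf g t z + z / (g * g) ^ t % (g * g) / g * g ^ t := by
      rw [rowOf, sum_range_succ]; rfl
    have ec : colOf g (t + 1) z = colOf g t z + z / (g * g) ^ t % (g * g) % g * g ^ t := by
      rw [colOf, sum_range_succ]; rfl
    rw [← er, ← ec, ← pow_succ, Nat.div_div_eq_div_mul, ← pow_succ]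
    refine ⟨(Nat.mod_lt _ (by positivity)).le.trans hggU, (Nat.div_le_self _ _).trans hzU,
      hr.le.trans hpow, hc.le.trans hpow, hpow, rfl, rfl, rfl, rfl⟩
  · rintro σ₁ hF ⟨h1, h2, h3, h4⟩
    simp only [St.set_reg, reduceCtorEq, if_false]
    exact ⟨h2, h3⟩

/-- The matrix is padded with zeros to the side `g ^ m` and stored with the base-`g` digits of row
and column interleaved, so that each digit of the position in base `g * g` belongs to one tensor
factor. -/
theorem matrixProg_spec {n k nk g m M : ℕ} {F : ℕ → ℕ → ZMod M} (hn : σ.reg .n = n)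
    (hk : σ.reg .k = k) (hnk : σ.reg .nk = nk) (hg : σ.reg .g = g) (hs : σ.reg .s = g * g)
    (hm : σ.reg .m = m) (hM : σ.reg .M = M) (hsN : σ.reg .sN = (g * g) ^ m)
    (hF : ∀ a < n, ∀ b < n, (σ.arr .pows (a * n + b) : ZMod M) = F a b)
    (hn0 : 0 < n) (hg0 : 0 < g) (hM2 : 2 ≤ M) (hMU : M ≤ L.U) (hkq : k ≤ L.q)
    (hkU : k ≤ L.U) (hmU : m ≤ L.U) (hgU : (g * g) ^ m ≤ L.U) (hggU : g * g ≤ L.U) :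
    Tr L.bounds matrixProg σ fun σ' => ∀ z < (g * g) ^ m, (σ'.arr .vec z : ZMod M) =
      if rowOf g m z < nk ∧ colOf g m z < nk then
        pairProd n k F (rowOf g m z) * crossProd n k F (rowOf g m z) (colOf g m z) else 0 := by
  have hgm : g ^ m ≤ L.U := (Nat.pow_le_pow_left (by nlinarith) m).trans hgU
  refine Tr.loop (fun i σ' => ∀ z < i, (σ'.arr .vec z : ZMod M) =
      if rowOf g m z < nk ∧ colOf g m z < nk then
        pairProd n k F (rowOf g m z) * crossProd n k F (rowOf g m z) (colOf g m z) else 0)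
    _ hsN hgU (by simp) ?_ (fun σ₁ _ h => h)
  intro z hz σ₁ hF1 h1
  have hn1 : σ₁.reg .n = n := by rw [hF1.reg _ rfl, hn]
  have hk1 : σ₁.reg .k = k := by rw [hF1.reg _ rfl, hk]
  have hM1 : σ₁.reg .M = M := by rw [hF1.reg _ rfl, hM]
  have hnk1 : σ₁.reg .nk = nk := by rw [hF1.reg _ rfl, hnk]
  have hp1 : σ₁.arr .pows = σ.arr .pows := by rw [hF1.arr _ rfl]
  refine Tr.seq (positionProg_spec (L := L) (g := g) (m := m) (z := z)
    (by simpa using (hF1.reg .g rfl).trans hg) (by simpa using (hF1.reg .s rfl).trans hs)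
    (by simpa using (hF1.reg .m rfl).trans hm) (by simp) hg0 (hz.le.trans hgU) hmU hgm hggU) ?_
  rintro σ₂ hF2 ⟨hI, hJ⟩
  have hn2 : σ₂.reg .n = n := by rw [hF2.reg _ rfl]; simpa using hn1
  have hk2 : σ₂.reg .k = k := by rw [hF2.reg _ rfl]; simpa using hk1
  have hM2' : σ₂.reg .M = M := by rw [hF2.reg _ rfl]; simpa using hM1
  have hnk2 : σ₂.reg .nk = nk := by rw [hF2.reg _ rfl]; simpa using hnk1
  have hz2 : σ₂.reg .z = z := by rw [hF2.reg _ rfl]; simp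
  have hp2 : σ₂.arr .pows = σ.arr .pows := by rw [hF2.arr _ rfl]; simpa using hp1
  have hv2 : σ₂.arr .vec = σ₁.arr .vec := by rw [hF2.arr _ rfl]; rfl
  set I := rowOf g m z with hIdef
  set J := colOf g m z with hJdef
  have hIU : I ≤ L.U := (rowOf_lt hg0 m z).le.trans hgm
  have hJU : J ≤ L.U := (colOf_lt hg0 m z).le.trans hgm
  have hfin : ∀ (σ₃ : St Var Arr) (v : ℕ), σ₃.arr .vec = σ₁.arr .vec →
      (v : ZMod M) = (if I < nk ∧ J < nk then pairProd n k F I * crossProd n k F I J else 0) →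
      ∀ z' < z + 1, ((σ₃.put .vec z v).arr .vec z' : ZMod M) =
        if rowOf g m z' < nk ∧ colOf g m z' < nk then
          pairProd n k F (rowOf g m z') * crossProd n k F (rowOf g m z') (colOf g m z') else 0 := by
    intro σ₃ v h3 hv z' hz'
    rw [St.put_arr]
    by_cases e : z' = z
    · rw [if_pos ⟨rfl, e⟩, e, hv]
    · rw [if_neg (fun h => e h.2), h3, h1 z' (by omega)]
  have htest : ((rg .nk - rg .I) * (rg .nk - rg .J) : E).ev σ₂ = (nk - I) * (nk - J) := by
    simp only [ev_mul, ev_sub, ev_var, hnk2, hI, hJ]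
  refine Tr.ite ?_ ?_
  · intro h0
    rw [htest] at h0
    have hIJ : I < nk ∧ J < nk := by
      constructor <;> by_contra hc <;> apply h0
      · rw [Nat.sub_eq_zero_of_le (by omega), Nat.zero_mul]
      · rw [Nat.sub_eq_zero_of_le (n := nk) (m := J) (by omega), Nat.mul_zero]
    refine Tr.seq (entryProg_spec hn2 hk2 hM2' hI hJ (by rw [hp2]; exact hF) hn0 hM2 hMU hIU hJU
      hkq hkU) ?_
    rintro σ₃ hF3 ⟨k1, k2⟩
    have hz3 : σ₃.reg .z = z := by rw [hF3.reg _ rfl, hz2]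
    refine ⟨by change σ₃.reg .acc ≤ L.U; omega, ?_⟩
    change ∀ z' < z + 1, ((σ₃.put .vec (σ₃.reg .z) (σ₃.reg .acc)).arr .vec z' : ZMod M) = _
    rw [hz3]
    exact hfin σ₃ _ (by rw [hF3.arr _ rfl, hv2]) (by rw [k2, if_pos hIJ])
  · intro h0
    rw [htest] at h0
    have hIJ : ¬ (I < nk ∧ J < nk) := by
      rintro ⟨h, h'⟩
      rcases Nat.mul_eq_zero.1 h0 with h0 | h0 <;> omega
    refine ⟨Nat.zero_le _, ?_⟩
    change ∀ z' < z + 1, ((σ₂.put .vec (σ₂.reg .z) 0).arr .vec z' : ZMod M) = _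
    rw [hz2]
    exact hfin σ₂ 0 hv2 (by rw [if_neg hIJ, Nat.cast_zero])

end CliqueAlg

/-! ### Correctness of the tensor power transformation and of the difference table. -/

namespace CliqueAlg

open LoopLang Finset

variable {L : Lim} {σ : St Var Arr}

theorem index_inj {Q r r' h h' : ℕ} (hh : h < Q) (hh' : h' < Q) (e : r * Q + h = r' * Q + h') :
    r = r' ∧ h = h' := by
  have e1 : (r * Q + h) / Q = r := by
    rw [Nat.mul_comm, Nat.mul_add_div (by omega), Nat.div_eq_of_lt hh, Nat.add_zero]
  have e2 : (r' * Q + h') / Q = r' := by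
    rw [Nat.mul_comm, Nat.mul_add_div (by omega), Nat.div_eq_of_lt hh', Nat.add_zero]
  have e3 : r = r' := by rw [← e1, e, e2]
  subst e3
  exact ⟨rfl, by omega⟩

/-- The results are gathered in `tmp`, as `vec` is still being read, and copied at the end.
`index_inj` ensures that a store does not destroy an earlier result. -/
theorem passProg_spec {R s Q c M : ℕ} {co : ℕ → ℕ → ZMod M} (hR : σ.reg .R = R)
    (hs : σ.reg .s = s) (hc : σ.reg .c = c) (hM : σ.reg .M = M) (hln : σ.reg .ln = Q * s)
    (hco : ∀ r < R, ∀ e < s, (σ.arr .pos ((c * R + r) * s + e) : ZMod M) -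
      σ.arr .neg ((c * R + r) * s + e) = co r e)
    (hM2 : 2 ≤ M) (hMU : M ≤ L.U) (hs0 : 0 < s) (hsU : s ≤ L.U) (hR0 : 0 < R) (hRU : R ≤ L.U)
    (hQL : Q * R ≤ L.rN) (hrU : L.rN ≤ L.U) :
    Tr L.bounds passProg σ fun σ' => σ'.reg .ln = Q * R ∧
      IsPass R s co Q (fun i => (σ.arr .vec i : ZMod M)) (fun i => (σ'.arr .vec i : ZMod M)) := by
  have hQR : Q ≤ Q * R := Nat.le_mul_of_pos_right _ hR0
  have hQ : (rg .ln / rg .s : E).ev σ = Q := by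
    simp only [ev_div, ev_var, hln, hs, Nat.mul_div_cancel _ hs0]
  set V := fun i => (σ.arr .vec i : ZMod M) with hV
  refine Tr.seq_iff.2 ⟨by change (rg .ln / rg .s : E).ev σ ≤ L.rN; omega, ?_⟩
  have hrun : Pr.run (.assign .Q (rg .ln / rg .s)) σ = σ.set .Q Q := by rw [Pr.run, hQ]
  rw [hrun]
  refine Tr.seq (R := fun σ' => ∀ r < R, ∀ h < Q, σ'.arr .tmp (r * Q + h) < M ∧
    (σ'.arr .tmp (r * Q + h) : ZMod M) = ∑ e ∈ range s, co r e * V (h * s + e)) ?_ ?_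
  · refine Tr.loop (fun h σ' => ∀ r < R, ∀ h' < h, σ'.arr .tmp (r * Q + h') < M ∧
      (σ'.arr .tmp (r * Q + h') : ZMod M) = ∑ e ∈ range s, co r e * V (h' * s + e)) Q (by simp)
      (by change Q ≤ L.U; omega) (by simp) ?_ (fun σ₁ _ h => h)
    intro h hh σ₁ hF1 h1
    refine Tr.loop (fun r σ' => (∀ r' < R, ∀ h' < h, σ'.arr .tmp (r' * Q + h') < M ∧
      (σ'.arr .tmp (r' * Q + h') : ZMod M) = ∑ e ∈ range s, co r' e * V (h' * s + e)) ∧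
      ∀ r' < r, σ'.arr .tmp (r' * Q + h) < M ∧
      (σ'.arr .tmp (r' * Q + h) : ZMod M) = ∑ e ∈ range s, co r' e * V (h * s + e)) R
      (by simpa using (hF1.reg .R rfl).trans (by simpa using hR)) hRU ⟨h1, by simp⟩ ?_ ?_
    · rintro r hr σ₂ hF2 ⟨h2, h3⟩
      refine Tr.seq_iff.2 ⟨Nat.zero_le _, ?_⟩
      have hR2 : σ₂.reg .R = R := by
        rw [hF2.reg _ rfl]; simpa using (hF1.reg .R rfl).trans (by simpa using hR)
      have hs2 : σ₂.reg .s = s := by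
        rw [hF2.reg _ rfl]; simpa using (hF1.reg .s rfl).trans (by simpa using hs)
      have hc2 : σ₂.reg .c = c := by
        rw [hF2.reg _ rfl]; simpa using (hF1.reg .c rfl).trans (by simpa using hc)
      have hM2' : σ₂.reg .M = M := by
        rw [hF2.reg _ rfl]; simpa using (hF1.reg .M rfl).trans (by simpa using hM)
      have hQ2 : σ₂.reg .Q = Q := by
        rw [hF2.reg _ rfl]; simpa using (hF1.reg .Q rfl).trans (by simp)
      have hh2 : σ₂.reg .h = h := by rw [hF2.reg _ rfl]; simp
      have hpos2 : σ₂.arr .pos = σ.arr .pos := by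
        rw [hF2.arr _ rfl]; exact hF1.arr .pos rfl
      have hneg2 : σ₂.arr .neg = σ.arr .neg := by
        rw [hF2.arr _ rfl]; exact hF1.arr .neg rfl
      have hvec2 : σ₂.arr .vec = σ.arr .vec := by
        rw [hF2.arr _ rfl]; exact hF1.arr .vec rfl
      refine Tr.seq (R := fun σ' => σ'.reg .acc < M ∧
        (σ'.reg .acc : ZMod M) = ∑ e ∈ range s, co r e * V (h * s + e)) ?_ ?_
      · refine Tr.loop (fun e σ' => σ'.reg .acc < M ∧
          (σ'.reg .acc : ZMod M) = ∑ e' ∈ range e, co r e' * V (h * s + e')) s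
          (by simpa [Pr.run] using hs2) hsU (by simp [Pr.run, ev_const]; omega) ?_
          (fun σ₃ _ h => by simpa using h)
        rintro e he σ₃ hF3 ⟨k1, k2⟩
        have hR3 : σ₃.reg .R = R := by rw [hF3.reg _ rfl]; simpa [Pr.run] using hR2
        have hs3 : σ₃.reg .s = s := by rw [hF3.reg _ rfl]; simpa [Pr.run] using hs2
        have hc3 : σ₃.reg .c = c := by rw [hF3.reg _ rfl]; simpa [Pr.run] using hc2
        have hM3 : σ₃.reg .M = M := by rw [hF3.reg _ rfl]; simpa [Pr.run] using hM2'
        have hh3 : σ₃.reg .h = h := by rw [hF3.reg _ rfl]; simpa [Pr.run] using hh2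
        have hr3 : σ₃.reg .r = r := by rw [hF3.reg _ rfl]; simp [Pr.run]
        have hpos3 : σ₃.arr .pos = σ.arr .pos := by rw [hF3.arr _ rfl]; simpa [Pr.run] using hpos2
        have hneg3 : σ₃.arr .neg = σ.arr .neg := by rw [hF3.arr _ rfl]; simpa [Pr.run] using hneg2
        have hvec3 : σ₃.arr .vec = σ.arr .vec := by rw [hF3.arr _ rfl]; simpa [Pr.run] using hvec2
        simp only [Tr.assign_iff, ev_mod, ev_mul, ev_add, ev_sub, ev_get, ev_var, ev_const,
          St.set_reg, St.set_arr, reduceCtorEq, if_false, if_true, hR3, hs3, hc3, hM3, hh3, hr3,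
          hpos3, hneg3, hvec3, ZMod.natCast_mod]
        refine ⟨(Nat.mod_lt _ (by omega)).le.trans hMU, Nat.mod_lt _ (by omega), ?_⟩
        push_cast [Nat.cast_sub (by omega : 1 ≤ M)]
        rw [k2, sum_range_succ, ← hco r hr e he, ZMod.natCast_self, hV]
        ring
      · rintro σ₃ hF3 ⟨k1, k2⟩
        have hQ3 : σ₃.reg .Q = Q := by rw [hF3.reg _ rfl]; simpa [Pr.run] using hQ2
        have hh3 : σ₃.reg .h = h := by rw [hF3.reg _ rfl]; simpa [Pr.run] using hh2
        have hr3 : σ₃.reg .r = r := by rw [hF3.reg _ rfl]; simp [Pr.run]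
        have ht3 : σ₃.arr .tmp = σ₂.arr .tmp := by rw [hF3.arr _ rfl]; simp [Pr.run]
        simp only [Tr.store_iff, ev_add, ev_mul, ev_var, hQ3, hh3, hr3, St.put_arr, true_and, ht3]
        refine ⟨by change _ ≤ L.U; omega, fun r' hr' h' hh' => ?_, fun r' hr' => ?_⟩
        · rw [if_neg fun he => by have := (index_inj (by omega) hh he).2; omega]
          exact h2 r' hr' h' hh'
        · by_cases e : r' = r
          · rw [e, if_pos rfl]; exact ⟨k1, k2⟩
          · rw [if_neg fun he => e (index_inj hh hh he).1]
            exact h3 r' (by omega)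
    · rintro σ₂ hF2 ⟨h2, h3⟩ r hr h' hh'
      by_cases e : h' = h
      · rw [e]; exact h3 r hr
      · exact h2 r hr h' (by omega)
  · intro σ₁ hF1 h1
    have hQ1 : σ₁.reg .Q = Q := by rw [hF1.reg _ rfl]; simp
    have hR1 : σ₁.reg .R = R := by rw [hF1.reg _ rfl]; simpa using hR
    have hQR1 : (rg .Q * rg .R : E).ev σ₁ = Q * R := by simp only [ev_mul, ev_var, hQ1, hR1]
    refine Tr.seq_iff.2 ⟨by change (rg .Q * rg .R : E).ev σ₁ ≤ L.rN; omega, ?_⟩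
    have hrun : Pr.run (.assign .ln (rg .Q * rg .R)) σ₁ = σ₁.set .ln (Q * R) := by
      rw [Pr.run, hQR1]
    rw [hrun]
    have h1' : ∀ i < Q * R, σ₁.arr .tmp i < M := by
      intro i hi
      have := (h1 (i / Q) (Nat.div_lt_of_lt_mul hi) (i % Q)
        (Nat.mod_lt _ (Nat.pos_of_ne_zero fun h => by simp [h] at hi))).1
      rwa [Nat.div_add_mod'] at this
    refine Tr.loop (fun i σ' => ∀ j < i, σ'.arr .vec j = σ₁.arr .tmp j) (Q * R) (by simp)
      (by change Q * R ≤ L.U; omega) (by simp) ?_ ?_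
    · intro i hi σ₂ hF2 h2
      have ht2 : σ₂.arr .tmp = σ₁.arr .tmp := by rw [hF2.arr _ rfl]; rfl
      simp only [Tr.store_iff, ev_get, ev_var, St.set_reg, St.set_arr, if_true, St.put_arr, ht2,
        true_and]
      refine ⟨(h1' i hi).le.trans hMU, fun j hj => ?_⟩
      by_cases e : j = i
      · rw [if_pos e, e]
      · rw [if_neg e, h2 j (by omega)]
    · intro σ₂ hF2 h2
      refine ⟨?_, fun r hr h hh => ?_⟩
      · simpa using (hF2.reg .ln rfl).trans (by simp)
      · simp only [St.set_arr]
        rw [h2 _ (by nlinarith), (h1 r hr h hh).2]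

theorem transformProg_spec {R s m c M : ℕ} {co : ℕ → ℕ → ZMod M} {V₀ : ℕ → ZMod M}
    (hR : σ.reg .R = R) (hs : σ.reg .s = s) (hm : σ.reg .m = m) (hc : σ.reg .c = c)
    (hM : σ.reg .M = M) (hsN : σ.reg .sN = s ^ m)
    (hco : ∀ r < R, ∀ e < s, (σ.arr .pos ((c * R + r) * s + e) : ZMod M) -
      σ.arr .neg ((c * R + r) * s + e) = co r e)
    (hV : ∀ z < s ^ m, (σ.arr .vec z : ZMod M) = V₀ z)
    (hM2 : 2 ≤ M) (hMU : M ≤ L.U) (hs0 : 0 < s) (hsR : s ≤ R) (hRU : R ≤ L.U)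
    (hmU : m ≤ L.U) (hRL : R ^ m ≤ L.rN) (hrU : L.rN ≤ L.U) :
    Tr L.bounds transformProg σ fun σ' => ∀ ρ < R ^ m, (σ'.arr .vec ρ : ZMod M) =
      ∑ δ ∈ range (s ^ m), tpow R s co m ρ δ * V₀ δ := by
  have hsm : s ^ m ≤ R ^ m := Nat.pow_le_pow_left hsR m
  refine Tr.seq_iff.2 ⟨by change σ.reg .sN ≤ L.rN; omega, ?_⟩
  refine Tr.loop (fun t σ' => σ'.reg .ln = R ^ t * s ^ (m - t) ∧
    IsTransform R s co m t (fun z => (σ.arr .vec z : ZMod M)) (fun z => (σ'.arr .vec z : ZMod M)))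
    m (by simpa [Pr.run] using hm) hmU ⟨by simp [Pr.run, ev_var, hsN], IsTransform.zero _ _ _ _ _⟩
    ?_ ?_
  · rintro t ht σ₁ hF1 ⟨h1, h2⟩
    have e1 : m - t = m - t - 1 + 1 := by omega
    -- Because `s ≤ R`, the lengths `R ^ t * s ^ (m - t)` do not decrease with `t` and never exceed
    -- `R ^ m`.
    have hbound : R ^ t * s ^ (m - t - 1) * R ≤ L.rN := by
      refine le_trans ?_ hRL
      calc R ^ t * s ^ (m - t - 1) * R ≤ R ^ t * R ^ (m - t - 1) * R :=
            Nat.mul_le_mul_right _ (Nat.mul_le_mul_left _ (Nat.pow_le_pow_left hsR _))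
        _ = R ^ m := by rw [← pow_add, ← pow_succ]; congr 1; omega
    refine Tr.imp (passProg_spec (L := L) (R := R) (s := s) (Q := R ^ t * s ^ (m - t - 1)) (c := c)
      (M := M) (co := co) (by simpa using (hF1.reg .R rfl).trans (by simpa [Pr.run] using hR))
      (by simpa using (hF1.reg .s rfl).trans (by simpa [Pr.run] using hs))
      (by simpa using (hF1.reg .c rfl).trans (by simpa [Pr.run] using hc))
      (by simpa using (hF1.reg .M rfl).trans (by simpa [Pr.run] using hM))
      (by simp only [St.set_reg, reduceCtorEq, if_false, h1]
          conv_lhs => rw [e1, pow_succ, ← mul_assoc])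
      (by
        have hp : (σ₁.set .t t).arr .pos = σ.arr .pos := hF1.arr .pos rfl
        have hn : (σ₁.set .t t).arr .neg = σ.arr .neg := hF1.arr .neg rfl
        rw [hp, hn]; exact hco) hM2 hMU hs0 (hsR.trans hRU) (by omega) hRU hbound hrU) ?_
    rintro σ₂ - ⟨k1, k2⟩
    refine ⟨?_, h2.succ ht k2⟩
    rw [k1, pow_succ, show m - (t + 1) = m - t - 1 by omega]
    ring
  · rintro σ₁ hF1 ⟨h1, h2⟩ ρ hρ
    simp only [St.set_arr]
    refine (h2.eq hρ).trans (sum_congr rfl fun δ hδ => ?_)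
    rw [hV δ (mem_range.1 hδ)]

/-- After `e` rounds the cell `x` holds the `e`-th difference at `x`, but only for `x + e ≤ D`; one
more cell becomes meaningless in each round. Working in place is safe: when cell `i` is replaced,
cell `i + 1` still has its old value. -/
theorem differenceProg_spec {D M : ℕ} {f : ZMod M → ZMod M} (hD : σ.reg .D = D)
    (hD1 : σ.reg .D₁ = D + 1) (hM : σ.reg .M = M)
    (hys : ∀ x ≤ D, σ.arr .ys x < M ∧ (σ.arr .ys x : ZMod M) = f x) (hM2 : 2 ≤ M) (hMU : M ≤ L.U)
    (hDU : D + 1 ≤ L.U) :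
    Tr L.bounds differenceProg σ fun σ' => σ'.reg .val =
      ((range (D + 1)).filter fun e => (fwdDiff 1)^[e] f 0 ≠ 0).sup (· + 1) := by
  refine Tr.seq_iff.2 ⟨Nat.zero_le _, ?_⟩
  refine Tr.loop (fun e σ' => σ'.reg .val =
      ((range e).filter fun e => (fwdDiff 1)^[e] f 0 ≠ 0).sup (· + 1) ∧
      ∀ x, x + e ≤ D → σ'.arr .ys x < M ∧ (σ'.arr .ys x : ZMod M) = (fwdDiff 1)^[e] f x) (D + 1)
    (by simpa [Pr.run] using hD1) hDU ⟨by simp [Pr.run, ev_const], fun x hx => by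
      simpa [Pr.run] using hys x hx⟩ ?_ ?_
  · rintro e he σ₁ hF1 ⟨h1, h2⟩
    have h20 := h2 0 (by omega)
    rw [Nat.cast_zero] at h20
    -- The cell holds a reduced residue, so it is `0` exactly when the residue class vanishes.
    have hne : σ₁.arr .ys 0 ≠ 0 ↔ (fwdDiff 1)^[e] f 0 ≠ 0 := by
      rw [← h20.2, Ne, Ne, ZMod.natCast_eq_zero_iff]
      refine not_congr ⟨fun h => by rw [h]; exact dvd_zero _, fun h => ?_⟩
      by_contra h0
      exact absurd (Nat.le_of_dvd (Nat.pos_of_ne_zero h0) h) (by omega)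
    refine Tr.seq (R := fun σ' => σ'.reg .val =
      ((range (e + 1)).filter fun e => (fwdDiff 1)^[e] f 0 ≠ 0).sup (· + 1)) ?_ ?_
    · rw [range_add_one, filter_insert]
      refine Tr.ite ?_ ?_
      · intro h
        have h' := hne.1 h
        simp only [Tr.assign_iff, ev_add, ev_var, ev_const, St.set_reg, if_true]
        refine ⟨by change e + 1 ≤ L.U; omega, ?_⟩
        rw [if_pos h', sup_insert]
        refine (max_eq_left (Finset.sup_le fun x hx => ?_)).symm
        have := mem_range.1 (mem_filter.1 hx).1
        omega
      · intro h
        have h' : ¬ (fwdDiff 1)^[e] f 0 ≠ 0 := fun h' => hne.2 h' h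
        rw [if_neg h']
        simpa using h1
    · intro σ₂ hF2 h3
      have hys2 : σ₂.arr .ys = σ₁.arr .ys := by rw [hF2.arr _ rfl]; rfl
      have hM2' : σ₂.reg .M = M := by
        rw [hF2.reg _ rfl]; simpa using (hF1.reg .M rfl).trans (by simpa [Pr.run] using hM)
      refine Tr.loop (fun i σ' => (∀ x < i, x + (e + 1) ≤ D → σ'.arr .ys x < M ∧
          (σ'.arr .ys x : ZMod M) = (fwdDiff 1)^[e + 1] f x) ∧
          ∀ x, i ≤ x → σ'.arr .ys x = σ₁.arr .ys x) D
        (by rw [hF2.reg _ rfl]; simpa using (hF1.reg .D rfl).trans (by simpa [Pr.run] using hD))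
        (by change D ≤ L.U; omega) ⟨by simp, fun x _ => by rw [hys2]⟩ ?_ ?_
      · rintro i hi σ₃ hF3 ⟨k1, k2⟩
        have hM3 : σ₃.reg .M = M := by rw [hF3.reg _ rfl, hM2']
        simp only [Tr.store_iff, ev_mod, ev_add, ev_sub, ev_get, ev_var, ev_const, St.set_reg,
          St.set_arr, reduceCtorEq, if_false, if_true, hM3, St.put_arr, true_and,
          k2 i le_rfl, k2 (i + 1) (by omega)]
        have hlt : (σ₁.arr .ys (i + 1) + (M - σ₁.arr .ys i)) % M < M := Nat.mod_lt _ (by omega)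
        refine ⟨hlt.le.trans hMU, fun x hx hxD => ?_, fun x hx => ?_⟩
        · by_cases e' : x = i
          · subst e'
            rw [if_pos rfl]
            refine ⟨hlt, ?_⟩
            have ha := h2 x (by omega)
            have hb := h2 (x + 1) (by omega)
            rw [ZMod.natCast_mod]
            push_cast [Nat.cast_sub ha.1.le]
            rw [ZMod.natCast_self, ha.2, hb.2, Function.iterate_succ_apply', fwdDiff]
            push_cast
            ring
          · rw [if_neg e']
            exact k1 x (by omega) hxD
        · rw [if_neg (by omega), k2 x (by omega)]
      · rintro σ₃ hF3 ⟨k1, k2⟩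
        refine ⟨?_, fun x hx => ?_⟩
        · simpa using (hF3.reg .val rfl).trans h3
        · exact k1 x (by omega) hx
  · rintro σ₁ hF1 ⟨h1, h2⟩
    simpa using h1

end CliqueAlg

/-! ### Evaluation of the trace polynomial at one point. -/

namespace CliqueAlg

open LoopLang Finset

variable {L : Lim} {σ σ' : St Var Arr} {d : MatMul.Decomposition}

/-- The state holds the constants of the algorithm: the instance size, the modulus `M`, the number
`m` of levels, and the coefficients of the decomposition. -/
structure Env (d : MatMul.Decomposition) (n₀ k₀ m₀ M₀ : ℕ) (σ : St Var Arr) : Prop where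
  n : σ.reg .n = n₀
  nn : σ.reg .nn = n₀ * n₀
  k : σ.reg .k = k₀
  nk : σ.reg .nk = n₀ ^ k₀
  g : σ.reg .g = d.g
  s : σ.reg .s = d.g * d.g
  R : σ.reg .R = d.R
  m : σ.reg .m = m₀
  M : σ.reg .M = M₀
  sN : σ.reg .sN = (d.g * d.g) ^ m₀
  rN : σ.reg .rN = d.R ^ m₀
  three : σ.reg .three = 3
  coef : ∀ c < 3, ∀ r < d.R, ∀ e < d.g * d.g,
    (σ.arr .pos ((c * d.R + r) * (d.g * d.g) + e) : ℤ) -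
      σ.arr .neg ((c * d.R + r) * (d.g * d.g) + e) = d.coef c r e

def envVars : List Var := [.n, .nn, .k, .nk, .g, .s, .R, .m, .M, .sN, .rN, .three]

theorem Env.congr {n k m M : ℕ} (h : Env d n k m M σ) (hv : ∀ v ∈ envVars, σ'.reg v = σ.reg v)
    (hp : σ'.arr .pos = σ.arr .pos) (hn : σ'.arr .neg = σ.arr .neg) : Env d n k m M σ' where
  n := (hv _ (by decide)).trans h.n
  nn := (hv _ (by decide)).trans h.nn
  k := (hv _ (by decide)).trans h.k
  nk := (hv _ (by decide)).trans h.nk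
  g := (hv _ (by decide)).trans h.g
  s := (hv _ (by decide)).trans h.s
  R := (hv _ (by decide)).trans h.R
  m := (hv _ (by decide)).trans h.m
  M := (hv _ (by decide)).trans h.M
  sN := (hv _ (by decide)).trans h.sN
  rN := (hv _ (by decide)).trans h.rN
  three := (hv _ (by decide)).trans h.three
  coef := by rw [hp, hn]; exact h.coef

theorem Env.frame {n k m M : ℕ} {p : P} (h : Env d n k m M σ) (hF : Frame p σ σ')
    (hw : envVars.all (fun v => !p.writes v) = true) (hp : p.alters .pos = false)
    (hn : p.alters .neg = false) : Env d n k m M σ' :=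
  h.congr (fun v hv => hF.reg v (by simpa using List.all_eq_true.1 hw v hv)) (hF.arr _ hp)
    (hF.arr _ hn)

theorem Env.set {n k m M : ℕ} {v : Var} (x : ℕ) (h : Env d n k m M σ) (hv : v ∉ envVars) :
    Env d n k m M (σ.set v x) :=
  h.congr (fun u hu => by rw [St.set_reg, if_neg (by rintro rfl; exact hv hu)]) rfl rfl

/-- The limits suffice for the evaluation at a point. -/
structure Lim.Fits (L : Lim) (d : MatMul.Decomposition) (n k m M Wm : ℕ) : Prop where
  two_le_M : 2 ≤ M
  M_le : M ≤ L.U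
  k_le_q : k ≤ L.q
  k_le : k ≤ L.U
  m_le : m ≤ L.U
  nn_le : n * n ≤ L.U
  W_le : Wm ≤ L.W
  W_le_U : Wm ≤ L.U
  R_le : d.R ≤ L.U
  rN_le : d.R ^ m ≤ L.rN
  rN_le_U : L.rN ≤ L.U
  three_le : 3 ≤ L.U

theorem ge_mul_self (d : MatMul.Decomposition) : d.g * d.g ≤ d.R := by
  have := d.sq_le
  rwa [pow_two] at this

/-- `prd` collects the pointwise product of the three transforms of one and the same matrix. Its sum
is `D ^ m` times a trace by `sum_transform`; `trace_padded`, `trace_eq` and `sum_pairProd_edgePow`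
then identify this trace. -/
theorem evalProg_spec {n k m M Wm x : ℕ} {ef : ℕ → ℕ} (henv : Env d n k m M σ)
    (hL : L.Fits d n k m M Wm) (hx : σ.reg .point = x) (hefσ : σ.arr .ef = ef) (hn0 : 0 < n)
    (hef : ∀ j < n * n, ef j ≤ Wm)
    (hsymm : ∀ a < n, ∀ b < n, ef (a * n + b) = ef (b * n + a)) (hnk : n ^ k ≤ d.g ^ m) :
    Tr L.bounds evalProg σ fun σ' => σ'.reg .y < M ∧ (σ'.reg .y : ZMod M) =
      (d.D : ZMod M) ^ m * ∑ i ∈ (range (n ^ (3 * k))).filter (TupleClique n (3 * k) ef),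
        (x : ZMod M) ^ tupleWeight n (3 * k) ef i := by
  have hg := d.two_le
  have hgR := ge_mul_self d
  have hgg0 : 0 < d.g * d.g := by positivity
  have hM2 := hL.two_le_M
  have hMU := hL.M_le
  have hrNU : d.R ^ m ≤ L.U := hL.rN_le.trans hL.rN_le_U
  have hsNU : (d.g * d.g) ^ m ≤ L.U := (Nat.pow_le_pow_left hgR m).trans hrNU
  set F : ℕ → ℕ → ZMod M := edgePow n ef (x : ZMod M) with hFdef
  set X : ℕ → ℕ → ZMod M := fun i j =>
    if i < n ^ k ∧ j < n ^ k then pairProd n k F i * crossProd n k F i j else 0 with hX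
  refine Tr.seq (edgeProg_spec henv.nn henv.M hx hefσ hM2 hef hL.W_le hL.W_le_U hL.nn_le hMU) ?_
  intro σ₁ hF1 hpows
  have henv1 := henv.frame hF1 rfl rfl rfl
  have hpF : ∀ a < n, ∀ b < n, (σ₁.arr .pows (a * n + b) : ZMod M) = F a b := fun a ha b hb =>
    hpows _ (by nlinarith)
  refine Tr.seq (R := fun σ' => ∀ r < d.R ^ m, σ'.arr .prd r = 1) ?_ ?_
  · refine Tr.loop (fun i σ' => ∀ r < i, σ'.arr .prd r = 1) _ henv1.rN hrNU (by simp) ?_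
      (fun σ₂ _ h => h)
    intro i hi σ₂ hF2 h2
    simp only [Tr.store_iff, ev_var, ev_const, St.set_reg, if_true, St.put_arr, true_and,
      St.set_arr]
    refine ⟨by change 1 ≤ L.U; omega, fun r hr => ?_⟩
    split_ifs with e
    · rfl
    · exact h2 r (by omega)
  intro σ₂ hF2 hone
  have henv2 := henv1.frame hF2 rfl rfl rfl
  have hp2 : σ₂.arr .pows = σ₁.arr .pows := hF2.arr _ rfl
  refine Tr.seq (R := fun σ' => ∀ r < d.R ^ m, (σ'.arr .prd r : ZMod M) =
    ∏ c ∈ range 3, transform d c m X r) ?_ ?_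
  · refine Tr.loop (fun c σ' => ∀ r < d.R ^ m, (σ'.arr .prd r : ZMod M) =
      ∏ c' ∈ range c, transform d c' m X r) 3 henv2.three hL.three_le
      (fun r hr => by rw [hone r hr]; simp) ?_ (fun σ₃ _ h => h)
    intro c hc σ₃ hF3 h3
    have henv3 : Env d n k m M (σ₃.set .c c) := (henv2.frame hF3 rfl rfl rfl).set c (by decide)
    have hp3 : σ₃.arr .pows = σ₁.arr .pows := by rw [hF3.arr _ rfl, hp2]
    refine Tr.seq (matrixProg_spec henv3.n henv3.k henv3.nk henv3.g henv3.s henv3.m henv3.M henv3.sN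
      (F := F) (by rw [St.set_arr, hp3]; exact hpF) hn0 (by omega) hM2 hMU hL.k_le_q hL.k_le hL.m_le
      hsNU (hgR.trans hL.R_le)) ?_
    intro σ₄ hF4 hvec
    have henv4 := henv3.frame hF4 rfl rfl rfl
    have hc4 : σ₄.reg .c = c := by rw [hF4.reg _ rfl]; simp
    have hprd4 : σ₄.arr .prd = σ₃.arr .prd := hF4.arr .prd rfl
    refine Tr.seq (transformProg_spec (L := L) (co := fun r e => (d.coef c r e : ZMod M))
      (V₀ := fun δ => X (rowOf d.g m δ) (colOf d.g m δ)) henv4.R henv4.s henv4.m hc4 henv4.M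
      henv4.sN (fun r hr e he => by rw [← henv4.coef c hc r hr e he]; push_cast; rfl)
      hvec hM2 hMU hgg0 hgR hL.R_le hL.m_le hL.rN_le hL.rN_le_U) ?_
    intro σ₅ hF5 hvec5
    have henv5 := henv4.frame hF5 rfl rfl rfl
    have hprd5 : σ₅.arr .prd = σ₃.arr .prd := by rw [hF5.arr _ rfl, hprd4]
    refine Tr.loop (fun i σ' => (∀ r < i, (σ'.arr .prd r : ZMod M) =
        ∏ c' ∈ range (c + 1), transform d c' m X r) ∧
        ∀ r, i ≤ r → σ'.arr .prd r = σ₃.arr .prd r) _ henv5.rN hrNU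
      ⟨by simp, fun r _ => by rw [hprd5]⟩ ?_ (fun σ₆ _ h => h.1)
    rintro i hi σ₆ hF6 ⟨k1, k2⟩
    have hM6 : σ₆.reg .M = M := by rw [hF6.reg _ rfl, henv5.M]
    have hv6 : σ₆.arr .vec = σ₅.arr .vec := hF6.arr _ rfl
    simp only [Tr.store_iff, ev_mod, ev_mul, ev_get, ev_var, St.set_reg, St.set_arr, reduceCtorEq,
      if_false, if_true, hM6, hv6, St.put_arr, true_and, k2 i le_rfl]
    refine ⟨(Nat.mod_lt _ (by omega)).le.trans hMU, fun r hr => ?_, fun r hr => ?_⟩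
    · by_cases e : r = i
      · subst e
        rw [if_pos rfl, ZMod.natCast_mod, Nat.cast_mul, h3 r hi, hvec5 r hi, prod_range_succ]
        rfl
      · rw [if_neg e, k1 r (by omega)]
    · rw [if_neg (by omega), k2 r (by omega)]
  intro σ₃ hF3 hprd
  have henv3 := henv2.frame hF3 rfl rfl rfl
  refine Tr.seq_iff.2 ⟨Nat.zero_le _, ?_⟩
  refine Tr.loop (fun i σ' => σ'.reg .y < M ∧ (σ'.reg .y : ZMod M) =
    ∑ r ∈ range i, ∏ c ∈ range 3, transform d c m X r) (d.R ^ m)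
    (by simpa [Pr.run] using henv3.rN) hrNU (by simp [Pr.run, ev_const]; omega) ?_ ?_
  · rintro i hi σ₄ hF4 ⟨k1, k2⟩
    have hM4 : σ₄.reg .M = M := by rw [hF4.reg _ rfl]; simpa [Pr.run] using henv3.M
    have hp4 : σ₄.arr .prd = σ₃.arr .prd := hF4.arr _ rfl
    simp only [Tr.assign_iff, ev_mod, ev_add, ev_get, ev_var, St.set_reg, St.set_arr, reduceCtorEq,
      if_false, if_true, hM4, hp4, ZMod.natCast_mod]
    refine ⟨(Nat.mod_lt _ (by omega)).le.trans hMU, Nat.mod_lt _ (by omega), ?_⟩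
    rw [Nat.cast_add, k2, hprd i hi, sum_range_succ]
  · rintro σ₄ hF4 ⟨k1, k2⟩
    simp only [St.set_reg, reduceCtorEq, if_false]
    refine ⟨k1, ?_⟩
    have hprod : ∀ r, ∏ c ∈ range 3, transform d c m X r =
        transform d 0 m X r * transform d 1 m X r * transform d 2 m X r := fun r => by
      simp [prod_range_succ]
    rw [k2]
    simp only [hprod]
    rw [sum_transform, hX, trace_padded hnk, trace_eq hn0 k F, ← sum_pairProd_edgePow]
    intro a ha b hb
    simp only [hFdef, edgePow, hsymm a ha b hb]

end CliqueAlg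

/-! ### Correctness of the fast algorithm. -/

namespace CliqueAlg

open LoopLang Finset

variable {L : Lim} {σ σ' : St Var Arr} {d : MatMul.Decomposition}

/-- The state holds the parameters of the instance and the coefficients of the decomposition. -/
structure Base (d : MatMul.Decomposition) (n₀ k₀ w₀ : ℕ) (σ : St Var Arr) : Prop where
  n : σ.reg .n = n₀
  nn : σ.reg .nn = n₀ * n₀
  q : σ.reg .q = 3 * k₀
  k : σ.reg .k = k₀
  nk : σ.reg .nk = n₀ ^ k₀
  wm : σ.reg .wm = w₀
  g : σ.reg .g = d.g
  s : σ.reg .s = d.g * d.g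
  R : σ.reg .R = d.R
  d₀ : σ.reg .d₀ = d.D
  three : σ.reg .three = 3
  coef : ∀ c < 3, ∀ r < d.R, ∀ e < d.g * d.g,
    (σ.arr .pos ((c * d.R + r) * (d.g * d.g) + e) : ℤ) -
      σ.arr .neg ((c * d.R + r) * (d.g * d.g) + e) = d.coef c r e

def baseVars : List Var := [.n, .nn, .q, .k, .nk, .wm, .g, .s, .R, .d₀, .three]

theorem Base.congr {n k w : ℕ} (h : Base d n k w σ) (hv : ∀ v ∈ baseVars, σ'.reg v = σ.reg v)
    (hp : σ'.arr .pos = σ.arr .pos) (hn : σ'.arr .neg = σ.arr .neg) : Base d n k w σ' where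
  n := (hv _ (by decide)).trans h.n
  nn := (hv _ (by decide)).trans h.nn
  q := (hv _ (by decide)).trans h.q
  k := (hv _ (by decide)).trans h.k
  nk := (hv _ (by decide)).trans h.nk
  wm := (hv _ (by decide)).trans h.wm
  g := (hv _ (by decide)).trans h.g
  s := (hv _ (by decide)).trans h.s
  R := (hv _ (by decide)).trans h.R
  d₀ := (hv _ (by decide)).trans h.d₀
  three := (hv _ (by decide)).trans h.three
  coef := by rw [hp, hn]; exact h.coef

theorem Base.frame {n k w : ℕ} {p : P} (h : Base d n k w σ) (hF : Frame p σ σ')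
    (hw : baseVars.all (fun v => !p.writes v) = true) (hp : p.alters .pos = false)
    (hn : p.alters .neg = false) : Base d n k w σ' :=
  h.congr (fun v hv => hF.reg v (by simpa using List.all_eq_true.1 hw v hv)) (hF.arr _ hp)
    (hF.arr _ hn)

theorem Base.set {n k w : ℕ} {v : Var} (x : ℕ) (h : Base d n k w σ) (hv : v ∉ baseVars) :
    Base d n k w (σ.set v x) :=
  h.congr (fun u hu => by rw [St.set_reg, if_neg (by rintro rfl; exact hv hu)]) rfl rfl

/-- The degree bound used for instances of the fast algorithm. -/
def degreeBound (d : MatMul.Decomposition) (k w : ℕ) : ℕ := 3 * k * (3 * k) * w + d.D + 1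

/-- The limits suffice for the fast algorithm. -/
structure Lim.FitsFast (L : Lim) (d : MatMul.Decomposition) (n k w : ℕ) : Prop where
  D_le : degreeBound d k w ≤ L.D
  nq_le : n * (3 * k) + 1 ≤ L.nq
  rN_le : d.R ^ levels d.g (n ^ k) ≤ L.rN
  sN_le : (d.g * d.g) ^ levels d.g (n ^ k) ≤ L.sN
  W_le : w ≤ L.W
  q_le : 3 * k ≤ L.q
  q_le_U : L.q ≤ L.U
  nq_le_U : L.nq ≤ L.U
  D_le_U : L.D + 1 ≤ L.U
  W_le_U : L.W ≤ L.U
  rN_le_U : L.rN ≤ L.U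
  R_le_U : d.R ≤ L.U
  nn_le_U : n * n ≤ L.U
  modulus_le : (2 * L.D) ^ L.nq ≤ L.U

theorem levels_le {g n k : ℕ} (hg : 2 ≤ g) : levels g (n ^ k) ≤ n * (3 * k) + 1 := by
  refine Nat.clog_le_of_le_pow ?_
  calc n ^ k ≤ (2 ^ n) ^ k := Nat.pow_le_pow_left Nat.lt_two_pow_self.le _
    _ = 2 ^ (n * k) := (pow_mul _ _ _).symm
    _ ≤ g ^ (n * k) := Nat.pow_le_pow_left hg _
    _ ≤ g ^ (n * (3 * k) + 1) := Nat.pow_le_pow_right (by omega) (by nlinarith)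

/-- The crude estimate `n ≤ 2 ^ n` gives an exponent that works for every prime and needs no
logarithm, yet stays polynomial in the input size when `q ≤ n`. -/
theorem pow_lt_modulus {n q p : ℕ} (hp : 2 ≤ p) : n ^ q < p ^ (n * q + 1) := by
  calc n ^ q ≤ (2 ^ n) ^ q := Nat.pow_le_pow_left Nat.lt_two_pow_self.le _
    _ = 2 ^ (n * q) := (pow_mul _ _ _).symm
    _ < 2 ^ (n * q + 1) := Nat.pow_lt_pow_right (by omega) (by omega)
    _ ≤ p ^ (n * q + 1) := Nat.pow_le_pow_left hp _

theorem fastProg_spec {n k w : ℕ} {ef : ℕ → ℕ} (hb : Base d n k w σ) (hL : L.FitsFast d n k w)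
    (hefσ : σ.arr .ef = ef) (hn0 : 0 < n) (hef : ∀ a < n, ∀ b < n, ef (a * n + b) ≤ w)
    (hsymm : ∀ a < n, ∀ b < n, ef (a * n + b) = ef (b * n + a)) :
    Tr L.bounds fastProg σ fun σ' => σ'.reg .val = optVal n (3 * k) ef := by
  have hg := d.two_le
  have hgR := ge_mul_self d
  have hgg : d.g ≤ d.g * d.g := Nat.le_mul_self _
  set m := levels d.g (n ^ k) with hm
  have hmle : m ≤ n * (3 * k) + 1 := levels_le hg
  have hDL := hL.D_le
  have hDU := hL.D_le_U
  have hnqL := hL.nq_le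
  have hnqU := hL.nq_le_U
  set D := degreeBound d k w with hD
  have hD1 : 2 ≤ D := by
    have := d.D_pos
    rw [hD, degreeBound]
    omega
  have h2DU : 2 * D ≤ L.U := by
    refine le_trans ?_ hL.modulus_le
    calc 2 * D ≤ 2 * L.D := by omega
      _ ≤ (2 * L.D) ^ L.nq := Nat.le_self_pow (by omega) _
  refine Tr.seq (R := fun σ' => σ'.reg .D = D) ?_ ?_
  · simp only [Tr.assign_iff, ev_add, ev_mul, ev_var, ev_const, hb.q, hb.wm, hb.d₀, St.set_reg,
      if_true]
    exact ⟨hDL, rfl⟩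
  intro σ₁ hF1 hD₁
  have hb1 := hb.frame hF1 rfl rfl rfl
  refine Tr.seq (R := fun σ' => σ'.reg .D₁ = D + 1) ?_ ?_
  · simp only [Tr.assign_iff, ev_add, ev_var, ev_const, hD₁, St.set_reg, if_true, and_true]
    change D + 1 ≤ L.D + 1
    omega
  intro σ₂ hF2 hDs
  have hb2 := hb1.frame hF2 rfl rfl rfl
  have hD2 : σ₂.reg .D = D := by rw [hF2.reg _ rfl, hD₁]
  refine Tr.seq (primeProg_spec hD2 (by omega) hDL h2DU) ?_
  rintro σ₃ hF3 ⟨hp, hDp, hp2⟩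
  have hb3 := hb2.frame hF3 rfl rfl rfl
  set p := σ₃.reg .p with hpdef
  set nq := n * (3 * k) + 1 with hnq
  refine Tr.seq (R := fun σ' => σ'.reg .nq = nq) ?_ ?_
  · simp only [Tr.assign_iff, ev_add, ev_mul, ev_var, ev_const, hb3.n, hb3.q, St.set_reg, if_true]
    exact ⟨hnqL, rfl⟩
  intro σ₄ hF4 hnq4
  have hb4 := hb3.frame hF4 rfl rfl rfl
  have hp4 : σ₄.reg .p = p := hF4.reg _ rfl
  have hMU : ∀ i ≤ nq, p ^ i ≤ L.U := fun i hi => by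
    refine le_trans ?_ hL.modulus_le
    calc p ^ i ≤ p ^ nq := Nat.pow_le_pow_right hp.pos hi
      _ ≤ (2 * L.D) ^ nq := Nat.pow_le_pow_left (by omega) _
      _ ≤ (2 * L.D) ^ L.nq := Nat.pow_le_pow_right (by omega) hnqL
  refine Tr.seq (powProg_spec (by decide) (by decide) (by decide) (by decide) hp4 hnq4
    (hnqL.trans hnqU) hMU) ?_
  intro σ₅ hF5 hM5
  have hb5 := hb4.frame hF5 rfl rfl rfl
  set M := p ^ nq with hM
  have hM2 : 2 ≤ M := by
    rw [hM]
    exact hp.two_le.trans (Nat.le_self_pow (by omega) _)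
  have hrNU : d.R ^ m ≤ L.U := hL.rN_le.trans hL.rN_le_U
  refine Tr.seq (sizeProg_spec hb5.nk hb5.g hb5.s hb5.R (hF5.reg _ rfl |>.trans hnq4) hg hmle hnqL
    (hnqL.trans hnqU) (by nlinarith) (by nlinarith) hL.sN_le hL.rN_le
    ((Nat.pow_le_pow_left (hgg.trans hgR) _).trans hrNU)) ?_
  rintro σ₆ hF6 ⟨hm6, hsN6, hrN6⟩
  have hb6 := hb5.frame hF6 rfl rfl rfl
  have hM6 : σ₆.reg .M = M := by rw [hF6.reg _ rfl, hM5]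
  have hDs6 : σ₆.reg .D₁ = D + 1 := by
    rw [hF6.reg _ rfl, hF5.reg _ rfl, hF4.reg _ rfl, hF3.reg _ rfl, hDs]
  have hD6 : σ₆.reg .D = D := by
    rw [hF6.reg _ rfl, hF5.reg _ rfl, hF4.reg _ rfl, hF3.reg _ rfl, hD2]
  have hef6 : σ₆.arr .ef = ef := by
    rw [hF6.arr _ rfl, hF5.arr _ rfl, hF4.arr _ rfl, hF3.arr _ rfl, hF2.arr _ rfl, hF1.arr _ rfl,
      hefσ]
  have henv : Env d n k m M σ₆ := ⟨hb6.n, hb6.nn, hb6.k, hb6.nk, hb6.g, hb6.s, hb6.R, hm6, hM6,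
    hsN6, hrN6, hb6.three, hb6.coef⟩
  have hfits : L.Fits d n k m M w := by
    have hqL := hL.q_le
    have hqU := hL.q_le_U
    exact ⟨hM2, hMU _ le_rfl, by omega, by omega, by omega, hL.nn_le_U, hL.W_le,
      hL.W_le.trans hL.W_le_U, hL.R_le_U, hL.rN_le, hL.rN_le_U, by omega⟩
  set f : ZMod M → ZMod M := fun x => (d.D : ZMod M) ^ m *
    ∑ i ∈ (range (n ^ (3 * k))).filter (TupleClique n (3 * k) ef),
      x ^ tupleWeight n (3 * k) ef i with hf
  refine Tr.seq (R := fun σ' => ∀ x ≤ D, σ'.arr .ys x < M ∧ (σ'.arr .ys x : ZMod M) = f x) ?_ ?_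
  · refine Tr.loop (fun i σ' => ∀ x < i, σ'.arr .ys x < M ∧ (σ'.arr .ys x : ZMod M) = f x) (D + 1)
      hDs6 (by change D + 1 ≤ L.U; omega) (by simp) ?_ (fun σ₇ _ h x hx => h x (by omega))
    intro i hi σ₇ hF7 h7
    have henv7 : Env d n k m M (σ₇.set .point i) := (henv.frame hF7 rfl rfl rfl).set i (by decide)
    refine Tr.seq (evalProg_spec henv7 hfits (by simp; rfl) (by rw [St.set_arr, hF7.arr _ rfl, hef6])
      hn0 (fun j hj => ?_) hsymm (Nat.le_pow_clog (by omega) _)) ?_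
    · have := hef (j / n) (Nat.div_lt_of_lt_mul hj) (j % n) (Nat.mod_lt _ hn0)
      rwa [Nat.div_add_mod'] at this
    rintro σ₈ hF8 ⟨hy, hyf⟩
    have hpt : σ₈.reg .point = i := by rw [hF8.reg _ rfl]; simp
    have hys : σ₈.arr .ys = σ₇.arr .ys := hF8.arr .ys rfl
    simp only [Tr.store_iff, ev_var, hpt, St.put_arr, true_and, hys]
    refine ⟨hy.le.trans (hMU _ le_rfl), fun x hx => ?_⟩
    by_cases e : x = i
    · subst e
      rw [if_pos rfl]
      exact ⟨hy, hyf⟩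
    · rw [if_neg e]
      exact h7 x (by omega)
  intro σ₇ hF7 hys
  refine (differenceProg_spec ((hF7.reg _ rfl).trans hD6) ((hF7.reg _ rfl).trans hDs6)
    ((hF7.reg _ rfl).trans hM6) hys hM2 (hMU _ le_rfl) (by omega)).imp fun σ₈ _ hval => ?_
  refine sup_eq_of_differences hp hDp d.D_pos ?_ _ _ (fun i _ => ?_) ?_ hval
  · rw [hD, degreeBound] at hDp
    omega
  · have := tupleWeight_le (q := 3 * k) hn0 hef i
    rw [hD, degreeBound]
    omega
  · refine (card_filter_le _ _).trans_lt ?_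
    rw [card_range]
    exact pow_lt_modulus hp.two_le

end CliqueAlg

/-! ### The optimum inside a vertex set, and the search for a clique by deletions. -/

namespace CliqueAlg

open LoopLang Finset WeightedClique

variable {L : Lim} {σ σ' : St Var Arr} {d : MatMul.Decomposition}

/-- The limits suffice for solving the instance. -/
structure Lim.FitsOpt (L : Lim) (d : MatMul.Decomposition) (n k w : ℕ) : Prop where
  k_le : k ≤ L.k
  q_le : 3 * k ≤ L.q
  q_le_U : L.q ≤ L.U
  n_le_U : n + 1 ≤ L.U
  nk_le_U : n ^ k ≤ L.U
  w_le_U : w ≤ L.U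
  val_le_U : 3 * k * (3 * k) * w + 1 ≤ L.U
  brute : n ^ k < w → n ^ (3 * k) ≤ L.N ∧ L.N ≤ L.U
  fast : w ≤ n ^ k → L.FitsFast d n k w

theorem optVal_le {n q w : ℕ} {ef : ℕ → ℕ} (hn : 0 < n)
    (hef : ∀ a < n, ∀ b < n, ef (a * n + b) ≤ w) : optVal n q ef ≤ q * q * w + 1 :=
  Finset.sup_le fun x _ => Nat.add_le_add_right (tupleWeight_le hn hef x) 1

theorem optProg_spec {n k wm : ℕ} {G : SimpleGraph (Fin n)} {w : Sym2 (Fin n) → ℕ}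
    {U : Finset (Fin n)} (hb : Base d n k wm σ) (hL : L.FitsOpt d n k wm) (hn0 : 0 < n)
    (hadj : IsEdgeArray G w univ (σ.arr .adj))
    (hle : ∀ a < n, ∀ b < n, σ.arr .adj (a * n + b) ≤ wm)
    (hal : ∀ a : Fin n, σ.arr .al a = if a ∈ U then 1 else 0) :
    Tr L.bounds optProg σ fun σ' => σ'.reg .val = cliqueOpt G w (3 * k) U ∧ σ'.reg .val ≤ L.U := by
  have hnU := hL.n_le_U
  have hal1 : ∀ a < n, σ.arr .al a ≤ 1 := fun a ha => by
    rw [hal ⟨a, ha⟩]; split_ifs <;> omega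
  have hmul : ∀ a < n, ∀ b < n,
      σ.arr .adj (a * n + b) * (σ.arr .al a * σ.arr .al b) ≤ wm := fun a ha b hb => by
    calc _ ≤ wm * (1 * 1) := Nat.mul_le_mul (hle a ha b hb)
          (Nat.mul_le_mul (hal1 a ha) (hal1 b hb))
      _ = wm := by ring
  refine Tr.seq (R := fun σ' => ∀ a < n, ∀ b < n, σ'.arr .ef (a * n + b) =
    σ.arr .adj (a * n + b) * (σ.arr .al a * σ.arr .al b)) ?_ ?_
  · refine Tr.loop (fun i σ' => ∀ a < i, ∀ b < n, σ'.arr .ef (a * n + b) =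
      σ.arr .adj (a * n + b) * (σ.arr .al a * σ.arr .al b)) n hb.n (by change n ≤ L.U; omega)
      (by simp) ?_ (fun σ₁ _ h => h)
    intro i hi σ₁ hF1 h1
    refine Tr.loop (fun j σ' => (∀ a < i, ∀ b < n, σ'.arr .ef (a * n + b) =
        σ.arr .adj (a * n + b) * (σ.arr .al a * σ.arr .al b)) ∧
      ∀ b < j, σ'.arr .ef (i * n + b) =
        σ.arr .adj (i * n + b) * (σ.arr .al i * σ.arr .al b)) n
      (by simpa [hF1.reg Var.n rfl] using hb.n) (by change n ≤ L.U; omega) ⟨h1, by simp⟩ ?_ ?_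
    · rintro j hj σ₂ hF2 ⟨h2, h3⟩
      have hn2 : σ₂.reg .n = n := by
        rw [hF2.reg _ rfl]; simpa [hF1.reg Var.n rfl] using hb.n
      have ha2 : σ₂.reg .a = i := by rw [hF2.reg _ rfl]; simp
      have hadj2 : σ₂.arr .adj = σ.arr .adj := by rw [hF2.arr _ rfl, St.set_arr, hF1.arr _ rfl]
      have hal2 : σ₂.arr .al = σ.arr .al := by rw [hF2.arr _ rfl, St.set_arr, hF1.arr _ rfl]
      simp only [Tr.store_iff, ev_add, ev_mul, ev_var, ev_get, St.set_reg, St.set_arr,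
        reduceCtorEq, if_false, if_true, hn2, ha2, hadj2, hal2, St.put_arr, true_and]
      refine ⟨(hmul i hi j hj).trans hL.w_le_U, fun a ha b hb => ?_, fun b hb => ?_⟩
      · rw [if_neg, h2 a ha b hb]
        intro e
        have := (index_inj hb hj e).1
        omega
      · by_cases e : b = j
        · rw [e, if_pos rfl]
        · rw [if_neg (by omega), h3 b (by omega)]
    · rintro σ₂ hF2 ⟨h2, h3⟩ a ha b hb
      by_cases e : a = i
      · rw [e]; exact h3 b hb
      · exact h2 a (by omega) b hb
  intro σ₁ hF1 hef
  have hb1 := hb.frame hF1 rfl rfl rfl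
  have hefle : ∀ a < n, ∀ b < n, σ₁.arr .ef (a * n + b) ≤ wm := fun a ha b hb => by
    rw [hef a ha b hb]; exact hmul a ha b hb
  have hedge : IsEdgeArray G w U (σ₁.arr .ef) := fun a b => by
    have h := hadj a b
    simp only [mem_univ, and_true] at h
    rw [hef a a.2 b b.2, hal, hal]
    refine ⟨fun ⟨h1, h2, h3⟩ => by simp [h.1 h1, h2, h3], fun hn => ?_⟩
    by_cases h1 : G.Adj a b
    · by_cases h2 : a ∈ U
      · have h3 : b ∉ U := fun h3 => hn ⟨h1, h2, h3⟩
        simp [h3]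
      · simp [h2]
    · simp [h.2 h1]
  have hval := optVal_eq_cliqueOpt (q := 3 * k) (by omega) hedge
  have key : ∀ σ' : St Var Arr, σ'.reg .val = optVal n (3 * k) (σ₁.arr .ef) →
      σ'.reg .val = cliqueOpt G w (3 * k) U ∧ σ'.reg .val ≤ L.U := fun σ' h =>
    ⟨h.trans hval, by rw [h]; exact (optVal_le hn0 hefle).trans hL.val_le_U⟩
  refine Tr.ite (fun h => ?_) (fun h => ?_)
  · simp only [ev_sub, ev_var, hb1.wm, hb1.nk] at h
    obtain ⟨h1, h2⟩ := hL.brute (by omega)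
    exact (bruteProg_spec hb1.n hb1.q hn0 hefle hL.val_le_U hL.w_le_U hL.q_le
      (hL.q_le.trans hL.q_le_U) h1 (h1.trans h2)).imp fun σ' _ h => key σ' h
  · simp only [ev_sub, ev_var, hb1.wm, hb1.nk] at h
    refine (fastProg_spec hb1 (hL.fast (by omega)) rfl hn0 hefle fun a ha b hb => ?_).imp
      fun σ' _ h => key σ' h
    have h1 := hedge ⟨a, ha⟩ ⟨b, hb⟩
    have h2 := hedge ⟨b, hb⟩ ⟨a, ha⟩
    by_cases hc : G.Adj ⟨a, ha⟩ ⟨b, hb⟩ ∧ (⟨a, ha⟩ : Fin n) ∈ U ∧ (⟨b, hb⟩ : Fin n) ∈ U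
    · rw [h1.1 hc, h2.1 ⟨hc.1.symm, hc.2.2, hc.2.1⟩, Sym2.eq_swap]
    · rw [h1.2 hc, h2.2 fun h => hc ⟨h.1.symm, h.2.2, h.2.1⟩]

theorem mem_greedy {n q : ℕ} {G : SimpleGraph (Fin n)} {w : Sym2 (Fin n) → ℕ} {a : Fin n} {v : ℕ}
    (h : v ≤ a) : a ∈ greedy G w q v := by
  induction v with
  | zero => simp [greedy]
  | succ v ih =>
    rw [greedy]
    split_ifs
    · rw [mem_filter]
      exact ⟨ih (by omega), by omega⟩
    · exact ih (by omega)

open Classical in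
/-- The answer of the greedy algorithm. -/
noncomputable def greedyAnswer {n : ℕ} (G : SimpleGraph (Fin n)) (w : Sym2 (Fin n) → ℕ) (q : ℕ) :
    Option (Finset (Fin n)) :=
  if cliqueOpt G w q univ = 0 then none else some (greedy G w q n)

/-- The answer is in the output array. -/
def Answers {n : ℕ} (ans : Option (Finset (Fin n))) (σ : St Var Arr) : Prop :=
  σ.reg .len = (encodeAnswer ans).length ∧
    ∀ (i : ℕ) (h : i < (encodeAnswer ans).length), σ.arr .out i = (encodeAnswer ans)[i]

theorem answers_none {n : ℕ} (hU : 1 ≤ L.U) :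
    Tr L.bounds (.store .out (cn 0) (cn 0);; .assign .len (cn 1)) σ
      (Answers (none : Option (Finset (Fin n)))) := by
  refine Tr.seq_iff.2 ⟨Nat.zero_le _, hU, rfl, fun i hi => ?_⟩
  have : i = 0 := by simpa [encodeAnswer] using hi
  subst this
  simp [encodeAnswer, Pr.run, ev_const]

/-- `hb` speaks of the state with `q`, `k` and `nk` already filled in, which the program does first.
-/
theorem solveProg_spec {n k wm : ℕ} {G : SimpleGraph (Fin n)} {w : Sym2 (Fin n) → ℕ}
    (hq : σ.reg .q₀ = 3 * k)
    (hb : Base d n k wm (((σ.set .q (3 * k)).set .k k).set .nk (n ^ k)))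
    (hL : L.FitsOpt d n k wm) (hn0 : 0 < n) (hadj : IsEdgeArray G w univ (σ.arr .adj))
    (hle : ∀ a < n, ∀ b < n, σ.arr .adj (a * n + b) ≤ wm) :
    Tr L.bounds solveProg σ (Answers (greedyAnswer G w (3 * k))) := by
  have hnU := hL.n_le_U
  have hqL := hL.q_le
  have hqU := hL.q_le_U
  have hn : σ.reg .n = n := by simpa using hb.n
  refine Tr.seq (R := fun σ' => σ'.reg .q = 3 * k) ?_ ?_
  · simp only [Tr.assign_iff, ev_var, hq, St.set_reg, if_true, and_true]
    exact hqL
  intro σ₁ hF1 hq1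
  refine Tr.seq (R := fun σ' => σ'.reg .k = k) ?_ ?_
  · simp only [Tr.assign_iff, ev_div, ev_var, ev_const, hq1, St.set_reg, if_true,
      Nat.mul_div_cancel_left k (show 0 < 3 by omega), and_true]
    exact hL.k_le
  intro σ₂ hF2 hk2
  have hn2 : σ₂.reg .n = n := by rw [hF2.reg _ rfl, hF1.reg _ rfl, hn]
  refine Tr.seq (powProg_spec (by decide) (by decide) (by decide) (by decide) hn2 hk2 (by omega)
    fun i hi => (Nat.pow_le_pow_right hn0 hi).trans hL.nk_le_U) ?_
  intro σ₃ hF3 hnk3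
  have hb3 : Base d n k wm σ₃ := by
    refine hb.congr (fun v hv => ?_) ?_ ?_
    · have hk3 : σ₃.reg .k = k := (hF3.reg _ rfl).trans hk2
      have hq3 : σ₃.reg .q = 3 * k := by rw [hF3.reg _ rfl, hF2.reg _ rfl, hq1]
      simp only [St.set_reg]
      split_ifs with h1 h2 h3
      · rw [h1, hnk3]
      · rw [h2, hk3]
      · rw [h3, hq3]
      · have h4 : v ≠ .i := by rintro rfl; revert hv; decide
        rw [hF3.reg v (by simp [powProg, Pr.writes, h1, h4]), hF2.reg v (by simp [Pr.writes, h2]),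
          hF1.reg v (by simp [Pr.writes, h3])]
    · rw [hF3.arr _ rfl, hF2.arr _ rfl, hF1.arr _ rfl]; rfl
    · rw [hF3.arr _ rfl, hF2.arr _ rfl, hF1.arr _ rfl]; rfl
  have hadj3 : σ₃.arr .adj = σ.arr .adj := by rw [hF3.arr _ rfl, hF2.arr _ rfl, hF1.arr _ rfl]
  refine Tr.seq (R := fun σ' => ∀ a < n, σ'.arr .al a = 1) ?_ ?_
  · refine Tr.loop (fun i σ' => ∀ a < i, σ'.arr .al a = 1) n hb3.n (by change n ≤ L.U; omega)
      (by simp) ?_ (fun σ₄ _ h => h)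
    intro i hi σ₄ _ h
    simp only [Tr.store_iff, ev_var, ev_const, St.set_reg, if_true, St.put_arr, true_and,
      St.set_arr]
    refine ⟨by change 1 ≤ L.U; omega, fun r hr => ?_⟩
    split_ifs with e
    · rfl
    · exact h r (by omega)
  intro σ₄ hF4 hal4
  have hb4 := hb3.frame hF4 rfl rfl rfl
  have hadj4 : σ₄.arr .adj = σ.arr .adj := (hF4.arr _ rfl).trans hadj3
  refine Tr.seq (optProg_spec (U := univ) hb4 hL hn0 (by rw [hadj4]; exact hadj)
    (by rw [hadj4]; exact hle) (fun a => by simp [hal4 a a.2])) ?_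
  rintro σ₅ hF5 ⟨hv5, hvU⟩
  have hb5 := hb4.frame hF5 rfl rfl rfl
  have hadj5 : σ₅.arr .adj = σ.arr .adj := (hF5.arr _ rfl).trans hadj4
  have hal5 : σ₅.arr .al = σ₄.arr .al := hF5.arr _ rfl
  refine Tr.seq (R := fun σ' => σ'.reg .best = cliqueOpt G w (3 * k) univ) ?_ ?_
  · simp only [Tr.assign_iff, ev_var, St.set_reg, if_true]
    exact ⟨hvU, hv5⟩
  intro σ₆ hF6 hbest
  have hb6 := hb5.frame hF6 rfl rfl rfl
  have hadj6 : σ₆.arr .adj = σ.arr .adj := (hF6.arr _ rfl).trans hadj5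
  have hal6 : σ₆.arr .al = σ₄.arr .al := (hF6.arr _ rfl).trans hal5
  refine Tr.ite (fun h0 => ?_) (fun h0 => ?_)
  swap
  · simp only [ev_var, hbest] at h0
    rw [greedyAnswer, if_pos h0]
    exact answers_none (by omega)
  simp only [ev_var, hbest] at h0
  rw [greedyAnswer, if_neg h0]
  refine Tr.seq (R := fun σ' => ∀ a : Fin n, σ'.arr .al a =
    if a ∈ greedy G w (3 * k) n then 1 else 0) ?_ ?_
  · refine Tr.loop (fun v σ' => ∀ a : Fin n, σ'.arr .al a =
      if a ∈ greedy G w (3 * k) v then 1 else 0) n hb6.n (by change n ≤ L.U; omega)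
      (fun a => by rw [hal6, hal4 a a.2, if_pos (mem_greedy (Nat.zero_le _))]) ?_ (fun σ₇ _ h => h)
    intro v hv σ₇ hF7 h7
    have hb7 := hb6.frame hF7 rfl rfl rfl
    have hadj7 : σ₇.arr .adj = σ.arr .adj := (hF7.arr _ rfl).trans hadj6
    have hbest7 : σ₇.reg .best = cliqueOpt G w (3 * k) univ := (hF7.reg _ rfl).trans hbest
    set X := (greedy G w (3 * k) v).filter fun a : Fin n => (a : ℕ) ≠ v with hX
    refine Tr.seq (R := fun σ' => ∀ a : Fin n, σ'.arr .al a = if a ∈ X then 1 else 0) ?_ ?_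
    · simp only [Tr.store_iff, ev_var, ev_const, St.set_reg, if_true, St.put_arr, true_and,
        St.set_arr]
      refine ⟨Nat.zero_le _, fun a => ?_⟩
      by_cases e : (a : ℕ) = v
      · simp [hX, e]
      · simp [hX, e, h7 a]
    intro σ₈ hF8 hal8
    have hb8 : Base d n k wm σ₈ := (hb7.set v (by decide)).frame hF8 rfl rfl rfl
    have hadj8 : σ₈.arr .adj = σ.arr .adj := (hF8.arr _ rfl).trans hadj7
    refine Tr.seq (optProg_spec (U := X) hb8 hL hn0 (by rw [hadj8]; exact hadj)
      (by rw [hadj8]; exact hle) hal8) ?_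
    rintro σ₉ hF9 ⟨hv9, -⟩
    have hbest9 : σ₉.reg .best = cliqueOpt G w (3 * k) univ := by
      rw [hF9.reg _ rfl, hF8.reg _ rfl, St.set_reg, if_neg (by decide), hbest7]
    have hal9 : σ₉.arr .al = σ₈.arr .al := hF9.arr _ rfl
    have hvv : σ₉.reg .v = v := by rw [hF9.reg _ rfl, hF8.reg _ rfl]; simp
    have hmono : cliqueOpt G w (3 * k) X ≤ cliqueOpt G w (3 * k) univ :=
      cliqueOpt_mono (subset_univ _)
    refine Tr.ite (fun h => ?_) (fun h => ?_)
    · simp only [ev_sub, ev_var, hbest9, hv9] at h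
      have hne : ¬ cliqueOpt G w (3 * k) X = cliqueOpt G w (3 * k) univ := by omega
      simp only [Tr.store_iff, ev_var, ev_const, St.put_arr, true_and, hvv, hal9]
      refine ⟨by change 1 ≤ L.U; omega, fun a => ?_⟩
      -- The optimum has dropped, so the vertex `v` is restored. It belongs to `greedy G w (3 * k)
      -- v` because no vertex from `v` on has been processed yet.
      have hg : greedy G w (3 * k) (v + 1) = greedy G w (3 * k) v := by
        rw [greedy, if_neg hne]
      rw [hg]
      by_cases e : (a : ℕ) = v
      · rw [if_pos e, if_pos (mem_greedy e.ge)]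
      · rw [if_neg e, hal8, hX]
        simp [e]
    · simp only [ev_sub, ev_var, hbest9, hv9] at h
      have heq : cliqueOpt G w (3 * k) X = cliqueOpt G w (3 * k) univ := by omega
      simp only [Tr.skip_iff, hal9]
      intro a
      have hg : greedy G w (3 * k) (v + 1) = X := by
        rw [greedy, if_pos heq]
      rw [hg, hal8]
  intro σ₇ hF7 hal7
  have hn7 : σ₇.reg .n = n := (hb6.frame hF7 rfl rfl rfl).n
  refine Tr.seq (R := fun σ' => σ'.arr .out 0 = 1) ?_ ?_
  · simp only [Tr.store_iff, ev_const, St.put_arr, if_true, and_true]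
    change 1 ≤ L.U
    omega
  intro σ₈ hF8 hout8
  have hal8 : σ₈.arr .al = σ₇.arr .al := hF8.arr _ rfl
  refine Tr.seq (R := fun σ' => σ'.arr .out 0 = 1 ∧ ∀ a < n, σ'.arr .out (a + 1) = σ₇.arr .al a)
    ?_ ?_
  · refine Tr.loop (fun i σ' => σ'.arr .out 0 = 1 ∧ ∀ a < i, σ'.arr .out (a + 1) = σ₇.arr .al a) n
      ((hF8.reg _ rfl).trans hn7) (by change n ≤ L.U; omega) ⟨hout8, by simp⟩ ?_ (fun σ₉ _ h => h)
    rintro i hi σ₉ hF9 ⟨k1, k2⟩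
    have hal9 : σ₉.arr .al = σ₇.arr .al := (hF9.arr _ rfl).trans hal8
    simp only [Tr.store_iff, ev_add, ev_var, ev_const, ev_get, St.set_reg, if_true, St.put_arr,
      true_and, St.set_arr, hal9]
    refine ⟨?_, by rw [if_neg (by omega), k1], fun r hr => ?_⟩
    · rw [hal7 ⟨i, hi⟩]
      change _ ≤ L.U
      split_ifs <;> omega
    · by_cases e : r = i
      · simp [e]
      · rw [if_neg (by omega), k2 r (by omega)]
  rintro σ₉ hF9 ⟨k1, k2⟩
  have hn9 : σ₉.reg .n = n := by rw [hF9.reg _ rfl, hF8.reg _ rfl, hn7]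
  simp only [Tr.assign_iff, ev_add, ev_var, ev_const, hn9]
  refine ⟨hnU, by simp [encodeAnswer], fun i hi => ?_⟩
  rw [St.set_arr]
  simp only [encodeAnswer, List.length_cons, List.length_ofFn] at hi
  cases i with
  | zero => simpa [encodeAnswer] using k1
  | succ i =>
    rw [k2 i (by omega), hal7 ⟨i, by omega⟩]
    simp [encodeAnswer]

end CliqueAlg

/-! ### Preparation of the instance, and correctness of the whole program. -/

namespace CliqueAlg

open LoopLang Finset WeightedClique

variable {L : Lim} {σ σ' : St Var Arr} {d : MatMul.Decomposition}

theorem storeList_writes (f : ℕ → ℤ) (N : ℕ) (v : Var) : (storeList f N).writes v = false := by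
  induction N with
  | zero => rfl
  | succ N ih => simp [storeList, Pr.writes, ih]

theorem storeList_alters (f : ℕ → ℤ) (N : ℕ) {a : Arr} (hp : a ≠ .pos) (hn : a ≠ .neg) :
    (storeList f N).alters a = false := by
  induction N with
  | zero => rfl
  | succ N ih => simp [storeList, Pr.alters, ih, hp, hn]

theorem storeList_spec {f : ℕ → ℤ} {N : ℕ} (hU : ∀ x < N, (f x).natAbs ≤ L.U) :
    Tr L.bounds (storeList f N) σ fun σ' =>
      ∀ x < N, (σ'.arr .pos x : ℤ) - σ'.arr .neg x = f x := by
  induction N with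
  | zero => simp [storeList]
  | succ N ih =>
    refine Tr.seq (ih fun x hx => hU x (by omega)) ?_
    intro σ₁ _ h
    have hN := hU N (by omega)
    simp only [Tr.seq_iff, Tr.store_iff, ev_const, St.put_arr, reduceCtorEq, false_and, if_false,
      true_and]
    refine ⟨by change _ ≤ L.U; omega, by change _ ≤ L.U; omega, fun x hx => ?_⟩
    by_cases e : x = N
    · subst e
      simp
    · simp only [e, if_false]
      exact h x (by omega)

theorem coefList_eq (d : MatMul.Decomposition) {c r e : ℕ} (hr : r < d.R) (he : e < d.g * d.g) :
    coefList d ((c * d.R + r) * (d.g * d.g) + e) = d.coef c r e := by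
  have h1 : ((c * d.R + r) * (d.g * d.g) + e) / (d.g * d.g) = c * d.R + r := by
    rw [mul_comm, Nat.mul_add_div (by omega), Nat.div_eq_of_lt he, add_zero]
  have h2 : (c * d.R + r) / d.R = c := by
    rw [mul_comm, Nat.mul_add_div (by omega), Nat.div_eq_of_lt hr, add_zero]
  rw [coefList, h1, h2, Nat.mul_add_mod', Nat.mod_eq_of_lt hr, Nat.mul_add_mod', Nat.mod_eq_of_lt he]

/-- A bound for the constants in the program of a decomposition. -/
def coefBound (d : MatMul.Decomposition) : ℕ :=
  d.R + d.D + ∑ x ∈ range (3 * d.R * (d.g * d.g)), (coefList d x).natAbs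

def maxEntry (n : ℕ) (ef : ℕ → ℕ) : ℕ := (range (n * n)).sup ef

/-- The limits suffice for preparing the instance. -/
structure Lim.FitsSetup (L : Lim) (d : MatMul.Decomposition) (n q w : ℕ) : Prop where
  n_le : n ≤ L.n
  R_le : d.R ≤ L.R
  s_le : d.g * d.g ≤ L.s
  coef_le_U : coefBound d ≤ L.U
  nn_le_U : n * n ≤ L.U
  q_le_U : q ≤ L.U
  w_le_U : w ≤ L.U

theorem setupProg_spec {n k : ℕ} {obj : Objective} {G : SimpleGraph (Fin n)}
    {w : Sym2 (Fin n) → ℕ} {ef : ℕ → ℕ} (hn : σ.arr .inp 0 = n) (hq : σ.arr .inp 1 = 3 * k)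
    (hinp : ∀ j, σ.arr .inp (j + 2) = ef j) (hef : IsEdgeArray G w univ ef)
    (hL : L.FitsSetup d n (3 * k) (maxEntry n ef)) :
    Tr L.bounds (setupProg d obj) σ fun σ' => σ'.reg .n = n ∧ σ'.reg .q₀ = 3 * k ∧
      Base d n k (maxEntry n ef) (((σ'.set .q (3 * k)).set .k k).set .nk (n ^ k)) ∧
      IsEdgeArray G (workWeight obj (maxEntry n ef - 1) w) univ (σ'.arr .adj) ∧
      ∀ a < n, ∀ b < n, σ'.arr .adj (a * n + b) ≤ maxEntry n ef := by
  set wm := maxEntry n ef with hwm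
  have hwU := hL.w_le_U
  have hcU := hL.coef_le_U
  have hRU : d.R + d.D ≤ L.U := by
    rw [coefBound] at hcU
    omega
  have hgR := ge_mul_self d
  have hgg : d.g ≤ d.g * d.g := Nat.le_mul_self _
  have hle : ∀ j < n * n, ef j ≤ wm := fun j hj => Finset.le_sup (f := ef) (mem_range.2 hj)
  have hidx : ∀ a < n, ∀ b < n, a * n + b < n * n := fun a ha b hb => by nlinarith
  -- The assignments of constants are split off, so that the loops are verified from an arbitrary
  -- state with the right register contents.
  suffices H : ∀ τ : St Var Arr, τ.reg .n = n → τ.reg .q₀ = 3 * k → τ.reg .nn = n * n →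
      τ.reg .g = d.g → τ.reg .R = d.R → τ.reg .s = d.g * d.g → τ.reg .d₀ = d.D →
      τ.reg .three = 3 → τ.arr .inp = σ.arr .inp →
      Tr L.bounds (storeList (coefList d) (3 * d.R * (d.g * d.g));; .assign .wm (cn 0);;
        .loop .i .nn (.ite (ar .inp (rg .i + cn 2) - rg .wm)
          (.assign .wm (ar .inp (rg .i + cn 2))) .skip);;
        .loop .i .nn (adjEntry obj)) τ fun σ' => σ'.reg .n = n ∧ σ'.reg .q₀ = 3 * k ∧
          Base d n k (maxEntry n ef) (((σ'.set .q (3 * k)).set .k k).set .nk (n ^ k)) ∧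
          IsEdgeArray G (workWeight obj (maxEntry n ef - 1) w) univ (σ'.arr .adj) ∧
          ∀ a < n, ∀ b < n, σ'.arr .adj (a * n + b) ≤ maxEntry n ef by
    unfold setupProg
    simp only [Tr.seq_iff (p := Pr.assign _ _), Tr.assign_iff, ev_get, ev_const, ev_var, ev_mul,
      St.set_reg, St.set_arr, reduceCtorEq, if_false, if_true, hn, hq]
    refine ⟨hL.n_le, hL.q_le_U, Nat.mul_le_mul hL.n_le hL.n_le, ?_, hL.R_le, hL.s_le, ?_, le_rfl,
      H _ ?_ ?_ ?_ ?_ ?_ ?_ ?_ ?_ ?_⟩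
    · change d.g ≤ L.U; omega
    · change d.D ≤ L.U; omega
    all_goals simp
  intro τ h1 h2 h3 h4 h5 h6 h7 h8 h9
  refine Tr.seq (storeList_spec fun x hx => ?_) ?_
  · have := single_le_sum (f := fun x => (coefList d x).natAbs) (fun _ _ => Nat.zero_le _)
      (mem_range.2 hx)
    rw [coefBound] at hcU
    omega
  intro τ₁ hF1 hcoef
  have hr1 : ∀ v, τ₁.reg v = τ.reg v := fun v => hF1.reg v (storeList_writes _ _ _)
  have hinp1 : τ₁.arr .inp = σ.arr .inp := by
    rw [hF1.arr _ (storeList_alters _ _ (by decide) (by decide)), h9]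
  refine Tr.seq (R := fun σ' => σ'.reg .wm = 0) ⟨Nat.zero_le _, by simp [Pr.run, ev_const]⟩ ?_
  intro τ₂ hF2 hw2
  have hnn2 : τ₂.reg .nn = n * n := by rw [hF2.reg _ rfl, hr1, h3]
  have hinp2 : τ₂.arr .inp = σ.arr .inp := by rw [hF2.arr _ rfl, hinp1]
  refine Tr.seq (R := fun σ' => σ'.reg .wm = wm) ?_ ?_
  · refine Tr.loop (fun i σ' => σ'.reg .wm = (range i).sup ef) (n * n) hnn2 hL.nn_le_U
      (by simpa using hw2) ?_ (fun τ₃ _ h => h)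
    intro i hi τ₃ hF3 h
    have hinp3 : τ₃.arr .inp = σ.arr .inp := by rw [hF3.arr _ rfl, hinp2]
    refine Tr.ite (fun h0 => ?_) (fun h0 => ?_)
    · simp only [ev_sub, ev_get, ev_add, ev_var, ev_const, St.set_reg, St.set_arr, reduceCtorEq,
        if_false, if_true, hinp3, hinp, h] at h0
      simp only [Tr.assign_iff, ev_get, ev_add, ev_var, ev_const, St.set_reg, St.set_arr,
        if_true, hinp3, hinp]
      refine ⟨(hle i hi).trans hwU, ?_⟩
      rw [range_add_one, sup_insert]
      exact (sup_eq_left.2 (by omega)).symm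
    · simp only [ev_sub, ev_get, ev_add, ev_var, ev_const, St.set_reg, St.set_arr, reduceCtorEq,
        if_false, if_true, hinp3, hinp, h] at h0
      simp only [Tr.skip_iff, St.set_reg, reduceCtorEq, if_false, h]
      rw [range_add_one, sup_insert]
      exact (sup_eq_right.2 (by omega)).symm
  intro τ₃ hF3 hw3
  have hinp3 : τ₃.arr .inp = σ.arr .inp := by rw [hF3.arr _ rfl, hinp2]
  have hr3 : ∀ v, v ≠ .wm → v ≠ .i → τ₃.reg v = τ.reg v := fun v hv hv' => by
    rw [hF3.reg v (by simp [Pr.writes, hv, hv']), hF2.reg v (by simp [Pr.writes, hv]), hr1]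
  set W := workWeight obj (wm - 1) w with hW
  set ad : ℕ → ℕ := fun j => match obj with
    | .maximize => ef j
    | .minimize => if ef j = 0 then 0 else wm + 1 - ef j with had
  have hadle : ∀ j < n * n, ad j ≤ wm := fun j hj => by
    have := hle j hj
    cases obj
    · exact this
    · simp only [had]
      split_ifs <;> omega
  have hade : ∀ a b : Fin n, (G.Adj a b → ad (a * n + b) = W s(a, b) + 1) ∧
      (¬ G.Adj a b → ad (a * n + b) = 0) := fun a b => by
    have h := hef a b
    have h' := hle _ (hidx a a.2 b b.2)
    simp only [mem_univ, and_true] at h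
    cases obj
    · exact h
    · simp only [had, hW, workWeight]
      refine ⟨fun hab => ?_, fun hab => by simp [h.2 hab]⟩
      rw [h.1 hab] at h' ⊢
      rw [if_neg (by omega)]
      omega
  suffices H : Tr L.bounds (.loop .i .nn (adjEntry obj)) τ₃ fun σ' =>
      ∀ j < n * n, σ'.arr .adj j = ad j by
    refine H.imp fun τ₄ hF4 hadj => ?_
    have hwr : ∀ v, v ≠ .i → τ₄.reg v = τ₃.reg v := fun v hv => hF4.reg v (by
      cases obj <;> simp [adjEntry, Pr.writes, hv])
    have hal : ∀ a, a ≠ .adj → τ₄.arr a = τ₃.arr a := fun a ha => hF4.arr a (by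
      cases obj <;> simp [adjEntry, Pr.alters, ha])
    have hpos : τ₄.arr .pos = τ₁.arr .pos := by
      rw [hal _ (by decide), hF3.arr _ rfl, hF2.arr _ rfl]
    have hneg : τ₄.arr .neg = τ₁.arr .neg := by
      rw [hal _ (by decide), hF3.arr _ rfl, hF2.arr _ rfl]
    have hr : ∀ v, v ≠ .wm → v ≠ .i → τ₄.reg v = τ.reg v := fun v hv hv' =>
      (hwr v hv').trans (hr3 v hv hv')
    refine ⟨by rw [hr _ (by decide) (by decide), h1], by rw [hr _ (by decide) (by decide), h2],
      ?_, ?_, ?_⟩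
    · constructor
      case coef =>
        intro c hc r hr' e he
        simp only [St.set_arr, hpos, hneg]
        rw [hcoef, coefList_eq d hr' he]
        have h1 : c * d.R + r < 3 * d.R := by nlinarith
        nlinarith
      case wm => simpa [hwr] using hw3
      all_goals simp [*]
    · intro a b
      rw [hadj _ (hidx a a.2 b b.2)]
      simpa using hade a b
    · intro a ha b hb
      rw [hadj _ (hidx a ha b hb)]
      exact hadle _ (hidx a ha b hb)
  refine Tr.loop (fun i σ' => ∀ j < i, σ'.arr .adj j = ad j) (n * n)
    (by rw [hr3 _ (by decide) (by decide), h3]) hL.nn_le_U (by simp) ?_ (fun τ₄ _ h => h)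
  intro i hi τ₄ hF4 h
  have hinp4 : τ₄.arr .inp = σ.arr .inp := by
    rw [hF4.arr _ (by cases obj <;> rfl), hinp3]
  have hw4 : τ₄.reg .wm = wm := by
    rw [hF4.reg _ (by cases obj <;> rfl), hw3]
  have key : ∀ e : E, e.ev (τ₄.set .i i) = ad i →
      Tr L.bounds (.store .adj (rg .i) e) (τ₄.set .i i) fun σ' => ∀ j < i + 1,
        σ'.arr .adj j = ad j := fun e he => by
    simp only [Tr.store_iff, he, ev_var, St.set_reg, if_true, St.put_arr, true_and, St.set_arr]
    refine ⟨(hadle i hi).trans hwU, fun j hj => ?_⟩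
    split_ifs with e
    · rw [e]
    · exact h j (by omega)
  cases obj with
  | maximize =>
    refine key _ ?_
    simp [ev_get, ev_add, ev_var, ev_const, hinp4, hinp, had]
  | minimize =>
    refine Tr.ite (fun h0 => key _ ?_) (fun h0 => key _ ?_)
    · simp only [ev_get, ev_add, ev_var, ev_const, St.set_reg, St.set_arr, if_true, hinp4, hinp]
        at h0
      simp [ev_sub, ev_get, ev_add, ev_var, ev_const, hinp4, hinp, had, hw4, h0]
    · simp only [ev_get, ev_add, ev_var, ev_const, St.set_reg, St.set_arr, if_true, hinp4, hinp]
        at h0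
      simp [ev_const, had, h0]

theorem mainProg_spec {n k : ℕ} (obj : Objective) {G : SimpleGraph (Fin n)}
    {w : Sym2 (Fin n) → ℕ} {ef : ℕ → ℕ} (hn : σ.arr .inp 0 = n) (hq : σ.arr .inp 1 = 3 * k)
    (hinp : ∀ j, σ.arr .inp (j + 2) = ef j) (hef : IsEdgeArray G w univ ef) (hn0 : 0 < n)
    (hL : L.FitsSetup d n (3 * k) (maxEntry n ef))
    (hL' : 3 * k ≤ n → L.FitsOpt d n k (maxEntry n ef)) :
    ∃ ans : Option (Finset (Fin n)), IsAnswer G w (3 * k) obj ans ∧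
      Tr L.bounds (mainProg d obj) σ (Answers ans) := by
  have hnn : 1 ≤ L.U := le_trans (by nlinarith) hL.nn_le_U
  by_cases hqn : n < 3 * k
  · refine ⟨none, ?_, Tr.seq (setupProg_spec hn hq hinp hef hL) ?_⟩
    · intro T hT
      have h1 := hT.card_eq
      have h2 := card_le_univ T
      rw [Fintype.card_fin] at h2
      omega
    · rintro σ₁ - ⟨h1, h2, -⟩
      refine Tr.ite (fun _ => answers_none hnn) (fun h => ?_)
      simp only [ev_sub, ev_var, h1, h2] at h
      omega
  · refine ⟨greedyAnswer G (workWeight obj (maxEntry n ef - 1) w) (3 * k), ?_,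
      Tr.seq (setupProg_spec hn hq hinp hef hL) ?_⟩
    · unfold greedyAnswer
      split_ifs with h
      · exact cliqueFree_of_cliqueOpt h
      -- An entry is a weight plus one, so `maxEntry n ef - 1` bounds all weights; in a graph
      -- without edges the condition is void.
      · refine isOptimal_of_workWeight (c := maxEntry n ef - 1) (fun e he => ?_)
          (isOptimal_greedy h)
        induction e using Sym2.ind with
        | _ a b =>
          have h1 := (hef a b).1 ⟨he, mem_univ _, mem_univ _⟩
          have h2 : ef (a * n + b) ≤ maxEntry n ef := Finset.le_sup (f := ef)
            (mem_range.2 (by have := a.2; have := b.2; nlinarith))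
          omega
    · rintro σ₁ - ⟨h1, h2, h3, h4, h5⟩
      refine Tr.ite (fun h => ?_) (fun h => solveProg_spec h2 h3 (hL' (by omega)) hn0 h4 h5)
      simp only [ev_sub, ev_var, h1, h2] at h
      omega

end CliqueAlg

/-! ### Running time of the program -/

namespace CliqueAlg

open LoopLang

/-- A common bound for the limits that are polynomial in the input size. -/
def Lim.z (L : Lim) : ℕ := L.n + L.q + L.k + L.nq + L.R + L.s + 4

/-- Up to a constant, the number of steps of `p` is at most `z ^ e * Y`. -/
def CostLE (p : P) (e : ℕ) (Y : Lim → ℕ) : Prop :=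
  ∃ c, ∀ L : Lim, p.steps L.bounds ≤ c * (L.z ^ e * Y L)

theorem Lim.one_le_z_pow (L : Lim) (e : ℕ) : 1 ≤ L.z ^ e :=
  Nat.one_le_pow _ _ (by unfold Lim.z; omega)

variable {p p' : P} {e e' : ℕ} {Y Y' : Lim → ℕ}

theorem CostLE.mono (h : CostLE p e Y) (he : e ≤ e') (hY : ∀ L, Y L ≤ Y' L) : CostLE p e' Y' := by
  obtain ⟨c, hc⟩ := h
  refine ⟨c, fun L => (hc L).trans (Nat.mul_le_mul_left _ (Nat.mul_le_mul ?_ (hY L)))⟩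
  exact Nat.pow_le_pow_right (by unfold Lim.z; omega) he

theorem CostLE.of_eq_one (hY : ∀ L, 1 ≤ Y L) (h : ∀ β, p.steps β = 1) : CostLE p e Y :=
  ⟨1, fun L => by
    rw [h, one_mul]
    exact Nat.mul_pos (L.one_le_z_pow e) (hY L)⟩

theorem CostLE.skip (hY : ∀ L, 1 ≤ Y L) : CostLE .skip e Y := .of_eq_one hY fun _ => rfl

theorem CostLE.assign {v : Var} {x : E} (hY : ∀ L, 1 ≤ Y L) : CostLE (.assign v x) e Y :=
  .of_eq_one hY fun _ => rfl

theorem CostLE.store {a : Arr} {i x : E} (hY : ∀ L, 1 ≤ Y L) : CostLE (.store a i x) e Y :=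
  .of_eq_one hY fun _ => rfl

theorem CostLE.seq (h : CostLE p e Y) (h' : CostLE p' e Y) : CostLE (p;; p') e Y := by
  obtain ⟨c, hc⟩ := h
  obtain ⟨c', hc'⟩ := h'
  refine ⟨c + c', fun L => ?_⟩
  rw [add_mul]
  exact Nat.add_le_add (hc L) (hc' L)

theorem CostLE.ite {x : E} (hY : ∀ L, 1 ≤ Y L) (h : CostLE p e Y) (h' : CostLE p' e Y) :
    CostLE (.ite x p p') e Y := by
  obtain ⟨c, hc⟩ := h
  obtain ⟨c', hc'⟩ := h'
  refine ⟨c + c' + 1, fun L => ?_⟩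
  have := Nat.mul_pos (L.one_le_z_pow e) (hY L)
  rw [add_mul, add_mul, one_mul]
  exact Nat.add_le_add (Nat.add_le_add (hc L) (hc' L)) this

/-- Used in two ways: a loop whose bound is polynomial in the input size raises the exponent of `z`,
any other loop enlarges `Y`. -/
theorem CostLE.loop {v b : Var} {f : ℕ} (hY : ∀ L, 1 ≤ Y L) (h : CostLE p e Y)
    (hb : ∀ L : Lim, (L.bounds.reg b + 1) * (L.z ^ e * Y L) ≤ L.z ^ f * Y' L) :
    CostLE (.loop v b p) f Y' := by
  obtain ⟨c, hc⟩ := h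
  refine ⟨c + 2, fun L => ?_⟩
  have h1 : 1 ≤ L.z ^ e * Y L := Nat.mul_pos (L.one_le_z_pow e) (hY L)
  calc (Pr.loop v b p).steps L.bounds = L.bounds.reg b * (p.steps L.bounds + 2) + 2 := rfl
    _ ≤ L.bounds.reg b * (c * (L.z ^ e * Y L) + 2) + 2 := by gcongr; exact hc L
    _ ≤ (c + 2) * ((L.bounds.reg b + 1) * (L.z ^ e * Y L)) := by nlinarith
    _ ≤ (c + 2) * (L.z ^ f * Y' L) := Nat.mul_le_mul_left _ (hb L)

theorem CostLE.small_loop {v b : Var} (hY : ∀ L, 1 ≤ Y L) (h : CostLE p e Y)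
    (hb : ∀ L : Lim, L.bounds.reg b + 1 ≤ L.z) : CostLE (.loop v b p) (e + 1) Y :=
  h.loop hY fun L => by
    rw [pow_succ', mul_assoc]
    exact Nat.mul_le_mul_right _ (hb L)

theorem CostLE.big_loop {v b : Var} (hY : ∀ L, 1 ≤ Y L) (h : CostLE p e Y)
    (hb : ∀ L : Lim, (L.bounds.reg b + 1) * Y L ≤ Y' L) : CostLE (.loop v b p) e Y' :=
  h.loop hY fun L => by
    rw [mul_left_comm]
    exact Nat.mul_le_mul_left _ (hb L)

theorem CostLE.nn_loop {v : Var} (hY : ∀ L, 1 ≤ Y L) (h : CostLE p e Y) :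
    CostLE (.loop v .nn p) (e + 2) Y :=
  h.loop hY fun L => by
    rw [pow_add, mul_comm (L.z ^ e) (L.z ^ 2), mul_assoc]
    refine Nat.mul_le_mul_right _ ?_
    have h1 : L.n + 1 ≤ L.z := by unfold Lim.z; omega
    change L.n * L.n + 1 ≤ L.z ^ 2
    nlinarith

theorem Lim.n_lt (L : Lim) : L.bounds.reg .n + 1 ≤ L.z := by
  change L.n + 1 ≤ L.z
  unfold Lim.z; omega

theorem Lim.q_lt (L : Lim) : L.bounds.reg .q + 1 ≤ L.z := by
  change L.q + 1 ≤ L.z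
  unfold Lim.z; omega

theorem Lim.k_lt (L : Lim) : L.bounds.reg .k + 1 ≤ L.z := by
  change L.k + 1 ≤ L.z
  unfold Lim.z; omega

theorem Lim.nq_lt (L : Lim) : L.bounds.reg .nq + 1 ≤ L.z := by
  change L.nq + 1 ≤ L.z
  unfold Lim.z; omega

theorem Lim.R_lt (L : Lim) : L.bounds.reg .R + 1 ≤ L.z := by
  change L.R + 1 ≤ L.z
  unfold Lim.z; omega

theorem Lim.s_lt (L : Lim) : L.bounds.reg .s + 1 ≤ L.z := by
  change L.s + 1 ≤ L.z
  unfold Lim.z; omega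

theorem Lim.three_lt (L : Lim) : L.bounds.reg .three + 1 ≤ L.z := by
  change 3 + 1 ≤ L.z
  unfold Lim.z; omega

theorem powProg_cost {v base ex : Var} (h : ∀ L : Lim, L.bounds.reg ex + 1 ≤ L.z) :
    CostLE (powProg v base ex) 1 1 :=
  .seq (.assign fun _ => le_rfl) (.small_loop (e := 0) (fun _ => le_rfl) (.assign fun _ => le_rfl) h)

theorem digitsProg_cost {cnt : Var} {off : E} (h : ∀ L : Lim, L.bounds.reg cnt + 1 ≤ L.z) :
    CostLE (digitsProg cnt off) 1 1 :=
  .small_loop (e := 0) (fun _ => le_rfl)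
    (.seq (.store fun _ => le_rfl) (.assign fun _ => le_rfl)) h

theorem tupleProg_cost : CostLE tupleProg 2 1 :=
  have h1 : ∀ L : Lim, 1 ≤ (1 : Lim → ℕ) L := fun _ => le_rfl
  .seq (.assign h1) <| .seq (.assign h1) <| .small_loop (e := 1) h1
    (.small_loop (e := 0) h1 (.seq (.assign h1) (.ite h1 (.assign h1) (.assign h1)))
      fun L => L.q_lt) fun L => L.q_lt

theorem bruteProg_cost : CostLE bruteProg 2 fun L => L.N + 1 :=
  have h1 : ∀ L : Lim, 1 ≤ (1 : Lim → ℕ) L := fun _ => le_rfl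
  have hN : ∀ L : Lim, 1 ≤ L.N + 1 := fun _ => Nat.le_add_left _ _
  .seq ((powProg_cost fun L => L.q_lt).mono (by omega) hN) <| .seq (.assign hN) <|
    .big_loop (e := 2) h1
      (.seq (.assign h1) <| .seq ((digitsProg_cost fun L => L.q_lt).mono (by omega) h1) <|
        .seq tupleProg_cost <| .ite h1 (.ite h1 (.assign h1) (.skip h1)) (.skip h1))
      fun _ => (mul_one _).le

theorem primeProg_cost : CostLE primeProg 1 fun L => (L.D + 1) * (L.D + 1) :=
  have h1 : ∀ L : Lim, 1 ≤ (1 : Lim → ℕ) L := fun _ => le_rfl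
  have hD : ∀ L : Lim, 1 ≤ L.D + 1 := fun _ => Nat.le_add_left _ _
  .big_loop (e := 1) hD (.seq (.assign hD) <| .seq (.assign hD) <| .seq
    (.loop (e := 0) h1 (.ite h1 (.ite h1 (.skip h1) (.assign h1)) (.skip h1)) fun L => by
      change (2 * L.D + 1) * (_ * 1) ≤ _
      have : 2 ≤ L.z := by unfold Lim.z; omega
      rw [pow_zero, pow_one]
      nlinarith)
    (.ite hD (.assign hD) (.skip hD))) fun _ => le_rfl

theorem sizeProg_cost : CostLE sizeProg 1 1 :=
  have h1 : ∀ L : Lim, 1 ≤ (1 : Lim → ℕ) L := fun _ => le_rfl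
  .seq (.assign h1) <| .seq (.assign h1) <| .seq (.assign h1) <| .seq (.assign h1) <|
    .small_loop (e := 0) h1 (.ite h1
      (.seq (.assign h1) <| .seq (.assign h1) <| .seq (.assign h1) (.assign h1)) (.skip h1))
      fun L => L.nq_lt

theorem edgeProg_cost : CostLE edgeProg 2 fun L => L.W + 1 :=
  have h1 : ∀ L : Lim, 1 ≤ (1 : Lim → ℕ) L := fun _ => le_rfl
  have hW : ∀ L : Lim, 1 ≤ L.W + 1 := fun _ => Nat.le_add_left _ _
  .nn_loop (e := 0) hW (.ite hW (.seq (.assign hW) <| .seq (.assign hW) <| .seq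
    (.big_loop h1 (.assign h1) fun _ => (mul_one _).le) (.store hW)) (.store hW))

theorem entryProg_cost : CostLE entryProg 2 1 :=
  have h1 : ∀ L : Lim, 1 ≤ (1 : Lim → ℕ) L := fun _ => le_rfl
  .seq (.assign h1) <| .seq ((digitsProg_cost fun L => L.k_lt).mono (by omega) h1) <|
    .seq (.assign h1) <| .seq ((digitsProg_cost fun L => L.k_lt).mono (by omega) h1) <|
    .seq (.assign h1) <| .small_loop (e := 1) h1
      (.seq (.small_loop (e := 0) h1 (.assign h1) fun L => L.q_lt)
        (.small_loop (e := 0) h1 (.assign h1) fun L => L.k_lt)) fun L => L.k_lt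

theorem positionProg_cost : CostLE positionProg 1 1 :=
  have h1 : ∀ L : Lim, 1 ≤ (1 : Lim → ℕ) L := fun _ => le_rfl
  .seq (.assign h1) <| .seq (.assign h1) <| .seq (.assign h1) <| .seq (.assign h1) <|
    .small_loop (e := 0) h1 (.seq (.assign h1) <| .seq (.assign h1) <| .seq (.assign h1) <|
      .seq (.assign h1) (.assign h1)) fun L => L.nq_lt

theorem matrixProg_cost : CostLE matrixProg 2 fun L => L.sN + 1 :=
  have h1 : ∀ L : Lim, 1 ≤ (1 : Lim → ℕ) L := fun _ => le_rfl
  .big_loop (e := 2) h1 (.seq (positionProg_cost.mono (by omega) h1) <|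
    .ite h1 (.seq entryProg_cost (.store h1)) (.store h1)) fun _ => (mul_one _).le

theorem passProg_cost : CostLE passProg 2 fun L => L.rN + 1 :=
  have h1 : ∀ L : Lim, 1 ≤ (1 : Lim → ℕ) L := fun _ => le_rfl
  have hr : ∀ L : Lim, 1 ≤ L.rN + 1 := fun _ => Nat.le_add_left _ _
  .seq (.assign hr) <| .seq (.big_loop (e := 2) h1 (.small_loop (e := 1) h1
      (.seq (.assign h1) <| .seq (.small_loop (e := 0) h1 (.assign h1) fun L => L.s_lt) (.store h1))
      fun L => L.R_lt) fun _ => (mul_one _).le) <|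
    .seq (.assign hr) (.big_loop h1 (.store h1) fun _ => (mul_one _).le)

theorem transformProg_cost : CostLE transformProg 3 fun L => L.rN + 1 :=
  have hr : ∀ L : Lim, 1 ≤ L.rN + 1 := fun _ => Nat.le_add_left _ _
  .seq (.assign hr) (.small_loop hr passProg_cost fun L => L.nq_lt)

theorem evalProg_cost : CostLE evalProg 4 fun L => L.W + L.rN + L.sN + 1 :=
  have h1 : ∀ L : Lim, 1 ≤ (1 : Lim → ℕ) L := fun _ => le_rfl
  have hY : ∀ L : Lim, 1 ≤ L.W + L.rN + L.sN + 1 := fun _ => Nat.le_add_left _ _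
  have hr : ∀ L : Lim, L.rN + 1 ≤ L.W + L.rN + L.sN + 1 := fun _ => by omega
  have hr' : ∀ L : Lim, (L.rN + 1) * 1 ≤ L.W + L.rN + L.sN + 1 := fun _ => by omega
  .seq (edgeProg_cost.mono (by omega) fun _ => by omega) <|
    .seq (.big_loop h1 (.store h1) hr') <|
    .seq (.small_loop hY (.seq (matrixProg_cost.mono (by omega) fun _ => by omega) <|
      .seq (transformProg_cost.mono le_rfl hr) (.big_loop h1 (.store h1) hr')) fun L => L.three_lt) <|
    .seq (.assign hY) (.big_loop h1 (.assign h1) hr')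

/-- The part of the running time that is not polynomial in the input size. -/
def Lim.work (L : Lim) : ℕ := (L.D + 2) * (L.D + L.W + L.rN + L.sN + 1)

theorem Lim.one_le_work (L : Lim) : 1 ≤ L.work := Nat.mul_pos (by omega) (by omega)

theorem differenceProg_cost : CostLE differenceProg 0 Lim.work :=
  have h1 : ∀ L : Lim, 1 ≤ (1 : Lim → ℕ) L := fun _ => le_rfl
  have hD : ∀ L : Lim, 1 ≤ L.D + 1 := fun _ => Nat.le_add_left _ _
  .seq (.assign Lim.one_le_work) <| .big_loop hD
    (.seq (.ite hD (.assign hD) (.skip hD)) (.big_loop h1 (.store h1) fun _ => (mul_one _).le))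
    fun L => by
      change (L.D + 1 + 1) * (L.D + 1) ≤ (L.D + 2) * _
      exact Nat.mul_le_mul_left _ (by omega)

/-- The `D + 1` evaluations contribute the product of `D` with `W + rN + sN`; trial division and the
difference table contribute the square of `D`. `Lim.work` covers both. -/
theorem fastProg_cost : CostLE fastProg 4 Lim.work :=
  have hw := Lim.one_le_work
  have hY : ∀ L : Lim, 1 ≤ L.W + L.rN + L.sN + 1 := fun _ => Nat.le_add_left _ _
  .seq (.assign hw) <| .seq (.assign hw) <|
    .seq (primeProg_cost.mono (by omega) fun L => Nat.mul_le_mul (by omega) (by omega)) <|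
    .seq (.assign hw) <| .seq ((powProg_cost fun L => L.nq_lt).mono (by omega) hw) <|
    .seq (sizeProg_cost.mono (by omega) hw) <|
    .seq (.big_loop hY (.seq evalProg_cost (.store hY)) fun L => by
      change (L.D + 1 + 1) * _ ≤ (L.D + 2) * _
      exact Nat.mul_le_mul_left _ (by omega)) (differenceProg_cost.mono (by omega) fun _ => le_rfl)

theorem optProg_cost : CostLE optProg 4 fun L => L.N + L.work :=
  have h1 : ∀ L : Lim, 1 ≤ (1 : Lim → ℕ) L := fun _ => le_rfl
  have hY : ∀ L : Lim, 1 ≤ L.N + L.work := fun L => le_add_left L.one_le_work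
  .seq (.mono (.small_loop (e := 1) h1 (.small_loop (e := 0) h1 (.store h1) fun L => L.n_lt)
      fun L => L.n_lt) (by omega) hY) <|
    .ite hY (bruteProg_cost.mono (by omega) fun L => Nat.add_le_add_left L.one_le_work _)
      (fastProg_cost.mono le_rfl fun _ => Nat.le_add_left _ _)

theorem solveProg_cost : CostLE solveProg 5 fun L => L.N + L.work :=
  have h1 : ∀ L : Lim, 1 ≤ (1 : Lim → ℕ) L := fun _ => le_rfl
  have hY : ∀ L : Lim, 1 ≤ L.N + L.work := fun L => le_add_left L.one_le_work
  have ho : CostLE optProg 5 fun L => L.N + L.work := optProg_cost.mono (by omega) fun _ => le_rfl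
  have hl : ∀ {i x : E} {a : Arr}, CostLE (.loop .i .n (.store a i x)) 5 fun L => L.N + L.work :=
    .mono (.small_loop (e := 0) h1 (.store h1) fun L => L.n_lt) (by omega) hY
  .seq (.assign hY) <| .seq (.assign hY) <|
    .seq ((powProg_cost fun L => L.k_lt).mono (by omega) hY) <| .seq hl <|
    .seq ho <| .seq (.assign hY) <| .ite hY
      (.seq (.small_loop hY (.seq (.store hY) <| .seq optProg_cost <|
        .ite hY (.store hY) (.skip hY)) fun L => L.n_lt) <|
        .seq (.store hY) <| .seq hl (.assign hY))
      (.seq (.store hY) (.assign hY))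

theorem storeList_cost (f : ℕ → ℤ) (N e : ℕ) (hY : ∀ L, 1 ≤ Y L) : CostLE (storeList f N) e Y := by
  induction N with
  | zero => exact .skip hY
  | succ N ih => exact .seq ih (.seq (.store hY) (.store hY))

theorem mainProg_cost (d : MatMul.Decomposition) (obj : WeightedClique.Objective) :
    CostLE (mainProg d obj) 5 fun L => L.N + L.work :=
  have h1 : ∀ L : Lim, 1 ≤ (1 : Lim → ℕ) L := fun _ => le_rfl
  have hY : ∀ L : Lim, 1 ≤ L.N + L.work := fun L => le_add_left L.one_le_work
  have ha : CostLE (adjEntry obj) 0 1 := match obj with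
    | .maximize => .store h1
    | .minimize => .ite h1 (.store h1) (.store h1)
  have hsetup : CostLE (setupProg d obj) 2 1 :=
    .seq (.assign h1) <| .seq (.assign h1) <| .seq (.assign h1) <| .seq (.assign h1) <|
      .seq (.assign h1) <| .seq (.assign h1) <| .seq (.assign h1) <| .seq (.assign h1) <|
      .seq (storeList_cost _ _ _ h1) <| .seq (.assign h1) <|
      .seq (.nn_loop h1 (.ite h1 (.assign h1) (.skip h1))) (.nn_loop h1 ha)
  .seq (hsetup.mono (by omega) hY) <| .ite hY (.seq (.store hY) (.assign hY)) solveProg_cost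

end CliqueAlg

/-! ### Choice of the limits and the resulting bound for the number of steps. -/

namespace CliqueAlg

open LoopLang

variable {d : MatMul.Decomposition} {τ : ℝ}

/-- Minimality of `m = levels d.g N` gives `g ^ m ≤ g * N`, and `R ^ m ≤ (g ^ m) ^ τ`. Rounding the
size up to a power of `g` therefore costs only the constant `g ^ τ`. -/
theorem rank_pow_le (hd : (d.R : ℝ) ≤ (d.g : ℝ) ^ τ) (hτ : 0 ≤ τ) {N : ℕ} (hN : 1 ≤ N) :
    ((d.R ^ levels d.g N : ℕ) : ℝ) ≤ (d.g : ℝ) ^ τ * (N : ℝ) ^ τ := by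
  have hg := d.two_le
  have h1 : d.g ^ levels d.g N ≤ d.g * N := by
    by_cases h : 1 < N
    · have h2 := Nat.pow_pred_clog_lt_self (b := d.g) (by omega) h
      have h3 : 0 < Nat.clog d.g N := Nat.clog_pos (by omega) h
      rw [levels, ← Nat.succ_pred_eq_of_pos h3, pow_succ']
      exact Nat.mul_le_mul_left _ h2.le
    · have : N = 1 := by omega
      subst this
      simp [levels]
      omega
  calc ((d.R ^ levels d.g N : ℕ) : ℝ) = (d.R : ℝ) ^ levels d.g N := by push_cast; rfl
    _ ≤ ((d.g : ℝ) ^ τ) ^ levels d.g N := by gcongr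
    _ = ((d.g : ℝ) ^ levels d.g N) ^ τ := by
        rw [← Real.rpow_natCast, ← Real.rpow_natCast, ← Real.rpow_mul (by positivity),
          ← Real.rpow_mul (by positivity), mul_comm]
    _ ≤ ((d.g : ℝ) * N) ^ τ := by
        refine Real.rpow_le_rpow (by positivity) ?_ hτ
        exact_mod_cast h1
    _ = (d.g : ℝ) ^ τ * (N : ℝ) ^ τ := Real.mul_rpow (by positivity) (by positivity)

/-- The exponent of the common limit for all numbers. -/
def bitBound (d : MatMul.Decomposition) (l : ℕ) : ℕ := (coefBound d + 6) * l ^ 2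

theorem le_two_pow_bitBound {l x e : ℕ} (hx : x ≤ 2 ^ e) (he : e ≤ bitBound d l) :
    x ≤ 2 ^ bitBound d l :=
  hx.trans (Nat.pow_le_pow_right (by omega) he)

/-- What the limits of an instance with input size `l` satisfy. -/
structure Lim.Suits (L : Lim) (d : MatMul.Decomposition) (n k w l : ℕ) : Prop where
  setup : L.FitsSetup d n (3 * k) w
  opt : 3 * k ≤ n → L.FitsOpt d n k w
  U_eq : L.U = 2 ^ bitBound d l
  reg_le : ∀ v, L.bounds.reg v ≤ L.U
  z_le : L.z ≤ (d.R + d.g * d.g + 9) * l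

theorem Lim.reg_le_of {L : Lim} (hn : L.n * L.n ≤ L.U) (hq : L.q ≤ L.U) (hk : L.k ≤ L.U)
    (hN : L.N ≤ L.U) (hD : 2 * L.D ≤ L.U) (hD' : L.D + 1 ≤ L.U) (hnq : L.nq ≤ L.U) (hW : L.W ≤ L.U)
    (hr : L.rN ≤ L.U) (hs : L.sN ≤ L.U) (hR : L.R ≤ L.U) (hs' : L.s ≤ L.U) (h3 : 3 ≤ L.U)
    (v : Var) : L.bounds.reg v ≤ L.U := by
  have := Nat.le_mul_self L.n
  cases v <;> simp only [Lim.bounds] <;> omega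

section Cases

variable {n k w l : ℕ}

/-- No search takes place, so all limits concerning it can be `0`; then `work` is `(0 + 2) * 1`. -/
theorem exists_lim_large_clique (hn : 1 ≤ n) (hl : n * n + 2 ≤ l) (hk : 3 * k < 2 ^ l)
    (hw : w < 2 ^ l) (hq : n < 3 * k) :
    ∃ L : Lim, L.Suits d n k w l ∧ L.N + L.work = 2 := by
  have hgR := ge_mul_self d
  have hll : l ≤ l ^ 2 := Nat.le_self_pow (by omega) l
  have hE : coefBound d ≤ bitBound d l := by unfold bitBound; nlinarith
  have hE' : l ≤ bitBound d l := by unfold bitBound; nlinarith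
  have hc : coefBound d ≤ 2 ^ bitBound d l := le_two_pow_bitBound Nat.lt_two_pow_self.le hE
  have hl2 : l ≤ 2 ^ bitBound d l := le_two_pow_bitBound Nat.lt_two_pow_self.le hE'
  have hk' := le_two_pow_bitBound hk.le hE'
  have hw' := le_two_pow_bitBound hw.le hE'
  have hRc : d.R ≤ coefBound d := by unfold coefBound; omega
  have := Nat.le_mul_self n
  refine ⟨⟨n, 0, 0, 0, 0, 0, 0, 0, 0, d.R, d.g * d.g, 2 ^ bitBound d l⟩, ⟨?_, ?_, rfl, ?_, ?_⟩, rfl⟩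
  · exact ⟨le_rfl, le_rfl, le_rfl, hc, by dsimp only; omega, hk', hw'⟩
  · intro h; omega
  · apply Lim.reg_le_of <;> dsimp only <;> omega
  · simp only [Lim.z]
    nlinarith

theorem pow_le_two_pow (hl : n * n + 2 ≤ l) {q : ℕ} (hq : q ≤ n) : n ^ q ≤ 2 ^ l := by
  calc n ^ q ≤ (2 ^ n) ^ q := Nat.pow_le_pow_left Nat.lt_two_pow_self.le _
    _ = 2 ^ (n * q) := (pow_mul _ _ _).symm
    _ ≤ 2 ^ l := Nat.pow_le_pow_right (by omega) (by nlinarith)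

theorem weight_le_two_pow (hk : 3 * k < 2 ^ l) (hw : w < 2 ^ l) :
    3 * k * (3 * k) * w + 1 ≤ 2 ^ (3 * l) := by
  have h1 : 3 * k * (3 * k) * w ≤ (2 ^ l - 1) * (2 ^ l) * 2 ^ l := by
    gcongr
    omega
  have h2 : 2 ^ (3 * l) = (2 ^ l - 1) * (2 ^ l) * 2 ^ l + 2 ^ l * 2 ^ l := by
    obtain ⟨a, ha⟩ : ∃ a, 2 ^ l = a + 1 := ⟨2 ^ l - 1, by omega⟩
    rw [mul_comm 3 l, pow_mul, ha]
    simp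
    ring
  have h3 : 1 ≤ 2 ^ l * 2 ^ l := Nat.mul_pos (by positivity) (by positivity)
  omega

theorem exists_lim_large_weight (hn : 1 ≤ n) (hl : n * n + 2 ≤ l) (hk : 3 * k < 2 ^ l)
    (hw : w < 2 ^ l) (hq : 3 * k ≤ n) (hbig : n ^ k < w) :
    ∃ L : Lim, L.Suits d n k w l ∧ L.N + L.work = n ^ (3 * k) + 2 := by
  have hgR := ge_mul_self d
  have hll : l ≤ l ^ 2 := Nat.le_self_pow (by omega) l
  have hE : coefBound d ≤ bitBound d l := by unfold bitBound; nlinarith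
  have hE' : 3 * l ≤ bitBound d l := by unfold bitBound; nlinarith
  have hE1 : l ≤ bitBound d l := by omega
  have hc : coefBound d ≤ 2 ^ bitBound d l := le_two_pow_bitBound Nat.lt_two_pow_self.le hE
  have hl2 : l ≤ 2 ^ bitBound d l := le_two_pow_bitBound Nat.lt_two_pow_self.le hE1
  have hk' := le_two_pow_bitBound hk.le hE1
  have hw' := le_two_pow_bitBound hw.le hE1
  have hv := le_two_pow_bitBound (weight_le_two_pow hk hw) hE'
  have hN := le_two_pow_bitBound (pow_le_two_pow hl hq) hE1
  have hN' := le_two_pow_bitBound (pow_le_two_pow hl (q := k) (by omega)) hE1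
  have hRc : d.R ≤ coefBound d := by unfold coefBound; omega
  have := Nat.le_mul_self n
  refine ⟨⟨n, 3 * k, k, n ^ (3 * k), 0, 0, 0, 0, 0, d.R, d.g * d.g, 2 ^ bitBound d l⟩,
    ⟨?_, ?_, rfl, ?_, ?_⟩, rfl⟩
  · exact ⟨le_rfl, le_rfl, le_rfl, hc, by dsimp only; omega, hk', hw'⟩
  · intro _
    exact ⟨le_rfl, le_rfl, hk', by dsimp only; omega, hN', hw', hv, fun _ => ⟨le_rfl, hN⟩,
      fun h => by omega⟩
  · apply Lim.reg_le_of <;> dsimp only <;> omega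
  · simp only [Lim.z]
    nlinarith

/-- The modulus determines the bit length: it is at most the power of a number of `O(l)` bits with
an exponent below `l`, which accounts for the square in `bitBound`. The rank power needs `O(l)` bits
for a fixed decomposition. -/
theorem exists_lim_small_weight (hn : 1 ≤ n) (hl : n * n + 2 ≤ l) (hk : 3 * k < 2 ^ l)
    (hw : w < 2 ^ l) (hq : 3 * k ≤ n) (hsmall : w ≤ n ^ k) :
    ∃ L : Lim, L.Suits d n k w l ∧ L.N + L.work = (degreeBound d k w + 2) *
      (degreeBound d k w + w + d.R ^ levels d.g (n ^ k) +
        (d.g * d.g) ^ levels d.g (n ^ k) + 1) := by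
  have hgR := ge_mul_self d
  have hll : l * 2 ≤ l ^ 2 := by rw [pow_two]; exact Nat.mul_le_mul_left _ (by omega)
  have hE : coefBound d ≤ bitBound d l := by unfold bitBound; nlinarith
  have hE' : 3 * l ≤ bitBound d l := by unfold bitBound; nlinarith
  have hE1 : l ≤ bitBound d l := by omega
  have hc : coefBound d ≤ 2 ^ bitBound d l := le_two_pow_bitBound Nat.lt_two_pow_self.le hE
  have hl2 : l ≤ 2 ^ bitBound d l := le_two_pow_bitBound Nat.lt_two_pow_self.le hE1
  have hk' := le_two_pow_bitBound hk.le hE1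
  have hw' := le_two_pow_bitBound hw.le hE1
  have hv := le_two_pow_bitBound (weight_le_two_pow hk hw) hE'
  have hN' := le_two_pow_bitBound (pow_le_two_pow hl (q := k) (by omega)) hE1
  have hRc : d.R ≤ coefBound d := by unfold coefBound; omega
  have hDc : d.D ≤ coefBound d := by unfold coefBound; omega
  have hnn := Nat.le_mul_self n
  have hnq : n * (3 * k) + 1 < l := by
    have := Nat.mul_le_mul_left n hq
    omega
  have hm : levels d.g (n ^ k) ≤ l := (levels_le d.two_le).trans hnq.le
  have hrN : d.R ^ levels d.g (n ^ k) ≤ 2 ^ bitBound d l := by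
    refine le_two_pow_bitBound (e := d.R * l) ?_ ?_
    · rw [pow_mul]
      calc d.R ^ levels d.g (n ^ k) ≤ (2 ^ d.R) ^ levels d.g (n ^ k) :=
            Nat.pow_le_pow_left Nat.lt_two_pow_self.le _
        _ ≤ (2 ^ d.R) ^ l := Nat.pow_le_pow_right (by positivity) hm
    · unfold bitBound
      exact Nat.mul_le_mul (by omega) (by omega)
  have hsN : (d.g * d.g) ^ levels d.g (n ^ k) ≤ 2 ^ bitBound d l :=
    (Nat.pow_le_pow_left hgR _).trans hrN
  have hD : 2 * (degreeBound d k w + 1) ≤ 2 ^ (3 * l + d.D + 3) := by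
    have h1 := weight_le_two_pow hk hw
    have h2 : d.D + 1 ≤ 2 ^ d.D := Nat.lt_two_pow_self
    have h3 : 2 ^ (3 * l + d.D + 3) = 8 * (2 ^ (3 * l) * 2 ^ d.D) := by
      rw [pow_add, pow_add]; ring
    have h4 : 2 ^ (3 * l) ≤ 2 ^ (3 * l) * 2 ^ d.D := Nat.le_mul_of_pos_right _ (by positivity)
    have h5 : 2 ^ d.D ≤ 2 ^ (3 * l) * 2 ^ d.D := Nat.le_mul_of_pos_left _ (by positivity)
    unfold degreeBound
    omega
  have hDE : 3 * l + d.D + 3 ≤ (coefBound d + 6) * l := by nlinarith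
  have hDE' : 3 * l + d.D + 3 ≤ bitBound d l :=
    hDE.trans (by unfold bitBound; exact Nat.mul_le_mul_left _ (by omega))
  have hD2 := le_two_pow_bitBound hD hDE'
  have hM : (2 * degreeBound d k w) ^ (n * (3 * k) + 1) ≤ 2 ^ bitBound d l := by
    calc (2 * degreeBound d k w) ^ (n * (3 * k) + 1)
        ≤ (2 ^ ((coefBound d + 6) * l)) ^ (n * (3 * k) + 1) := by
          refine Nat.pow_le_pow_left (le_trans (by omega) (hD.trans ?_)) _
          exact Nat.pow_le_pow_right (by omega) hDE
      _ ≤ (2 ^ ((coefBound d + 6) * l)) ^ l := Nat.pow_le_pow_right (by positivity) hnq.le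
      _ = 2 ^ bitBound d l := by rw [← pow_mul, bitBound, pow_two, mul_assoc]
  refine ⟨⟨n, 3 * k, k, 0, degreeBound d k w, n * (3 * k) + 1, w, d.R ^ levels d.g (n ^ k),
    (d.g * d.g) ^ levels d.g (n ^ k), d.R, d.g * d.g, 2 ^ bitBound d l⟩,
    ⟨?_, ?_, rfl, ?_, ?_⟩, by simp only [Lim.work, zero_add]⟩
  · exact ⟨le_rfl, le_rfl, le_rfl, hc, by dsimp only; omega, hk', hw'⟩
  · intro _
    refine ⟨le_rfl, le_rfl, hk', by dsimp only; omega, hN', hw', hv, fun h => by omega,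
      fun _ => ⟨le_rfl, le_rfl, le_rfl, le_rfl, le_rfl, le_rfl, hk', ?_, ?_, hw', hrN, ?_, ?_, hM⟩⟩
    all_goals dsimp only; omega
  · apply Lim.reg_le_of <;> dsimp only <;> omega
  · simp only [Lim.z]
    nlinarith

/-- Limits for which the running time is as claimed. -/
theorem exists_lim (hd : (d.R : ℝ) ≤ (d.g : ℝ) ^ τ) (hτ : 2 ≤ τ) :
    ∃ C : ℝ, ∀ n k w l W : ℕ, 1 ≤ n → n * n + 2 ≤ l → 3 * k < 2 ^ l → w < 2 ^ l →
      1 ≤ W → w ≤ 2 * W → ∃ L : Lim, L.Suits d n k w l ∧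
        ((L.N + L.work : ℕ) : ℝ) ≤ C * (l : ℝ) ^ 2 * ((n : ℝ) ^ (τ * k) * W) := by
  set Γ : ℝ := (d.g : ℝ) ^ τ with hΓ
  set c : ℝ := 2 * (d.D + 4) with hcdef
  have hΓ0 : 0 ≤ Γ := by positivity
  have hc0 : 8 ≤ c := by
    have : (0 : ℝ) ≤ d.D := by positivity
    rw [hcdef]; linarith
  refine ⟨4 + c * (c + 2 * Γ + 2), ?_⟩
  intro n k w l W hn hl hk hw hW hwW
  have hn1 : (1 : ℝ) ≤ n := by exact_mod_cast hn
  have hW1 : (1 : ℝ) ≤ W := by exact_mod_cast hW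
  have hl1 : (1 : ℝ) ≤ l := by exact_mod_cast (show 1 ≤ l by omega)
  set T : ℝ := (n : ℝ) ^ (τ * k) with hT
  have hτk : (2 : ℝ) * k ≤ τ * k := by gcongr
  -- Here `2 ≤ τ` is used.
  have hT2 : ((n : ℝ) ^ k) ^ 2 ≤ T := by
    rw [← pow_mul, ← Real.rpow_natCast, hT]
    refine Real.rpow_le_rpow_of_exponent_le hn1 ?_
    push_cast
    linarith
  have hnk1 : (1 : ℝ) ≤ (n : ℝ) ^ k := one_le_pow₀ hn1
  have hnkT : (n : ℝ) ^ k ≤ T := le_trans (by nlinarith) hT2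
  have hT1 : 1 ≤ T := hnk1.trans hnkT
  have hTW : 1 ≤ T * W := one_le_mul_of_one_le_of_one_le hT1 hW1
  have hwR : (w : ℝ) ≤ 2 * W := by exact_mod_cast hwW
  have hl2 : (1 : ℝ) ≤ (l : ℝ) ^ 2 := one_le_pow₀ hl1
  have hbase : 4 * (T * W) ≤ (4 + c * (c + 2 * Γ + 2)) * (l : ℝ) ^ 2 * (T * W) := by
    have h1 : 0 ≤ c * (c + 2 * Γ + 2) := by positivity
    have h2 : (4 : ℝ) ≤ (4 + c * (c + 2 * Γ + 2)) * (l : ℝ) ^ 2 := by nlinarith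
    exact mul_le_mul_of_nonneg_right h2 (by positivity)
  by_cases hq : n < 3 * k
  · obtain ⟨L, hL, e⟩ := exists_lim_large_clique (d := d) hn hl hk hw hq
    refine ⟨L, hL, le_trans ?_ hbase⟩
    rw [e]
    push_cast
    linarith
  by_cases hbig : n ^ k < w
  · obtain ⟨L, hL, e⟩ := exists_lim_large_weight (d := d) hn hl hk hw (by omega) hbig
    refine ⟨L, hL, le_trans ?_ hbase⟩
    rw [e]
    have hb : (n : ℝ) ^ k ≤ w := by exact_mod_cast hbig.le
    -- One factor `n ^ k` of the exhaustive search is paid for by the weight, `n ^ k < w ≤ 2 * W`,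
    -- and the other two by `T`.
    have h1 : (n : ℝ) ^ (3 * k) = ((n : ℝ) ^ k) ^ 2 * (n : ℝ) ^ k := by
      rw [mul_comm, pow_mul]; ring
    have h2 : ((n : ℝ) ^ k) ^ 2 * (n : ℝ) ^ k ≤ T * (2 * W) :=
      mul_le_mul hT2 (hb.trans hwR) (by positivity) (by positivity)
    push_cast
    rw [h1]
    linarith
  · obtain ⟨L, hL, e⟩ := exists_lim_small_weight (d := d) hn hl hk hw (by omega) (by omega)
    refine ⟨L, hL, ?_⟩
    rw [e]
    have hkl : 3 * k * (3 * k) + 2 ≤ l := by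
      have : 3 * k * (3 * k) ≤ n * n := Nat.mul_le_mul (by omega) (by omega)
      omega
    have hklR : (3 * k * (3 * k) : ℝ) + 2 ≤ l := by exact_mod_cast hkl
    have hws : (w : ℝ) ≤ (n : ℝ) ^ k := by exact_mod_cast (show w ≤ n ^ k by omega)
    have hDdef : ((degreeBound d k w : ℕ) : ℝ) = 3 * k * (3 * k) * w + d.D + 1 := by
      unfold degreeBound; push_cast; ring
    have hdD : (0 : ℝ) ≤ d.D := by positivity
    have hw0 : (0 : ℝ) ≤ w := by positivity
    -- Applied with `x = W` to the first factor of the work and with `x = T` to the second. The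
    -- latter is legitimate because `w ≤ n ^ k ≤ T`, and it keeps the square of the degree bound
    -- within `T * W` up to a factor polynomial in `l`.
    have hdeg : ∀ x : ℝ, 1 ≤ x → (w : ℝ) ≤ 2 * x →
        ((degreeBound d k w : ℕ) : ℝ) + 2 ≤ c * l * x := fun x hx hwx => by
      have h1 : (3 * k * (3 * k) : ℝ) * w ≤ l * (2 * x) :=
        mul_le_mul (by linarith) hwx hw0 (by linarith)
      have h2 : 1 ≤ l * x := one_le_mul_of_one_le_of_one_le hl1 hx
      have h3 : (d.D + 3 : ℝ) * 1 ≤ (d.D + 3) * (l * x) :=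
        mul_le_mul_of_nonneg_left h2 (by linarith)
      rw [hDdef, hcdef]
      nlinarith
    have hrank := rank_pow_le hd (by linarith) (N := n ^ k) (Nat.one_le_pow _ _ hn)
    have hnkτ : (((n ^ k : ℕ) : ℝ)) ^ τ = T := by
      push_cast
      rw [hT, ← Real.rpow_natCast, ← Real.rpow_mul (by positivity), mul_comm]
    rw [hnkτ] at hrank
    have hsq : (((d.g * d.g) ^ levels d.g (n ^ k) : ℕ) : ℝ) ≤ Γ * T := by
      refine le_trans ?_ hrank
      exact_mod_cast Nat.pow_le_pow_left (ge_mul_self d) _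
    have hA : ((degreeBound d k w : ℕ) : ℝ) + 2 ≤ c * l * W := hdeg W hW1 hwR
    have hB : ((degreeBound d k w : ℕ) : ℝ) + w + (d.R ^ levels d.g (n ^ k) : ℕ) +
        ((d.g * d.g) ^ levels d.g (n ^ k) : ℕ) + 1 ≤ (c + 2 * Γ + 2) * l * T := by
      have h1 := hdeg T hT1 (by linarith)
      have hlT : T ≤ l * T := le_mul_of_one_le_left (by linarith) hl1
      have h2 : Γ * T ≤ Γ * (l * T) := mul_le_mul_of_nonneg_left hlT hΓ0
      have h3 : (w : ℝ) ≤ T := hws.trans hnkT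
      linarith
    have hAB := mul_le_mul hA hB (by positivity) (by positivity)
    refine le_trans (le_of_eq ?_) (hAB.trans ?_)
    · push_cast; ring
    · have : 0 ≤ 4 * (l : ℝ) ^ 2 * (T * W) := by positivity
      nlinarith

end Cases

end CliqueAlg

/-! ### The main theorem -/

namespace CliqueAlg

open LoopLang Finset WeightedClique RAM

theorem length_le_inputSize (l : List ℕ) : l.length ≤ inputSize l := by
  induction l with
  | nil => simp [inputSize]
  | cons x l ih =>
    simp only [inputSize, List.map_cons, List.sum_cons, List.length_cons] at ih ⊢
    omega

theorem size_le_inputSize {l : List ℕ} {x : ℕ} (hx : x ∈ l) : x.size ≤ inputSize l := by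
  have := List.single_le_sum (l := l.map fun x => x.size + 1) (by simp) _ (List.mem_map_of_mem hx)
  unfold inputSize
  omega

section Instance

variable {n : ℕ} (G : SimpleGraph (Fin n)) (w : Sym2 (Fin n) → ℕ) (q : ℕ)

theorem length_encodeInstance : (encodeInstance G w q).length = n * n + 2 := by
  simp [encodeInstance]

theorem isEdgeArray_encodeInstance :
    IsEdgeArray G w univ fun j => (encodeInstance G w q).getD (j + 2) 0 := by
  classical
  intro a b
  have hlt : (a : ℕ) * n + b < n * n := by have := a.2; have := b.2; nlinarith
  have hn : 0 < n := a.pos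
  have hdiv : Fin.divNat (⟨a * n + b, hlt⟩ : Fin (n * n)) = a := by
    ext
    simp only [Fin.divNat]
    rw [mul_comm, Nat.mul_add_div hn, Nat.div_eq_of_lt b.2, add_zero]
  have hmod : Fin.modNat (⟨a * n + b, hlt⟩ : Fin (n * n)) = b := by
    ext
    simp only [Fin.modNat]
    rw [Nat.mul_add_mod', Nat.mod_eq_of_lt b.2]
  have h : (encodeInstance G w q).getD (a * n + b + 2) 0 =
      if G.Adj a b then w s(a, b) + 1 else 0 := by
    rw [List.getD_eq_getElem _ _ (by rw [length_encodeInstance]; omega)]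
    simp [encodeInstance, hdiv, hmod]
  simp only [h, mem_univ, and_true]
  exact ⟨fun hab => if_pos hab, fun hab => if_neg hab⟩

variable {G w q}

theorem maxEntry_lt {l : ℕ} (hl : ∀ x ∈ encodeInstance G w q, x < 2 ^ l) :
    maxEntry n (fun j => (encodeInstance G w q).getD (j + 2) 0) < 2 ^ l := by
  refine (Finset.sup_lt_iff (show (⊥ : ℕ) < 2 ^ l from by simp)).2 fun j hj => ?_
  have hj' : j + 2 < (encodeInstance G w q).length := by
    rw [length_encodeInstance]
    have := mem_range.1 hj
    omega
  rw [List.getD_eq_getElem _ _ hj']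
  exact hl _ (List.getElem_mem hj')

theorem maxEntry_le {W : ℕ} (hw : ∀ e ∈ G.edgeSet, w e ≤ W) :
    maxEntry n (fun j => (encodeInstance G w q).getD (j + 2) 0) ≤ W + 1 := by
  refine Finset.sup_le fun j hj => ?_
  have hjn := mem_range.1 hj
  have hn : 0 < n := by
    rcases Nat.eq_zero_or_pos n with h | h
    · subst h; omega
    · exact h
  have h := isEdgeArray_encodeInstance G w q ⟨j / n, Nat.div_lt_of_lt_mul hjn⟩
    ⟨j % n, Nat.mod_lt _ hn⟩
  simp only [mem_univ, and_true, Nat.div_add_mod'] at h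
  by_cases hab : G.Adj ⟨j / n, Nat.div_lt_of_lt_mul hjn⟩ ⟨j % n, Nat.mod_lt _ hn⟩
  · rw [h.1 hab]
    exact Nat.add_le_add_right (hw _ hab) 1
  · rw [h.2 hab]
    omega

end Instance

theorem length_encodeAnswer_le {n : ℕ} (ans : Option (Finset (Fin n))) :
    (encodeAnswer ans).length ≤ n * n + 2 := by
  have := Nat.le_mul_self n
  cases ans <;> simp [encodeAnswer]
  omega

theorem cast_le_mul_pow {t Q l X : ℕ} {C T : ℝ} (ht : t ≤ Q * l ^ 9 * X)
    (hX : (X : ℝ) ≤ C * (l : ℝ) ^ 2 * T) : (t : ℝ) ≤ Q * C * T * (l : ℝ) ^ 11 := by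
  calc (t : ℝ) ≤ Q * (l : ℝ) ^ 9 * X := by exact_mod_cast ht
    _ ≤ Q * (l : ℝ) ^ 9 * (C * (l : ℝ) ^ 2 * T) := by gcongr
    _ = Q * C * T * (l : ℝ) ^ 11 := by ring

end CliqueAlg

open MatMul RAM WeightedClique in
theorem mainTheorem6 (obj : Objective) (ε : ℝ) (hε : 0 < ε) :
    ∃ (P : Program) (C : ℝ) (c : ℕ),
      ∀ (n k W : ℕ) (G : SimpleGraph (Fin n)) (w : Sym2 (Fin n) → ℕ),
        1 ≤ n → 1 ≤ W → (∀ e ∈ G.edgeSet, w e ≤ W) →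
        ∃ (answer : Option (Finset (Fin n))) (t : ℕ),
          IsAnswer G w (3 * k) obj answer ∧
          P.Computes (encodeInstance G w (3 * k)) (encodeAnswer answer) t ∧
          (t : ℝ) ≤ C * ((n : ℝ) ^ ((omega + ε) * (k : ℝ)) * (W : ℝ)) *
            (inputSize (encodeInstance G w (3 * k)) : ℝ) ^ c := by
  open CliqueAlg LoopLang in
  -- The decomposition depends on `ε` alone and is built into the program as constants, so neither
  -- the program nor the bounds depend on the instance.
  obtain ⟨d, hd⟩ := exists_decomposition_rpow hε
  obtain ⟨C, hlim⟩ := exists_lim hd (by linarith [two_le_omega])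
  obtain ⟨P, K, hP⟩ := exists_program (mainProg d obj) (mainProg_wf d obj) .inp .out .len
  obtain ⟨c₁, hc₁⟩ := mainProg_cost d obj
  set c₀ := coefBound d + 6 with hc₀
  set c₃ := d.R + d.g * d.g + 9 with hc₃
  -- The exponent `11` is `5` from the polynomial part of the step count, `4` from the squared
  -- quadratic bit length and `2` from `exists_lim`.
  refine ⟨P, (K * (c₀ + 2) ^ 2 * (c₁ * c₃ ^ 5 + 11) : ℕ) * C, 11, ?_⟩
  intro n k W G w hn hW hw
  set input := encodeInstance G w (3 * k) with hinput
  set l := inputSize input with hl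
  have hlen : input.length = n * n + 2 := length_encodeInstance G w (3 * k)
  have hnl : n * n + 2 ≤ l := hlen ▸ length_le_inputSize input
  have hsize : ∀ x ∈ input, x < 2 ^ l := fun x hx => Nat.size_le.1 (size_le_inputSize hx)
  have hk : 3 * k < 2 ^ l := hsize _ (by simp [hinput, encodeInstance])
  set ef : ℕ → ℕ := fun j => input.getD (j + 2) 0 with hef
  -- Entries are at most `W + 1`, and this is at most `2 * W` because `1 ≤ W`.
  obtain ⟨L, hL, hwork⟩ := hlim n k (maxEntry n ef) l W hn hnl hk (maxEntry_lt hsize) hW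
    ((maxEntry_le hw).trans (by omega))
  obtain ⟨ans, hans, htr⟩ := mainProg_spec (σ := start .inp input) obj (G := G) (w := w) (ef := ef)
    (by simp [start, hinput, encodeInstance]) (by simp [start, hinput, encodeInstance])
    (fun j => by simp [start, hef]) (isEdgeArray_encodeInstance G w (3 * k)) hn hL.setup hL.opt
  have hlb : l ≤ bitBound d l := by
    have : l ≤ l ^ 2 := Nat.le_self_pow (by omega) l
    unfold bitBound
    nlinarith
  -- The number `2 ^ bitBound d l` itself has one bit more than its exponent.
  have hU : ∀ x ≤ L.U, x.size ≤ bitBound d l + 1 := fun x hx => by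
    refine (Nat.size_le_size hx).trans ?_
    rw [hL.U_eq, Nat.size_pow]
  have hinU : ∀ x ∈ input, x ≤ L.U := fun x hx => by
    rw [hL.U_eq]
    exact (hsize x hx).le.trans (Nat.pow_le_pow_right (by omega) hlb)
  have hnU : n * n + 2 ≤ L.U := by
    rw [hL.U_eq]
    exact hnl.trans (hlb.trans Nat.lt_two_pow_self.le)
  obtain ⟨t, ht, htle⟩ := hP input (encodeAnswer ans) L.bounds (bitBound d l + 1) n
    (by simp [hinput, encodeInstance]) hlen (fun x hx => hU x (hinU x hx)) (hU _ hnU)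
    (fun v => hU _ (hL.reg_le v)) (fun _ => hU _ le_rfl) hinU (length_encodeAnswer_le ans) htr
  refine ⟨ans, t, hans, ht, ?_⟩
  have hX : 1 ≤ L.N + L.work := le_add_left L.one_le_work
  have hl1 : 1 ≤ l := by omega
  have hbits : bitBound d l + 1 + 1 ≤ (c₀ + 2) * l ^ 2 := by
    have : 1 ≤ l ^ 2 := Nat.one_le_pow _ _ hl1
    unfold bitBound
    nlinarith
  have hsteps : (mainProg d obj).steps L.bounds + 6 * (n * n + 2) + 5 ≤
      (c₁ * c₃ ^ 5 + 11) * (l ^ 5 * (L.N + L.work)) := by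
    have h1 : (mainProg d obj).steps L.bounds ≤ c₁ * ((c₃ * l) ^ 5 * (L.N + L.work)) :=
      (hc₁ L).trans (by gcongr; exact hL.z_le)
    have h2 : l * 1 ≤ l ^ 5 * (L.N + L.work) :=
      Nat.mul_le_mul (Nat.le_self_pow (by omega) l) hX
    have h3 : c₁ * ((c₃ * l) ^ 5 * (L.N + L.work)) =
        c₁ * c₃ ^ 5 * (l ^ 5 * (L.N + L.work)) := by ring
    rw [add_mul]
    omega
  have htot : t ≤ K * (c₀ + 2) ^ 2 * (c₁ * c₃ ^ 5 + 11) * l ^ 9 * (L.N + L.work) := by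
    refine htle.trans ?_
    calc K * (bitBound d l + 1 + 1) ^ 2 * ((mainProg d obj).steps L.bounds + 6 * (n * n + 2) + 5)
        ≤ K * ((c₀ + 2) * l ^ 2) ^ 2 * ((c₁ * c₃ ^ 5 + 11) * (l ^ 5 * (L.N + L.work))) := by gcongr
      _ = _ := by ring
  exact cast_le_mul_pow htot hwork
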